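/- **Theorem 1.7.** Define $\phi(1)=1$ and $\phi(m)=1+\frac{1}{1+\frac{1}{\phi(m-1)}}$ for integers $m\ge 2$. Let $n\ge 1$ be an integer, let $I\subset\mathbb{R}$ be a compact interval, and let $f$ be a real-valued real analytic function on an open interval $U\subseteq\mathbb{R}$ that contains the difference set $I-I=\{x-y:x,y\in I\}$. For $d\in\mathbb{R}$ put $\Delta_{d}f(x)=f(x+d)-f(x)$. Suppose that for any $n$ distinct real numbers $\delta_1,\dots,\delta_n$ with $0<\delta_i<\operatorname{diam}(I)$ for all $i$, the functions $\Delta_{\delta_1}f,\dots,\Delta_{\delta_n}f$ are $1$-independent, that is, their derivatives $(\Delta_{\delta_1}f)',\dots,(\Delta_{\delta_n}f)'$ are linearly independent over $\mathbb{R}$ as functions on their common domain $\{x\in U: x+\delta_i\in U\text{ for all } i\}$. Then there is a constant $c>0$, depending only on $f$, $n$ and $I$, such that for every finite set $A\subset I$, $$\bigl|2^{n}f(A-A)-(2^{n}-1)f(A-A)\bigr|\ \ge\ c\,|A|^{1+\phi(n)}.$$ Here $f(A-A)=\{f(x-y):x,y\in A\}$, and for a set $X\subset\mathbb{R}$ and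 integers $k,l\ge 0$, $kX-lX$ denotes the set of all $x_1+\dots+x_k-y_1-\dots-y_l$ with $x_1,\dots,x_k,y_1,\dots,y_l\in X$. -/

import Mathlib

open scoped Pointwise

/-- The exponent sequence: `φ(1) = 1` and `φ(n) = 1 + 1 / (1 + 1 / φ(n-1))` for `n ≥ 2`.
The value at `0` is a placeholder (the sequence starts at `1`). -/
noncomputable def growthExponent : ℕ → ℝ
  | 0 => 1
  | 1 => 1
  | n + 2 => 1 + 1 / (1 + 1 / growthExponent (n + 1))

/-- The discrete derivative `Δ_d f (x) = f (x + d) - f x`. -/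
def discreteDeriv (d : ℝ) (f : ℝ → ℝ) (x : ℝ) : ℝ := f (x + d) - f x

/-- The common domain of the discrete derivatives `Δ_{δ i}` of a function with domain `U`:
the points `x ∈ U` such that all the points `x + δ i` lie in `U`. -/
def commonDomain {ι : Type*} (U : Set ℝ) (δ : ι → ℝ) : Set ℝ :=
  {x | x ∈ U ∧ ∀ i, x + δ i ∈ U}

/-- A family of functions is `k`-independent on `D` if the `k`-th derivatives, as functions
on `D`, are linearly independent over `ℝ`. -/
def KIndependentOn {ι : Type*} (k : ℕ) (D : Set ℝ) (g : ι → ℝ → ℝ) : Prop :=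
  LinearIndependent ℝ (fun i => D.domRestrict (iteratedDeriv k (g i)))

/-- The iterated sum and difference set `k X - l X`: all
`x₁ + ⋯ + x_k - y₁ - ⋯ - y_l` with `x₁, …, x_k, y₁, …, y_l ∈ X`. -/
def sumDiffSet (k l : ℕ) (X : Set ℝ) : Set ℝ :=
  {z | ∃ (x : Fin k → ℝ) (y : Fin l → ℝ), (∀ i, x i ∈ X) ∧ (∀ j, y j ∈ X) ∧
    z = ∑ i, x i - ∑ j, y j}

/-!
The lower bound comes from squeezing small numbers into large gaps, iterated along a recursion in
which each round differentiates discretely once more.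

*Squeezing.* Let `f` be increasing on a set `X` of points whose gaps are at least `Δ`, let
`0 < δ ≤ Δ`, and suppose that `X` and `X + δ` lie in `A - A`. Then every positive number that does not
exceed `Δ_δ f(x)` fits between `f(x)` and the value of `f` at the next point of `X`. If `S` is a set of such
small numbers in `2^m Δ_δ f(Y) - (2^m - 1) Δ_δ f(Y)`, the sums `f(x) + s`, with `x` among the points
at which `Δ_δ f` is largest, are pairwise distinct and lie in
`2^(m+1) f(A - A) - (2^(m+1) - 1) f(A - A)` (`squeeze_core`). It therefore suffices to show that for
one of `n = m + 1` steps `δ_i` the set `2^m Δ_{δ_i} f(Y) - (2^m - 1) Δ_{δ_i} f(Y)` has at least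
`c |Y| ^ φ(n)` elements in the range of `Δ_{δ_i} f` on `Y` (`Rich`). The steps come from `n + 1`
consecutive points of `A` at minimal distance (`exists_sequence_of_cluster`). The points `x` are the
differences between `A` and an end of this cluster; they can be taken large compared with the
`δ_i` and, as `A` may be replaced by its part in a short interval, small in absolute terms.

*Power-like functions.* In this range of `x` the functions `Δ_{δ_i} f` are a triangular transform of
functions whose derivatives are close to `κ z ^ p_i`, with distinct exponents `p_i`, on a complex
neighbourhood of the range (`exists_powerPrimitive_combination`); all constants are uniform in the
steps. To see this, `w = f'` is extended to complex arguments. Gaussian elimination on Taylor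
coefficients yields operators `w^(s+1) + ∑_{i<s} b_i w^(i+1)` whose values at `w` vanish to distinct
orders at `0` (`exists_distinct_leading_terms`). In the Taylor expansion of
`∑_j c_j (w(z + δ_j) - w(z))` the derivatives of `w` are expressed through these values and the first
`s` derivatives; the coefficients `c_j` are chosen so that the latter drop out
(`exists_annihilating_coeff`), and what remains is dominated by its first term
(`exists_combination_relClose`). If one of the operators annihilated `w`, the same
expansion would make a combination of the `(Δ_{δ_i} f)'` vanish, contrary to the independence
hypothesis (`linDiffOp_ne_zero_of_kIndependentOn`).

*Recursion.* Growth for triangular tuples of such functions is proved by induction on their number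
(`exists_rich_of_powerPrimitive`). By Rolle's theorem their combinations are monotone on a positive
proportion of any finite set. If many successive points are far apart in ratio, the gaps
of the first function over a lacunary subset are distinct and the bound is quadratic. Otherwise let
`P` be the number of distinct gaps of the first function. Inserting these gaps gives `|X| P`
elements. A popular gap `d` occurs at least `|X| / P` times, and the increments `g_i(y(z)) - g_i(z)`,
where `y` solves `g_1(y(z)) = g_1(z) + d`, are again power-like with distinct exponents
(`exists_level_map`, `exists_powerPrimitive_increment`), one fewer in number; by induction and
squeezing one obtains `|X| (|X| / P) ^ φ(n - 1)` elements. The recursion for `φ` balances the two bounds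
(`rpow_growthExponent_le_or`).
-/

/-! ### Iterated sum and difference sets -/

theorem sumDiffSet_mono {k l : ℕ} {X Y : Set ℝ} (h : X ⊆ Y) :
    sumDiffSet k l X ⊆ sumDiffSet k l Y := by
  rintro z ⟨x, y, hx, hy, rfl⟩
  exact ⟨x, y, fun i => h (hx i), fun i => h (hy i), rfl⟩

theorem mem_sumDiffSet_one_zero {X : Set ℝ} {x : ℝ} (hx : x ∈ X) : x ∈ sumDiffSet 1 0 X :=
  ⟨fun _ => x, fun _ => x, fun _ => hx, fun _ => hx, by simp⟩

theorem sub_mem_sumDiffSet {X : Set ℝ} {x y : ℝ} (hx : x ∈ X) (hy : y ∈ X) :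
    x - y ∈ sumDiffSet 1 1 X :=
  ⟨fun _ => x, fun _ => y, fun _ => hx, fun _ => hy, by simp⟩

theorem zero_mem_sumDiffSet (X : Set ℝ) : (0 : ℝ) ∈ sumDiffSet 0 0 X :=
  ⟨Fin.elim0, Fin.elim0, fun i => i.elim0, fun i => i.elim0, by simp⟩

theorem add_mem_sumDiffSet {k l k' l' : ℕ} {X : Set ℝ} {z z' : ℝ}
    (hz : z ∈ sumDiffSet k l X) (hz' : z' ∈ sumDiffSet k' l' X) :
    z + z' ∈ sumDiffSet (k + k') (l + l') X := by
  obtain ⟨x, y, hx, hy, rfl⟩ := hz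
  obtain ⟨x', y', hx', hy', rfl⟩ := hz'
  refine ⟨Fin.append x x', Fin.append y y', fun i => ?_, fun i => ?_, ?_⟩
  · refine Fin.addCases (fun j => ?_) (fun j => ?_) i <;> simp [hx, hx']
  · refine Fin.addCases (fun j => ?_) (fun j => ?_) i <;> simp [hy, hy']
  · simp only [Fin.sum_univ_add, Fin.append_left, Fin.append_right]
    ring

theorem neg_mem_sumDiffSet {k l : ℕ} {X : Set ℝ} {z : ℝ} (hz : z ∈ sumDiffSet k l X) :
    -z ∈ sumDiffSet l k X := by
  obtain ⟨x, y, hx, hy, rfl⟩ := hz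
  exact ⟨y, x, hy, hx, by ring⟩

theorem sub_mem_sumDiffSet_add {k l k' l' : ℕ} {X : Set ℝ} {z z' : ℝ}
    (hz : z ∈ sumDiffSet k l X) (hz' : z' ∈ sumDiffSet k' l' X) :
    z - z' ∈ sumDiffSet (k + l') (l + k') X := by
  rw [sub_eq_add_neg]
  exact add_mem_sumDiffSet hz (neg_mem_sumDiffSet hz')

theorem sum_mem_sumDiffSet {V : Set ℝ} (k : ℕ) (x : Fin k → ℝ)
    (hx : ∀ i, x i ∈ sumDiffSet 1 1 V) : ∑ i, x i ∈ sumDiffSet k k V := by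
  induction k with
  | zero => simpa using zero_mem_sumDiffSet V
  | succ k ih =>
    rw [Fin.sum_univ_castSucc]
    exact add_mem_sumDiffSet (ih _ fun i => hx _) (hx _)

theorem sumDiffSet_subset_of_sub {V D : Set ℝ} (hD : D ⊆ sumDiffSet 1 1 V) (k l : ℕ) :
    sumDiffSet k l D ⊆ sumDiffSet (k + l) (k + l) V := by
  rintro z ⟨x, y, hx, hy, rfl⟩
  have := sub_mem_sumDiffSet_add (sum_mem_sumDiffSet k x fun i => hD (hx i))
    (sum_mem_sumDiffSet l y fun i => hD (hy i))
  exact this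

theorem sumDiffSet_finite {k l : ℕ} {X : Set ℝ} (hX : X.Finite) :
    (sumDiffSet k l X).Finite := by
  have h1 : (Set.univ.pi fun _ : Fin k => X).Finite := Set.Finite.pi fun _ => hX
  have h2 : (Set.univ.pi fun _ : Fin l => X).Finite := Set.Finite.pi fun _ => hX
  refine ((h1.prod h2).image fun p => ∑ i, p.1 i - ∑ j, p.2 j).subset ?_
  rintro z ⟨x, y, hx, hy, rfl⟩
  exact ⟨(x, y), ⟨fun i _ => hx i, fun i _ => hy i⟩, rfl⟩

theorem neg_mem_sumDiffSet_neg {k l : ℕ} {X : Set ℝ} {z : ℝ} (hz : z ∈ sumDiffSet k l X) :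
    -z ∈ sumDiffSet k l (-X) := by
  obtain ⟨x, y, hx, hy, rfl⟩ := hz
  exact ⟨fun i => -x i, fun i => -y i, fun i => by simpa using hx i,
    fun i => by simpa using hy i, by simp [Finset.sum_neg_distrib]; ring⟩

/-- Adding a summand `x - x` does not change the represented number. -/
theorem sumDiffSet_subset_succ {k l : ℕ} {X : Set ℝ} (hX : X.Nonempty) :
    sumDiffSet k l X ⊆ sumDiffSet (k + 1) (l + 1) X := by
  intro z hz
  obtain ⟨x, hx⟩ := hX
  simpa using add_mem_sumDiffSet hz (sub_mem_sumDiffSet hx hx)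

theorem sumDiffSet_subset_add {k l : ℕ} {X : Set ℝ} (hX : X.Nonempty) (m : ℕ) :
    sumDiffSet k l X ⊆ sumDiffSet (k + m) (l + m) X := by
  induction m with
  | zero => exact subset_rfl
  | succ m ih => exact ih.trans (sumDiffSet_subset_succ hX)

/-! ### Rich sets and squeezing -/

/-- `Rich m h X M` says that `2^m h(X) - (2^m - 1) h(X)` has at least `M` elements lying between
the smallest and the largest value of `h` on `X`. The confinement to the range of `h` is what
allows such elements to be inserted into gaps. -/
def Rich (m : ℕ) (h : ℝ → ℝ) (X : Finset ℝ) (M : ℝ) : Prop :=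
  ∃ S : Finset ℝ, (S : Set ℝ) ⊆ sumDiffSet (2 ^ m) (2 ^ m - 1) (h '' (X : Set ℝ)) ∧
    (∀ s ∈ S, ∃ x ∈ X, ∃ x' ∈ X, h x ≤ s ∧ s ≤ h x') ∧ M ≤ (S.card : ℝ)

theorem Rich.mono {m : ℕ} {h : ℝ → ℝ} {X Y : Finset ℝ} {M M' : ℝ} (H : Rich m h X M)
    (hXY : X ⊆ Y) (hM : M' ≤ M) : Rich m h Y M' := by
  obtain ⟨S, h1, h2, h3⟩ := H
  refine ⟨S, h1.trans (sumDiffSet_mono (Set.image_mono (by exact_mod_cast hXY))), ?_,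
    hM.trans h3⟩
  intro s hs
  obtain ⟨x, hx, x', hx', hh⟩ := h2 s hs
  exact ⟨x, hXY hx, x', hXY hx', hh⟩

theorem Rich.neg {m : ℕ} {h : ℝ → ℝ} {X : Finset ℝ} {M : ℝ} (H : Rich m h X M) :
    Rich m (fun x => -h x) X M := by
  obtain ⟨S, h1, h2, h3⟩ := H
  classical
  refine ⟨S.image fun x => -x, ?_, ?_, ?_⟩
  · intro z hz
    obtain ⟨s, hs, rfl⟩ := Finset.mem_image.1 (Finset.mem_coe.1 hz)
    have := neg_mem_sumDiffSet_neg (h1 hs)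
    refine sumDiffSet_mono ?_ this
    rintro y hy
    obtain ⟨x, hx, hxy⟩ := hy
    exact ⟨x, hx, by simp [hxy]⟩
  · intro z hz
    obtain ⟨s, hs, rfl⟩ := Finset.mem_image.1 hz
    obtain ⟨x, hx, x', hx', hh⟩ := h2 s hs
    exact ⟨x', hx', x, hx, by linarith, by linarith⟩
  · rwa [Finset.card_image_of_injective _ neg_injective]

theorem Rich.congr {m : ℕ} {h h' : ℝ → ℝ} {X : Finset ℝ} {M : ℝ} (H : Rich m h X M)
    (hh : ∀ x ∈ X, h x = h' x) : Rich m h' X M := by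
  obtain ⟨S, h1, h2, h3⟩ := H
  have him : h '' (X : Set ℝ) = h' '' (X : Set ℝ) := Set.image_congr fun x hx => hh x hx
  refine ⟨S, him ▸ h1, fun s hs => ?_, h3⟩
  obtain ⟨x, hx, x', hx', h4, h5⟩ := h2 s hs
  exact ⟨x, hx, x', hx', hh x hx ▸ h4, hh x' hx' ▸ h5⟩

theorem Rich.level_mono {m m' : ℕ} {h : ℝ → ℝ} {X : Finset ℝ} {M : ℝ} (H : Rich m h X M)
    (hX : X.Nonempty) (hm : m ≤ m') : Rich m' h X M := by
  obtain ⟨S, h1, h2, h3⟩ := H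
  refine ⟨S, h1.trans ?_, h2, h3⟩
  have hne : (h '' (X : Set ℝ)).Nonempty := by simpa using hX
  have h4 : 2 ^ m ≤ 2 ^ m' := Nat.pow_le_pow_right two_pos hm
  have h5 : 1 ≤ 2 ^ m := Nat.one_le_two_pow
  have := sumDiffSet_subset_add (k := 2 ^ m) (l := 2 ^ m - 1) hne (2 ^ m' - 2 ^ m)
  rwa [show 2 ^ m + (2 ^ m' - 2 ^ m) = 2 ^ m' by omega,
    show 2 ^ m - 1 + (2 ^ m' - 2 ^ m) = 2 ^ m' - 1 by omega] at this

theorem rich_zero {h : ℝ → ℝ} {X : Finset ℝ} :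
    Rich 0 h X ((X.image h).card : ℝ) := by
  classical
  refine ⟨X.image h, ?_, ?_, le_rfl⟩
  · intro z hz
    rw [Finset.coe_image] at hz
    exact mem_sumDiffSet_one_zero hz
  · intro s hs
    obtain ⟨x, hx, rfl⟩ := Finset.mem_image.1 hs
    exact ⟨x, hx, x, hx, le_rfl, le_rfl⟩

theorem rich_one_of_nonempty (m : ℕ) {h : ℝ → ℝ} {X : Finset ℝ} (hX : X.Nonempty) {M : ℝ}
    (hM : M ≤ 1) : Rich m h X M := by
  refine (rich_zero.level_mono hX (Nat.zero_le m)).mono subset_rfl (hM.trans ?_)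
  exact_mod_cast Finset.card_pos.2 (hX.image h)

/-- Squeezing: if the values `u x`, `x ∈ B`, are at mutual distance at least `τ`, then the
translates of a set `S ⊆ (0, τ]` to these values are disjoint. -/
theorem squeeze_core {m : ℕ} {V D : Set ℝ} {B S : Finset ℝ} {u : ℝ → ℝ} {τ : ℝ}
    (hu : ∀ x ∈ B, u x ∈ V) (hgap : ∀ x ∈ B, ∀ x' ∈ B, x < x' → u x + τ ≤ u x')
    (hS : ∀ s ∈ S, 0 < s ∧ s ≤ τ) (hSD : (S : Set ℝ) ⊆ sumDiffSet (2 ^ m) (2 ^ m - 1) D)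
    (hD : D ⊆ sumDiffSet 1 1 V) :
    ∃ S' : Finset ℝ, (S' : Set ℝ) ⊆ sumDiffSet (2 ^ (m + 1)) (2 ^ (m + 1) - 1) V ∧
      S'.card = B.card * S.card ∧ ∀ s ∈ S', ∃ x ∈ B, u x ≤ s ∧ s ≤ u x + τ := by
  classical
  refine ⟨(B ×ˢ S).image fun p => u p.1 + p.2, ?_, ?_, ?_⟩
  · intro z hz
    obtain ⟨⟨x, s⟩, hp, rfl⟩ := Finset.mem_image.1 (Finset.mem_coe.1 hz)
    obtain ⟨hx, hs⟩ := Finset.mem_product.1 hp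
    have h1 := sumDiffSet_subset_of_sub hD _ _ (hSD hs)
    have h2 := add_mem_sumDiffSet (mem_sumDiffSet_one_zero (hu x hx)) h1
    have h5 : 1 ≤ 2 ^ m := Nat.one_le_two_pow
    rw [pow_succ]
    rwa [show 1 + (2 ^ m + (2 ^ m - 1)) = 2 ^ m * 2 by omega,
      show 0 + (2 ^ m + (2 ^ m - 1)) = 2 ^ m * 2 - 1 by omega] at h2
  · rw [Finset.card_image_of_injOn, Finset.card_product]
    have key : ∀ x ∈ B, ∀ x' ∈ B, ∀ s ∈ S, ∀ s' ∈ S, x < x' → u x + s < u x' + s' := by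
      intro x hx x' hx' s hs s' hs' hlt
      linarith [hgap x hx x' hx' hlt, (hS s hs).2, (hS s' hs').1]
    rintro ⟨x, s⟩ hp ⟨x', s'⟩ hp' heq
    obtain ⟨hx, hs⟩ := Finset.mem_product.1 (Finset.mem_coe.1 hp)
    obtain ⟨hx', hs'⟩ := Finset.mem_product.1 (Finset.mem_coe.1 hp')
    simp only at heq hx hs hx' hs'
    rcases lt_trichotomy x x' with hlt | rfl | hlt
    · exact absurd heq (key x hx x' hx' s hs s' hs' hlt).ne
    · simpa using heq
    · exact absurd heq (key x' hx' x hx s' hs' s hs hlt).ne'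
  · intro z hz
    obtain ⟨⟨x, s⟩, hp, rfl⟩ := Finset.mem_image.1 hz
    obtain ⟨hx, hs⟩ := Finset.mem_product.1 hp
    exact ⟨x, hx, by linarith [(hS s hs).1], by linarith [(hS s hs).2]⟩

/-! ### Successors and largest values in a finite set -/

open Classical in
/-- The successor of `x` in the finite set `X`; it is `x` itself if no element of `X` exceeds
`x`. -/
noncomputable def nxt (X : Finset ℝ) (x : ℝ) : ℝ :=
  if h : (X.filter fun y => x < y).Nonempty then (X.filter fun y => x < y).min' h else x

theorem nxt_spec {X : Finset ℝ} {x : ℝ} (h : ∃ y ∈ X, x < y) :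
    nxt X x ∈ X ∧ x < nxt X x ∧ ∀ y ∈ X, x < y → nxt X x ≤ y := by
  classical
  have hne : (X.filter fun y => x < y).Nonempty := by
    obtain ⟨y, hy, hxy⟩ := h
    exact ⟨y, Finset.mem_filter.2 ⟨hy, hxy⟩⟩
  have h1 := Finset.min'_mem _ hne
  rw [Finset.mem_filter] at h1
  rw [nxt, dif_pos hne]
  exact ⟨h1.1, h1.2, fun y hy hxy => Finset.min'_le _ _ (Finset.mem_filter.2 ⟨hy, hxy⟩)⟩

open Classical in
/-- The elements of `X` that have a successor in `X`. -/
noncomputable def nonMax (X : Finset ℝ) : Finset ℝ := X.filter fun x => ∃ y ∈ X, x < y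

theorem nonMax_subset (X : Finset ℝ) : nonMax X ⊆ X := by
  classical exact Finset.filter_subset _ _

theorem nxt_mem {X : Finset ℝ} {x : ℝ} (h : x ∈ nonMax X) : nxt X x ∈ X := by
  classical exact (nxt_spec (Finset.mem_filter.1 h).2).1

theorem lt_nxt {X : Finset ℝ} {x : ℝ} (h : x ∈ nonMax X) : x < nxt X x := by
  classical exact (nxt_spec (Finset.mem_filter.1 h).2).2.1

theorem nxt_le {X : Finset ℝ} {x y : ℝ} (hy : y ∈ X) (h : x < y) : nxt X x ≤ y :=
  (nxt_spec ⟨y, hy, h⟩).2.2 y hy h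

theorem card_le_card_nonMax (X : Finset ℝ) : X.card ≤ (nonMax X).card + 1 := by
  classical
  rcases X.eq_empty_or_nonempty with rfl | hX
  · simp
  · have : X ⊆ insert (X.max' hX) (nonMax X) := by
      intro x hx
      rw [Finset.mem_insert]
      rcases (X.le_max' x hx).eq_or_lt with h | h
      · exact Or.inl h
      · exact Or.inr (Finset.mem_filter.2 ⟨hx, _, X.max'_mem hX, h⟩)
    exact (Finset.card_le_card this).trans (Finset.card_insert_le _ _)

/-- The `k` largest values of a function on a finite set. -/
theorem exists_top (γ : ℝ → ℝ) (E : Finset ℝ) {k : ℕ} (hk : k ≤ E.card) (hE : E.Nonempty) :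
    ∃ B ⊆ E, B.card = k ∧ ∃ τ, (∀ x ∈ B, τ ≤ γ x) ∧ ∀ x ∈ E, x ∉ B → γ x ≤ τ := by
  classical
  induction k with
  | zero =>
    obtain ⟨x, -, hx⟩ := E.exists_max_image γ hE
    exact ⟨∅, by simp, by simp, γ x, by simp, fun y hy _ => hx y hy⟩
  | succ k ih =>
    obtain ⟨B, hBE, hBk, τ, h1, h2⟩ := ih (by omega)
    have hne : (E \ B).Nonempty := by
      rw [← Finset.card_pos, Finset.card_sdiff_of_subset hBE]; omega
    obtain ⟨x, hx, hmax⟩ := (E \ B).exists_max_image γ hne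
    rw [Finset.mem_sdiff] at hx
    refine ⟨insert x B, Finset.insert_subset hx.1 hBE, ?_, γ x, ?_, ?_⟩
    · rw [Finset.card_insert_of_notMem hx.2, hBk]
    · intro y hy
      rcases Finset.mem_insert.1 hy with rfl | hy
      · exact le_rfl
      · exact (h2 x hx.1 hx.2).trans (h1 y hy)
    · intro y hy hyB
      rw [Finset.mem_insert, not_or] at hyB
      exact hmax y (Finset.mem_sdiff.2 ⟨hy, hyB.2⟩)

/-- Squeezing for the increments of a monotone function `h` over the gaps of `X`: the increments
over the gaps in `Y` fit into the gaps in `B`. -/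
theorem Rich.squeeze_of_strictMonoOn {m : ℕ} {h : ℝ → ℝ} {X Y B : Finset ℝ} {τ M : ℝ}
    (hh : StrictMonoOn h X) (hY : Y ⊆ nonMax X) (hB : B ⊆ nonMax X)
    (hYτ : ∀ x ∈ Y, |h (nxt X x) - h x| ≤ τ) (hBτ : ∀ x ∈ B, τ ≤ |h (nxt X x) - h x|)
    (H : Rich m (fun x => h (nxt X x) - h x) Y M) : Rich (m + 1) h X (B.card * M) := by
  have hpos : ∀ x ∈ nonMax X, 0 < h (nxt X x) - h x := fun x hx =>
    sub_pos.2 (hh (nonMax_subset X hx) (nxt_mem hx) (lt_nxt hx))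
  obtain ⟨S, h1, h2, h3⟩ := H
  have hgap : ∀ x ∈ B, ∀ x' ∈ B, x < x' → h x + τ ≤ h x' := by
    intro x hx x' hx' hlt
    have h7 := hBτ x hx
    rw [abs_of_pos (hpos x (hB hx))] at h7
    have h8 := hh.monotoneOn (nxt_mem (hB hx)) (nonMax_subset X (hB hx'))
      (nxt_le (nonMax_subset X (hB hx')) hlt)
    linarith
  have hS : ∀ s ∈ S, 0 < s ∧ s ≤ τ := by
    intro s hs
    obtain ⟨x, hx, x', hx', h7, h8⟩ := h2 s hs
    have h9 := hYτ x' hx'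
    rw [abs_of_pos (hpos x' (hY hx'))] at h9
    exact ⟨(hpos x (hY hx)).trans_le h7, h8.trans h9⟩
  have hD : (fun x => h (nxt X x) - h x) '' (Y : Set ℝ) ⊆ sumDiffSet 1 1 (h '' (X : Set ℝ)) := by
    rintro _ ⟨x, hx, rfl⟩
    exact sub_mem_sumDiffSet ⟨_, nxt_mem (hY hx), rfl⟩ ⟨_, nonMax_subset X (hY hx), rfl⟩
  obtain ⟨S', h4, h5, h6⟩ := squeeze_core (u := h)
    (fun x hx => Set.mem_image_of_mem h (nonMax_subset X (hB hx))) hgap hS h1 hD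
  refine ⟨S', h4, ?_, ?_⟩
  · intro s hs
    obtain ⟨x, hx, h7, h8⟩ := h6 s hs
    refine ⟨x, nonMax_subset X (hB hx), _, nxt_mem (hB hx), h7, h8.trans ?_⟩
    have := hBτ x hx
    rw [abs_of_pos (hpos x (hB hx))] at this
    linarith
  · rw [h5]
    push_cast
    gcongr

theorem Rich.squeeze {m : ℕ} {h : ℝ → ℝ} {X Y B : Finset ℝ} {τ M : ℝ}
    (hh : StrictMonoOn h X ∨ StrictAntiOn h X) (hY : Y ⊆ nonMax X) (hB : B ⊆ nonMax X)
    (hYτ : ∀ x ∈ Y, |h (nxt X x) - h x| ≤ τ) (hBτ : ∀ x ∈ B, τ ≤ |h (nxt X x) - h x|)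
    (H : Rich m (fun x => h (nxt X x) - h x) Y M) : Rich (m + 1) h X (B.card * M) := by
  rcases hh with hh | hh
  · exact H.squeeze_of_strictMonoOn hh hY hB hYτ hBτ
  · have := Rich.squeeze_of_strictMonoOn (m := m) (h := fun x => -h x) (X := X) (Y := Y) (B := B)
      (τ := τ) (M := M) (fun x hx y hy hxy => neg_lt_neg (hh hx hy hxy)) hY hB
      (fun x hx => by rw [← abs_neg]; convert hYτ x hx using 2; ring)
      (fun x hx => by rw [← abs_neg]; convert hBτ x hx using 2; ring)
      (H.neg.congr fun x _ => by ring)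
    simpa using this.neg

/-- Distinct gap lengths give a quadratic bound in `2 h(X) - h(X)`. -/
theorem rich_of_distinct_gaps {m : ℕ} {h : ℝ → ℝ} {X Y B : Finset ℝ} {τ : ℝ}
    (hh : StrictMonoOn h X ∨ StrictAntiOn h X) (hX : X.Nonempty)
    (hY : Y ⊆ nonMax X) (hB : B ⊆ nonMax X)
    (hYτ : ∀ x ∈ Y, |h (nxt X x) - h x| ≤ τ) (hBτ : ∀ x ∈ B, τ ≤ |h (nxt X x) - h x|) :
    Rich (m + 1) h X (B.card * (Y.image fun x => h (nxt X x) - h x).card) :=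
  (Rich.squeeze hh hY hB hYτ hBτ rich_zero).level_mono hX (by omega)

/-! ### Relative approximation -/

/-- `RelClose ε a b` says that `a` approximates `b` with relative error at most `ε`. -/
def RelClose (ε : ℝ) (a b : ℂ) : Prop := ‖a - b‖ ≤ ε * ‖b‖

theorem RelClose.mono {ε ε' : ℝ} {a b : ℂ} (h : RelClose ε a b) (hε : ε ≤ ε') : RelClose ε' a b :=
  le_trans h (by gcongr)

theorem RelClose.norm_le {ε : ℝ} {a b : ℂ} (h : RelClose ε a b) : ‖a‖ ≤ (1 + ε) * ‖b‖ := by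
  have := norm_sub_norm_le a b
  unfold RelClose at h
  linarith

theorem RelClose.le_norm {ε : ℝ} {a b : ℂ} (h : RelClose ε a b) : (1 - ε) * ‖b‖ ≤ ‖a‖ := by
  have := norm_sub_norm_le b a
  rw [norm_sub_rev] at this
  unfold RelClose at h
  linarith

theorem RelClose.ne_zero {ε : ℝ} {a b : ℂ} (h : RelClose ε a b) (hε : ε < 1) (hb : b ≠ 0) : a ≠ 0 := by
  have h1 := h.le_norm
  have h2 : 0 < (1 - ε) * ‖b‖ := mul_pos (by linarith) (norm_pos_iff.2 hb)
  exact norm_pos_iff.1 (h2.trans_le h1)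

theorem RelClose.mul {ε : ℝ} {a b a' b' : ℂ} (h : RelClose ε a b) (h' : RelClose ε a' b') (h0 : 0 ≤ ε)
    (h1 : ε ≤ 1) : RelClose (3 * ε) (a * a') (b * b') := by
  have e : a * a' - b * b' = (a - b) * a' + b * (a' - b') := by ring
  unfold RelClose
  rw [e, norm_mul b b']
  refine (norm_add_le _ _).trans ?_
  rw [norm_mul, norm_mul]
  have h2 := h'.norm_le
  unfold RelClose at h h'
  have h3 : ‖a - b‖ * ‖a'‖ ≤ ε * ‖b‖ * (2 * ‖b'‖) := by
    gcongr
    exact h2.trans (by gcongr; linarith)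
  have h4 : ‖b‖ * ‖a' - b'‖ ≤ ‖b‖ * (ε * ‖b'‖) := by gcongr
  linarith

theorem RelClose.div {ε : ℝ} {a b a' b' : ℂ} (h : RelClose ε a b) (h' : RelClose ε a' b') (h0 : 0 ≤ ε)
    (h1 : ε ≤ 1 / 2) (hb' : b' ≠ 0) : RelClose (4 * ε) (a / a') (b / b') := by
  have ha' : a' ≠ 0 := h'.ne_zero (by linarith) hb'
  have e : a / a' - b / b' = ((a - b) * b' - b * (a' - b')) / (a' * b') := by
    field_simp
    ring
  have h2 := h'.le_norm
  have hp : 0 < ‖b'‖ := norm_pos_iff.2 hb'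
  have hpa : 0 < ‖a'‖ := norm_pos_iff.2 ha'
  unfold RelClose at h h' ⊢
  rw [e, norm_div, norm_div, norm_mul, div_le_iff₀ (by positivity)]
  have h3 : ‖(a - b) * b' - b * (a' - b')‖ ≤ 2 * ε * ‖b‖ * ‖b'‖ := by
    refine (norm_sub_le _ _).trans ?_
    rw [norm_mul, norm_mul]
    have h4 : ‖a - b‖ * ‖b'‖ ≤ ε * ‖b‖ * ‖b'‖ := by gcongr
    have h5 : ‖b‖ * ‖a' - b'‖ ≤ ‖b‖ * (ε * ‖b'‖) := by gcongr
    linarith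
  refine h3.trans ?_
  have h6 : ‖b'‖ ≤ 2 * ‖a'‖ := by nlinarith
  calc 2 * ε * ‖b‖ * ‖b'‖ ≤ 2 * ε * ‖b‖ * (2 * ‖a'‖) := by gcongr
    _ = 4 * ε * (‖b‖ / ‖b'‖) * (‖a'‖ * ‖b'‖) := by field_simp; ring

theorem RelClose.trans {ε : ℝ} {a b c : ℂ} (h : RelClose ε a b) (h' : RelClose ε b c) (h0 : 0 ≤ ε)
    (h1 : ε ≤ 1) : RelClose (3 * ε) a c := by
  have h2 := h'.norm_le
  unfold RelClose at h h' ⊢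
  have h3 : ε * ‖b‖ ≤ ε * (2 * ‖c‖) := by
    gcongr
    exact h2.trans (by gcongr; linarith)
  have := norm_sub_le_norm_sub_add_norm_sub a b c
  linarith

theorem RelClose.const_mul {ε : ℝ} {a b : ℂ} (h : RelClose ε a b) (c : ℂ) : RelClose ε (c * a) (c * b) := by
  unfold RelClose at *
  rw [← mul_sub, norm_mul, norm_mul]
  nlinarith [norm_nonneg c]

theorem exists_rel_zpow (q : ℤ) {ε : ℝ} (hε : 0 < ε) :
    ∃ s > 0, ∀ w z : ℂ, z ≠ 0 → RelClose s w z → RelClose ε (w ^ q) (z ^ q) := by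
  have hc : ContinuousAt (fun u : ℂ => u ^ q) 1 := continuousAt_zpow₀ 1 q (Or.inl one_ne_zero)
  obtain ⟨δ, hδ, H⟩ := Metric.continuousAt_iff.1 hc ε hε
  refine ⟨δ / 2, by positivity, fun w z hz hr => ?_⟩
  have hzp : 0 < ‖z‖ := norm_pos_iff.2 hz
  have h1 : dist (w / z) 1 < δ := by
    rw [dist_eq_norm, div_sub_one hz, norm_div, div_lt_iff₀ hzp]
    unfold RelClose at hr
    nlinarith
  have h2 := H h1
  rw [dist_eq_norm, one_zpow, div_zpow] at h2
  have h3 : w ^ q - z ^ q = (w ^ q / z ^ q - 1) * z ^ q := by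
    field_simp
  unfold RelClose
  rw [h3, norm_mul]
  gcongr

/-! ### Sectors and power-like functions -/

/-- The union of the discs `|z - x| < ρ x` with `x ∈ [α, β]`. -/
def sector (α β ρ : ℝ) : Set ℂ := {z | ∃ x ∈ Set.Icc α β, ‖z - x‖ < ρ * x}

theorem isOpen_sector (α β ρ : ℝ) : IsOpen (sector α β ρ) := by
  have : sector α β ρ = ⋃ x ∈ Set.Icc α β, Metric.ball (x : ℂ) (ρ * x) := by
    ext z
    simp [sector, dist_eq_norm]
  rw [this]
  exact isOpen_biUnion fun x _ => Metric.isOpen_ball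

theorem sector_mono {α β ρ α' β' ρ' : ℝ} (hα : 0 < α') (h1 : α ≤ α') (h2 : β' ≤ β)
    (h3 : ρ' ≤ ρ) : sector α' β' ρ' ⊆ sector α β ρ := by
  rintro z ⟨x, hx, hz⟩
  have : 0 ≤ x := hα.le.trans hx.1
  exact ⟨x, ⟨h1.trans hx.1, hx.2.trans h2⟩, hz.trans_le (by gcongr)⟩

theorem conj_mem_sector {α β ρ : ℝ} {z : ℂ} (hz : z ∈ sector α β ρ) :
    (starRingEnd ℂ) z ∈ sector α β ρ := by
  obtain ⟨x, hx, hz⟩ := hz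
  refine ⟨x, hx, ?_⟩
  rwa [← Complex.conj_ofReal x, ← map_sub, Complex.norm_conj]

theorem ofReal_mem_sector {α β ρ x : ℝ} (hα : 0 < α) (hρ : 0 < ρ) (hx : x ∈ Set.Icc α β) :
    (x : ℂ) ∈ sector α β ρ :=
  ⟨x, hx, by simpa using mul_pos hρ (hα.trans_le hx.1)⟩

theorem ne_zero_of_mem_sector {α β ρ : ℝ} {z : ℂ} (hα : 0 < α) (hρ : ρ ≤ 1)
    (hz : z ∈ sector α β ρ) : z ≠ 0 := by
  rintro rfl
  obtain ⟨x, hx, hz⟩ := hz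
  have : 0 < x := hα.trans_le hx.1
  rw [zero_sub, norm_neg, Complex.norm_real, Real.norm_of_nonneg this.le] at hz
  nlinarith

theorem mem_sector_of_near {α β ρ : ℝ} {z w : ℂ} (hα : 0 < α) (hρ0 : 0 < ρ) (hρ : ρ ≤ 1)
    (hz : z ∈ sector α β (ρ / 2)) (hw : ‖w - z‖ ≤ ρ / 4 * ‖z‖) : w ∈ sector α β ρ := by
  obtain ⟨x, hx, hz⟩ := hz
  refine ⟨x, hx, ?_⟩
  have hx0 : 0 < x := hα.trans_le hx.1
  have h1 : ‖z‖ ≤ ‖z - x‖ + x := by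
    have := norm_add_le (z - x) x
    rwa [sub_add_cancel, Complex.norm_real, Real.norm_of_nonneg hx0.le] at this
  have h2 := norm_sub_le_norm_sub_add_norm_sub w z (x : ℂ)
  have h3 : ‖z‖ ≤ 3 / 2 * x := by nlinarith
  have h4 : ρ / 4 * ‖z‖ ≤ ρ / 4 * (3 / 2 * x) := by gcongr
  nlinarith [mul_pos hρ0 hx0]

/-- A function that is symmetric under complex conjugation on `Ω`. -/
def ConjSymm (Ω : Set ℂ) (g : ℂ → ℂ) : Prop :=
  ∀ z ∈ Ω, g ((starRingEnd ℂ) z) = (starRingEnd ℂ) (g z)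

theorem ConjSymm.mono {Ω Ω' : Set ℂ} {g : ℂ → ℂ} (hg : ConjSymm Ω g) (h : Ω' ⊆ Ω) :
    ConjSymm Ω' g := fun z hz => hg z (h hz)

theorem ConjSymm.deriv {Ω : Set ℂ} {g : ℂ → ℂ} (hg : ConjSymm Ω g) (hΩ : IsOpen Ω)
    (hc : ∀ z ∈ Ω, (starRingEnd ℂ) z ∈ Ω) : ConjSymm Ω (deriv g) := by
  intro z hz
  have h1 : g =ᶠ[nhds ((starRingEnd ℂ) z)] (starRingEnd ℂ) ∘ g ∘ (starRingEnd ℂ) := by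
    filter_upwards [hΩ.mem_nhds (hc z hz)] with w hw
    have := hg _ (hc w hw)
    rw [Complex.conj_conj] at this
    exact this
  rw [h1.deriv_eq, deriv_conj_conj]
  simp

theorem ConjSymm.im_eq_zero {Ω : Set ℂ} {g : ℂ → ℂ} (hg : ConjSymm Ω g) {x : ℝ}
    (hx : (x : ℂ) ∈ Ω) : (g x).im = 0 := by
  have := hg x hx
  rw [Complex.conj_ofReal] at this
  exact Complex.conj_eq_iff_im.1 this.symm

theorem ConjSymm.ofReal_re {Ω : Set ℂ} {g : ℂ → ℂ} (hg : ConjSymm Ω g) {x : ℝ}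
    (hx : (x : ℂ) ∈ Ω) : ((g x).re : ℂ) = g x :=
  Complex.ext (by simp) (by simp [hg.im_eq_zero hx])

/-- A holomorphic function on `Ω`, real on the real axis, which is `κ z ^ q` up to a relative
error `ε`. The exponent may be negative: passing to increments lowers exponents. -/
structure PowerLike (Ω : Set ℂ) (q : ℤ) (κ ε : ℝ) (φ : ℂ → ℂ) : Prop where
  diff : DifferentiableOn ℂ φ Ω
  symm : ConjSymm Ω φ
  ne : κ ≠ 0
  rel : ∀ z ∈ Ω, RelClose ε (φ z) (κ * z ^ q)

theorem PowerLike.mono {Ω Ω' : Set ℂ} {q : ℤ} {κ ε ε' : ℝ} {φ : ℂ → ℂ}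
    (h : PowerLike Ω q κ ε φ) (hΩ : Ω' ⊆ Ω) (hε : ε ≤ ε') : PowerLike Ω' q κ ε' φ :=
  ⟨h.diff.mono hΩ, h.symm.mono hΩ, h.ne, fun z hz => (h.rel z (hΩ hz)).mono hε⟩

/-- A holomorphic function on `Ω`, real on the real axis, with power-like derivative. -/
structure PowerPrimitive (Ω : Set ℂ) (q : ℤ) (κ ε : ℝ) (g : ℂ → ℂ) : Prop where
  diff : DifferentiableOn ℂ g Ω
  symm : ConjSymm Ω g
  ne : κ ≠ 0
  rel : ∀ z ∈ Ω, RelClose ε (deriv g z) (κ * z ^ q)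

theorem PowerPrimitive.mono {Ω Ω' : Set ℂ} {q : ℤ} {κ ε ε' : ℝ} {φ : ℂ → ℂ}
    (h : PowerPrimitive Ω q κ ε φ) (hΩ : Ω' ⊆ Ω) (hε : ε ≤ ε') : PowerPrimitive Ω' q κ ε' φ :=
  ⟨h.diff.mono hΩ, h.symm.mono hΩ, h.ne, fun z hz => (h.rel z (hΩ hz)).mono hε⟩

theorem PowerPrimitive.powerLike {α β ρ : ℝ} {q : ℤ} {κ ε : ℝ} {g : ℂ → ℂ}
    (h : PowerPrimitive (sector α β ρ) q κ ε g) : PowerLike (sector α β ρ) q κ ε (deriv g) :=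
  ⟨h.diff.deriv (isOpen_sector _ _ _),
    h.symm.deriv (isOpen_sector _ _ _) fun _ => conj_mem_sector, h.ne, h.rel⟩

theorem PowerLike.ne_zero {Ω : Set ℂ} {q : ℤ} {κ ε : ℝ} {φ : ℂ → ℂ}
    (h : PowerLike Ω q κ ε φ) (hε : ε < 1) {z : ℂ} (hz : z ∈ Ω) (hz0 : z ≠ 0) : φ z ≠ 0 :=
  (h.rel z hz).ne_zero hε
    (mul_ne_zero (by exact_mod_cast h.ne) (zpow_ne_zero _ hz0))

theorem zpow_sub_div {κ₁ κ₂ : ℂ} {z : ℂ} (hz : z ≠ 0) (q₁ q₂ : ℤ) :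
    κ₂ * z ^ q₂ / (κ₁ * z ^ q₁) = κ₂ / κ₁ * z ^ (q₂ - q₁) := by
  rw [zpow_sub₀ hz]
  ring

/-- The derivative of the quotient of two power-like functions with distinct exponents is
power-like on a smaller sector, by Cauchy's estimate. -/
theorem exists_powerLike_deriv_div {q₁ q₂ : ℤ} (hq : q₁ ≠ q₂) {ρ ε' : ℝ} (hρ0 : 0 < ρ)
    (hρ : ρ ≤ 1) (hε' : 0 < ε') :
    ∃ ε > 0, ε ≤ 1 / 2 ∧ ∀ α β κ₁ κ₂ : ℝ, 0 < α → ∀ φ₁ φ₂ : ℂ → ℂ,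
      PowerLike (sector α β ρ) q₁ κ₁ ε φ₁ → PowerLike (sector α β ρ) q₂ κ₂ ε φ₂ →
      DifferentiableOn ℂ (fun z => φ₂ z / φ₁ z) (sector α β ρ) ∧
      PowerLike (sector α β (ρ / 2)) (q₂ - q₁ - 1) (κ₂ / κ₁ * ((q₂ - q₁ : ℤ) : ℝ)) ε'
        (deriv fun z => φ₂ z / φ₁ z) := by
  obtain ⟨s, hs, Hs⟩ := exists_rel_zpow (q₂ - q₁) one_pos
  set t := min s (ρ / 4) with ht
  have ht0 : 0 < t := lt_min hs (by positivity)
  refine ⟨min (1 / 2) (ε' * t / 8), by positivity, min_le_left _ _, ?_⟩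
  set ε := min (1 / 2) (ε' * t / 8) with hεdef
  have hε0 : 0 < ε := by positivity
  have hε2 : ε ≤ 1 / 2 := min_le_left _ _
  intro α β κ₁ κ₂ hα φ₁ φ₂ h₁ h₂
  have hne : ∀ z ∈ sector α β ρ, z ≠ 0 := fun z hz => ne_zero_of_mem_sector hα hρ hz
  have hsub : sector α β (ρ / 2) ⊆ sector α β ρ := by
    rintro z ⟨x, hx, hz⟩
    have : 0 < x := hα.trans_le hx.1
    exact ⟨x, hx, hz.trans_le (by nlinarith)⟩
  have hd : DifferentiableOn ℂ (fun z => φ₂ z / φ₁ z) (sector α β ρ) :=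
    h₂.diff.div h₁.diff fun z hz => h₁.ne_zero (by linarith) hz (hne z hz)
  have hsymm : ConjSymm (sector α β ρ) (fun z => φ₂ z / φ₁ z) := by
    intro z hz
    simp only [h₁.symm z hz, h₂.symm z hz, map_div₀]
  refine ⟨hd, (hd.deriv (isOpen_sector _ _ _)).mono hsub,
    (hsymm.deriv (isOpen_sector _ _ _) fun _ => conj_mem_sector).mono hsub, ?_, ?_⟩
  · refine mul_ne_zero (div_ne_zero h₂.ne h₁.ne) ?_
    exact_mod_cast sub_ne_zero.2 hq.symm
  intro z hz
  have hz0 := hne z (hsub hz)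
  have hzp : 0 < ‖z‖ := norm_pos_iff.2 hz0
  set k : ℂ := (κ₂ : ℂ) / κ₁ with hk
  set R₀ : ℂ → ℂ := fun w => k * w ^ (q₂ - q₁) with hR₀
  have hball : ∀ w, ‖w - z‖ ≤ t * ‖z‖ → w ∈ sector α β ρ := fun w hw =>
    mem_sector_of_near hα hρ0 hρ hz (hw.trans (by gcongr; exact min_le_right _ _))
  have hd0 : ∀ w : ℂ, w ≠ 0 → HasDerivAt R₀ (k * (((q₂ - q₁ : ℤ) : ℂ) * w ^ (q₂ - q₁ - 1))) w :=
    fun w hw => (hasDerivAt_zpow _ w (Or.inl hw)).const_mul k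
  -- Cauchy's estimate on a circle of radius proportional to `‖z‖`, where the quotient is compared
  -- with the exact power
  have hbound : ∀ w ∈ Metric.sphere z (t * ‖z‖), ‖φ₂ w / φ₁ w - R₀ w‖ ≤ 8 * ε * ‖R₀ z‖ := by
    intro w hw
    have hw' : ‖w - z‖ ≤ t * ‖z‖ := by
      rw [← dist_eq_norm]; exact (Metric.mem_sphere.1 hw).le
    have hwΩ := hball w hw'
    have hw0 := hne w hwΩ
    have h3 := (h₂.rel w hwΩ).div (h₁.rel w hwΩ) hε0.le hε2
      (mul_ne_zero (by exact_mod_cast h₁.ne) (zpow_ne_zero _ hw0))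
    rw [zpow_sub_div hw0] at h3
    have h4 : RelClose 1 (w ^ (q₂ - q₁)) (z ^ (q₂ - q₁)) :=
      Hs w z hz0 (hw'.trans (by gcongr; exact min_le_left _ _))
    have h5 := (h4.const_mul k).norm_le
    calc ‖φ₂ w / φ₁ w - R₀ w‖ ≤ 4 * ε * ‖R₀ w‖ := h3
      _ ≤ 4 * ε * ((1 + 1) * ‖R₀ z‖) := by gcongr
      _ = 8 * ε * ‖R₀ z‖ := by ring
  have hr : 0 < t * ‖z‖ := by positivity
  have hclosed : Metric.closedBall z (t * ‖z‖) ⊆ sector α β ρ := fun w hw =>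
    hball w (by rw [← dist_eq_norm]; exact hw)
  have hdiff : DifferentiableOn ℂ (fun w => φ₂ w / φ₁ w - R₀ w) (Metric.closedBall z (t * ‖z‖)) :=
    (hd.mono hclosed).sub fun w hw =>
      (hd0 w (hne w (hclosed hw))).differentiableAt.differentiableWithinAt
  have hC := Complex.norm_deriv_le_of_forall_mem_sphere_norm_le hr
    (hdiff.diffContOnCl_ball subset_rfl) hbound
  have hdz : DifferentiableAt ℂ (fun z => φ₂ z / φ₁ z) z :=
    (hd z (hsub hz)).differentiableAt ((isOpen_sector _ _ _).mem_nhds (hsub hz))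
  rw [deriv_fun_sub hdz (hd0 z hz0).differentiableAt, (hd0 z hz0).deriv] at hC
  have e1 : ((κ₂ / κ₁ * ((q₂ - q₁ : ℤ) : ℝ) : ℝ) : ℂ) * z ^ (q₂ - q₁ - 1) =
      k * (((q₂ - q₁ : ℤ) : ℂ) * z ^ (q₂ - q₁ - 1)) := by
    rw [hk]; push_cast; ring
  unfold RelClose
  rw [e1]
  refine hC.trans ?_
  have hq1 : (1 : ℝ) ≤ ‖((q₂ - q₁ : ℤ) : ℂ)‖ := by
    rw [Complex.norm_intCast]
    exact_mod_cast Int.one_le_abs (sub_ne_zero.2 hq.symm)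
  have e2 : ‖z ^ (q₂ - q₁ - 1)‖ = ‖z ^ (q₂ - q₁)‖ / ‖z‖ := by
    rw [zpow_sub_one₀ hz0, norm_mul, norm_inv]; rfl
  simp only [hR₀, norm_mul, e2]
  rw [div_le_iff₀ hr]
  have e3 : ε' * (‖k‖ * (‖((q₂ - q₁ : ℤ) : ℂ)‖ * (‖z ^ (q₂ - q₁)‖ / ‖z‖))) * (t * ‖z‖) =
      (ε' * t) * ‖((q₂ - q₁ : ℤ) : ℂ)‖ * (‖k‖ * ‖z ^ (q₂ - q₁)‖) := by
    field_simp
  rw [e3]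
  refine mul_le_mul_of_nonneg_right ?_ (by positivity)
  have : ε ≤ ε' * t / 8 := min_le_right _ _
  nlinarith [mul_pos hε' ht0]

theorem hasDerivAt_re {Ω : Set ℂ} (hΩ : IsOpen Ω) {g : ℂ → ℂ} (hg : DifferentiableOn ℂ g Ω)
    {x : ℝ} (hx : (x : ℂ) ∈ Ω) : HasDerivAt (fun t : ℝ => (g t).re) (deriv g x).re x :=
  ((hg x hx).differentiableAt (hΩ.mem_nhds hx)).hasDerivAt.real_of_complex

/-- A choice of a uniform bound for finitely many positive thresholds. -/
theorem exists_pos_forall_le {ι : Type*} [Finite ι] (e : ι → ℝ) (he : ∀ i, 0 < e i) :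
    ∃ ε > 0, ∀ i, ε ≤ e i := by
  cases isEmpty_or_nonempty ι
  · exact ⟨1, one_pos, fun i => isEmptyElim i⟩
  · obtain ⟨i, hi⟩ := Finite.exists_min e
    exact ⟨e i, he i, hi⟩

/-- A nontrivial linear combination of `k + 1` power-like functions with distinct exponents has
at most `k` zeros on the real interval: divide by the first function, differentiate, and use
Rolle's theorem. -/
theorem exists_no_zeros_combination (k : ℕ) (q : Fin (k + 1) → ℤ) (hq : Function.Injective q)
    {ρ : ℝ} (hρ0 : 0 < ρ) (hρ : ρ ≤ 1) :
    ∃ ε > 0, ∀ α β : ℝ, 0 < α → ∀ (κ : Fin (k + 1) → ℝ) (φ : Fin (k + 1) → ℂ → ℂ),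
      (∀ i, PowerLike (sector α β ρ) (q i) (κ i) ε (φ i)) →
      ∀ T : Fin (k + 1) → ℝ, T ≠ 0 → ∀ z : Fin (k + 1) → ℝ, StrictMono z →
        (∀ l, z l ∈ Set.Icc α β) → ¬ ∀ l, ∑ i, T i * (φ i (z l)).re = 0 := by
  induction k generalizing ρ with
  | zero =>
    refine ⟨1 / 2, by norm_num, fun α β hα κ φ hφ T hT z _ hz hzero => ?_⟩
    have h0 := hzero 0
    simp only [Nat.reduceAdd, Finset.univ_unique, Fin.default_eq_zero, Fin.isValue,
      Finset.sum_singleton] at h0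
    have hT0 : T 0 ≠ 0 := fun h => hT (funext fun i => by
      rw [Fin.fin_one_eq_zero i]; exact h)
    have hzΩ := ofReal_mem_sector hα hρ0 (hz 0)
    have h1 := (hφ 0).ne_zero (by norm_num) hzΩ (ne_zero_of_mem_sector hα hρ hzΩ)
    rw [← (hφ 0).symm.ofReal_re hzΩ] at h1
    rcases mul_eq_zero.1 h0 with h | h
    · exact hT0 h
    · exact h1 (by rw [h]; rfl)
  | succ k ih =>
    obtain ⟨ε₁, hε₁, H₁⟩ := ih (fun i => q i.succ - q 0 - 1)
      (fun i j hij => by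
        have : q i.succ = q j.succ := by simpa using hij
        exact Fin.succ_injective _ (hq this)) (half_pos hρ0) (by linarith : ρ / 2 ≤ 1)
    have hne : ∀ i : Fin (k + 1), q 0 ≠ q i.succ := fun i h =>
      Fin.succ_ne_zero i (hq h).symm
    choose e he he2 He using fun i : Fin (k + 1) =>
      exists_powerLike_deriv_div (hne i) hρ0 hρ hε₁
    obtain ⟨ε, hε, hεe⟩ := exists_pos_forall_le e he
    refine ⟨ε, hε, fun α β hα κ φ hφ T hT z hzm hz hzero => ?_⟩
    have hε2 : ε ≤ 1 / 2 := (hεe 0).trans (he2 0)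
    have hmem : ∀ x ∈ Set.Icc α β, (x : ℂ) ∈ sector α β ρ := fun x hx =>
      ofReal_mem_sector hα hρ0 hx
    have hφ0 : ∀ x ∈ Set.Icc α β, φ 0 x ≠ 0 := fun x hx =>
      (hφ 0).ne_zero (by linarith) (hmem x hx) (ne_zero_of_mem_sector hα hρ (hmem x hx))
    have hφ0re : ∀ x ∈ Set.Icc α β, (φ 0 x).re ≠ 0 := fun x hx h => hφ0 x hx (by
      rw [← (hφ 0).symm.ofReal_re (hmem x hx), h]; rfl)
    -- if only the first function occurs, there is no zero at all
    by_cases hT' : (fun i : Fin (k + 1) => T i.succ) = 0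
    · have h0 := hzero 0
      rw [Fin.sum_univ_succ, Finset.sum_eq_zero, add_zero] at h0
      · have hT0 : T 0 ≠ 0 := fun h => hT (funext fun i => by
          refine Fin.cases h (fun j => ?_) i
          exact congrFun hT' j)
        exact (mul_ne_zero hT0 (hφ0re _ (hz 0))) h0
      · intro i _
        rw [show T i.succ = 0 from congrFun hT' i, zero_mul]
    set R : Fin (k + 1) → ℂ → ℂ := fun i w => φ i.succ w / φ 0 w with hR
    have HR := fun i => He i α β (κ 0) (κ i.succ) hα (φ 0) (φ i.succ)
      ((hφ 0).mono subset_rfl (hεe i)) ((hφ i.succ).mono subset_rfl (hεe i))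
    set F : ℝ → ℝ := fun x => T 0 + ∑ i, T i.succ * (R i x).re with hF
    have hFd : ∀ x ∈ Set.Icc α β,
        HasDerivAt F (∑ i, T i.succ * (deriv (R i) x).re) x := by
      intro x hx
      have := HasDerivAt.fun_sum (u := Finset.univ) fun i (_ : i ∈ Finset.univ) =>
        (hasDerivAt_re (isOpen_sector _ _ _) (HR i).1 (hmem x hx)).const_mul (T i.succ)
      exact this.const_add _
    have hF0 : ∀ l, F (z l) = 0 := by
      intro l
      have h1 := hzero l
      have h2 : ∀ i, (φ i (z l)).re / (φ 0 (z l)).re = (φ i (z l) / φ 0 (z l)).re := by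
        intro i
        conv_rhs => rw [← (hφ 0).symm.ofReal_re (hmem _ (hz l)),
          ← (hφ i).symm.ofReal_re (hmem _ (hz l)), ← Complex.ofReal_div, Complex.ofReal_re]
      have h3 : (∑ i, T i * (φ i (z l)).re) / (φ 0 (z l)).re = F (z l) := by
        rw [Finset.sum_div, Fin.sum_univ_succ, hF]
        congr 1
        · rw [mul_div_assoc, div_self (hφ0re _ (hz l)), mul_one]
        · refine Finset.sum_congr rfl fun i _ => ?_
          rw [mul_div_assoc, h2]
      rw [← h3, h1, zero_div]
    -- dividing by the first function leaves its coefficient as a constant; the derivative of the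
    -- quotient involves one function fewer and vanishes between consecutive zeros
    have hRolle : ∀ l : Fin (k + 1), ∃ ξ ∈ Set.Ioo (z l.castSucc) (z l.succ),
        (∑ i, T i.succ * (deriv (R i) ξ).re) = 0 := by
      intro l
      have hlt : z l.castSucc < z l.succ := hzm (Fin.castSucc_lt_succ)
      have hsub : Set.Icc (z l.castSucc) (z l.succ) ⊆ Set.Icc α β :=
        Set.Icc_subset_Icc (hz _).1 (hz _).2
      exact exists_hasDerivAt_eq_zero hlt
        (fun x hx => (hFd x (hsub hx)).continuousAt.continuousWithinAt)
        (by rw [hF0, hF0]) fun x hx => hFd x (hsub (Set.Ioo_subset_Icc_self hx))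
    choose ξ hξ hξ0 using hRolle
    refine H₁ α β hα _ (fun i => deriv (R i)) (fun i => (HR i).2) _ hT' ξ ?_ ?_ hξ0
    · refine Fin.strictMono_iff_lt_succ.2 fun l => ?_
      have h1 := (hξ l.castSucc).2
      have h2 := (hξ l.succ).1
      rw [Fin.succ_castSucc] at h1
      exact h1.trans h2
    · intro l
      exact ⟨(hz _).1.trans (hξ l).1.le, (hξ l).2.le.trans (hz _).2⟩

/-! ### Increments along a level of the first function -/

/-- On a disc around `z` of radius small relative to `|z|`, a power-like function is close to the
constant `κ z ^ q`. -/
theorem exists_relClose_center (q : ℤ) {ρ ε' : ℝ} (hρ0 : 0 < ρ) (hρ : ρ ≤ 1) (hε' : 0 < ε') :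
    ∃ s > 0, s ≤ ρ / 4 ∧ ∃ ε > 0, ∀ (α β κ : ℝ) (φ : ℂ → ℂ), 0 < α →
      (∀ z ∈ sector α β ρ, RelClose ε (φ z) (κ * z ^ q)) →
      ∀ z ∈ sector α β (ρ / 2), ∀ v, ‖v - z‖ ≤ s * ‖z‖ → RelClose ε' (φ v) (κ * z ^ q) := by
  set e := min 1 (ε' / 3) with he
  have he0 : 0 < e := by positivity
  obtain ⟨s, hs, Hs⟩ := exists_rel_zpow q he0
  refine ⟨min s (ρ / 4), by positivity, min_le_right _ _, e, he0, ?_⟩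
  intro α β κ φ hα hφ z hz v hv
  have hsub : sector α β (ρ / 2) ⊆ sector α β ρ := sector_mono hα le_rfl le_rfl (by linarith)
  have hz0 := ne_zero_of_mem_sector hα hρ (hsub hz)
  have hvΩ : v ∈ sector α β ρ :=
    mem_sector_of_near hα hρ0 hρ hz (hv.trans (by gcongr; exact min_le_right _ _))
  have h1 := hφ v hvΩ
  have h2 := (Hs v z hz0 (hv.trans (by gcongr; exact min_le_left _ _))).const_mul κ
  refine (h1.trans h2 he0.le (min_le_left _ _)).mono ?_
  have : e ≤ ε' / 3 := min_le_right _ _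
  linarith

/-- A function whose derivative is close to a constant `c` is close to linear. -/
theorem relClose_sub_of_relClose_deriv {g : ℂ → ℂ} {z c : ℂ} {r ε : ℝ}
    (hd : ∀ v, ‖v - z‖ ≤ r → DifferentiableAt ℂ g v)
    (hg : ∀ v, ‖v - z‖ ≤ r → RelClose ε (deriv g v) c) {w w' : ℂ} (hw : ‖w - z‖ ≤ r)
    (hw' : ‖w' - z‖ ≤ r) : RelClose ε (g w - g w') (c * (w - w')) := by
  have hd' : ∀ v ∈ Metric.closedBall z r, HasDerivAt (fun v => g v - c * v) (deriv g v - c) v := by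
    intro v hv
    have h1 := (hd v (by rw [← dist_eq_norm]; exact hv)).hasDerivAt
    have h2 := h1.fun_sub ((hasDerivAt_id' v).const_mul c)
    rwa [mul_one] at h2
  have h2 := (convex_closedBall z r).norm_image_sub_le_of_norm_hasDerivWithin_le
    (f := fun v => g v - c * v) (f' := fun v => deriv g v - c) (C := ε * ‖c‖)
    (fun v hv => (hd' v hv).hasDerivWithinAt)
    (fun v hv => hg v (by rw [← dist_eq_norm]; exact hv))
    (x := w') (y := w) (by rw [Metric.mem_closedBall, dist_eq_norm]; exact hw')
    (by rw [Metric.mem_closedBall, dist_eq_norm]; exact hw)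
  unfold RelClose
  rw [norm_mul, ← mul_assoc]
  refine le_trans (le_of_eq ?_) h2
  congr 1
  ring

/-- The solution `y` of `g y = g z + d` close to `z`, for small `d`: it exists, is unique near
`z`, and depends holomorphically on `z`. -/
theorem exists_level_map (q : ℤ) {ρ : ℝ} (hρ0 : 0 < ρ) (hρ : ρ ≤ 1) :
    ∃ ρ' > 0, ρ' ≤ ρ / 4 ∧ ∃ s > 0, ∃ ε > 0, ∀ τ > 0, ∃ η > 0,
      ∀ (α β α' β' κ d : ℝ) (g : ℂ → ℂ), 0 < α → α ≤ α' → β' ≤ β →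
      PowerPrimitive (sector α β ρ) q κ ε g →
      (∀ x ∈ Set.Icc α' β', |d| ≤ η * (|κ| * x ^ q * x)) →
      ∃ y : ℂ → ℂ, ConjSymm (sector α' β' ρ') y ∧ DifferentiableOn ℂ y (sector α' β' ρ') ∧
        ∀ z ∈ sector α' β' ρ', ‖y z - z‖ ≤ τ * ‖z‖ ∧ g (y z) = g z + d ∧
          ∀ w, ‖w - z‖ ≤ s * ‖z‖ → g w = g z + d → w = y z := by
  obtain ⟨s, hs, hsρ, ε, hε, H⟩ := exists_relClose_center q hρ0 hρ (one_half_pos (α := ℝ))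
  obtain ⟨s₀, hs₀, Hs₀⟩ := exists_rel_zpow q (one_half_pos (α := ℝ))
  set ρ' := min (ρ / 4) s₀ with hρ'
  have hρ'0 : 0 < ρ' := by positivity
  have hρ'ρ : ρ' ≤ ρ / 4 := min_le_left _ _
  refine ⟨ρ', hρ'0, hρ'ρ, s, hs, ε, hε, fun τ hτ => ?_⟩
  set τ' := min τ (s / 2) with hτ'
  have hτ'0 : 0 < τ' := by positivity
  have hτ's : τ' < s := (min_le_right _ _).trans_lt (by linarith)
  refine ⟨τ' / 32, by positivity, ?_⟩
  intro α β α' β' κ d g hα hαα hββ hg hd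
  have hα' : 0 < α' := hα.trans_le hαα
  have hsub : sector α' β' ρ' ⊆ sector α β (ρ / 2) := sector_mono hα' hαα hββ (by linarith)
  have hsub2 : sector α β (ρ / 2) ⊆ sector α β ρ := sector_mono hα le_rfl le_rfl (by linarith)
  have hz0 : ∀ z ∈ sector α' β' ρ', z ≠ 0 := fun z hz =>
    ne_zero_of_mem_sector hα' (by linarith) hz
  have hc0 : ∀ z ∈ sector α' β' ρ', (κ : ℂ) * z ^ q ≠ 0 := fun z hz =>
    mul_ne_zero (by exact_mod_cast hg.ne) (zpow_ne_zero _ (hz0 z hz))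
  have hnear : ∀ z ∈ sector α' β' ρ', ∀ v, ‖v - z‖ ≤ s * ‖z‖ → v ∈ sector α β ρ :=
    fun z hz v hv => mem_sector_of_near hα hρ0 hρ (hsub hz) (hv.trans (by gcongr))
  have hdiff : ∀ v ∈ sector α β ρ, DifferentiableAt ℂ g v := fun v hv =>
    (hg.diff v hv).differentiableAt ((isOpen_sector _ _ _).mem_nhds hv)
  -- `g` is bi-Lipschitz near `z`
  have hlin : ∀ z ∈ sector α' β' ρ', ∀ w w', ‖w - z‖ ≤ s * ‖z‖ → ‖w' - z‖ ≤ s * ‖z‖ →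
      1 / 2 * ‖(κ : ℂ) * z ^ q‖ * ‖w - w'‖ ≤ ‖g w - g w'‖ := by
    intro z hz w w' hw hw'
    have h1 := (relClose_sub_of_relClose_deriv (fun v hv => hdiff v (hnear z hz v hv))
      (H α β κ (deriv g) hα hg.rel z (hsub hz)) hw hw').le_norm
    rw [norm_mul] at h1
    linarith
  have huniq : ∀ z ∈ sector α' β' ρ', ∀ w w', ‖w - z‖ ≤ s * ‖z‖ → ‖w' - z‖ ≤ s * ‖z‖ →
      g w = g w' → w = w' := by
    intro z hz w w' hw hw' h
    have h1 := hlin z hz w w' hw hw'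
    rw [h, sub_self, norm_zero] at h1
    have h2 : 0 < 1 / 2 * ‖(κ : ℂ) * z ^ q‖ := by
      have := norm_pos_iff.2 (hc0 z hz); positivity
    have h3 : ‖w - w'‖ ≤ 0 := by
      by_contra h4
      push Not at h4
      nlinarith
    exact sub_eq_zero.1 (norm_le_zero_iff.1 h3)
  -- existence, by a quantitative open mapping theorem
  have hex : ∀ z ∈ sector α' β' ρ', ∃ w, ‖w - z‖ ≤ τ' * ‖z‖ ∧ g w = g z + d := by
    intro z hz
    have hzp : 0 < ‖z‖ := norm_pos_iff.2 (hz0 z hz)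
    have hcp : 0 < ‖(κ : ℂ) * z ^ q‖ := norm_pos_iff.2 (hc0 z hz)
    have hr : 0 < τ' * ‖z‖ := by positivity
    have hcl : ∀ v ∈ Metric.closedBall z (τ' * ‖z‖), ‖v - z‖ ≤ s * ‖z‖ := fun v hv => by
      rw [← dist_eq_norm]
      exact (Metric.mem_closedBall.1 hv).trans (by gcongr)
    have hzz : ‖z - z‖ ≤ s * ‖z‖ := by rw [sub_self, norm_zero]; positivity
    have h1 := DiffContOnCl.ball_subset_image_closedBall (f := g) (z₀ := z) (r := τ' * ‖z‖)
      (ε := 1 / 2 * ‖(κ : ℂ) * z ^ q‖ * (τ' * ‖z‖))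
      (DifferentiableOn.diffContOnCl_ball (U := sector α β ρ) hg.diff
        fun v hv => hnear z hz v (hcl v hv)) hr ?_ ?_
    · have hdb : g z + d ∈ Metric.ball (g z) (1 / 2 * ‖(κ : ℂ) * z ^ q‖ * (τ' * ‖z‖) / 2) := by
        rw [Metric.mem_ball, dist_eq_norm, add_sub_cancel_left, Complex.norm_real,
          Real.norm_eq_abs]
        obtain ⟨x, hx, hzx⟩ := hz
        have hx0 : 0 < x := hα'.trans_le hx.1
        have h2 := hd x hx
        have h3 : RelClose (1 / 2) (z ^ q) ((x : ℂ) ^ q) := by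
          refine Hs₀ z x (by exact_mod_cast hx0.ne') ?_
          unfold RelClose
          rw [Complex.norm_real, Real.norm_of_nonneg hx0.le]
          refine hzx.le.trans ?_
          gcongr
          exact min_le_right _ _
        have h4 := h3.le_norm
        rw [norm_zpow, Complex.norm_real, Real.norm_of_nonneg hx0.le] at h4
        have h5 : x ≤ 2 * ‖z‖ := by
          have := norm_sub_norm_le (x : ℂ) z
          rw [norm_sub_rev, Complex.norm_real, Real.norm_of_nonneg hx0.le] at this
          nlinarith
        rw [norm_mul, Complex.norm_real, Real.norm_eq_abs] at hcp ⊢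
        have hxq : 0 < x ^ q := zpow_pos hx0 q
        calc |d| ≤ τ' / 32 * (|κ| * x ^ q * x) := h2
          _ ≤ τ' / 32 * (|κ| * (2 * ‖z ^ q‖) * (2 * ‖z‖)) := by gcongr; linarith
          _ < 1 / 2 * (|κ| * ‖z ^ q‖) * (τ' * ‖z‖) / 2 := by
            have : 0 < τ' * (|κ| * ‖z ^ q‖) * ‖z‖ := by positivity
            nlinarith
      obtain ⟨w, hw, hgw⟩ := h1 hdb
      exact ⟨w, by rw [← dist_eq_norm]; exact hw, hgw⟩
    · intro w hw
      have h2 := hlin z hz w z (hcl w (Metric.sphere_subset_closedBall hw)) hzz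
      rwa [← dist_eq_norm w z, Metric.mem_sphere.1 hw] at h2
    · have h2 : ∀ᶠ w in nhdsWithin z {z}ᶜ, g w ≠ g z := by
        have h3 : Metric.closedBall z (s * ‖z‖) ∈ nhds z :=
          Metric.closedBall_mem_nhds _ (by positivity)
        filter_upwards [nhdsWithin_le_nhds h3, self_mem_nhdsWithin] with w hw hwz heq
        exact hwz (huniq z hz w z (by rw [← dist_eq_norm]; exact hw) hzz heq)
      exact h2.frequently.filter_mono nhdsWithin_le_nhds
  classical
  choose! y hy1 hy2 using hex
  have hyu : ∀ z ∈ sector α' β' ρ', ∀ w, ‖w - z‖ ≤ s * ‖z‖ → g w = g z + d → w = y z :=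
    fun z hz w hw h => huniq z hz w (y z) hw ((hy1 z hz).trans (by gcongr)) (h.trans (hy2 z hz).symm)
  refine ⟨y, ?_, ?_, fun z hz => ⟨(hy1 z hz).trans (by gcongr; exact min_le_left _ _),
    hy2 z hz, hyu z hz⟩⟩
  · -- the symmetry under conjugation follows from uniqueness
    intro z hz
    symm
    refine hyu _ (conj_mem_sector hz) _ ?_ ?_
    · rw [← map_sub, Complex.norm_conj, Complex.norm_conj]
      exact (hy1 z hz).trans (by gcongr)
    · have h1 : y z ∈ sector α β ρ := hnear z hz _ ((hy1 z hz).trans (by gcongr))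
      rw [hg.symm _ h1, hy2 z hz, hg.symm z (hsub2 (hsub hz)), map_add, Complex.conj_ofReal]
  · -- by uniqueness, `y` agrees near `z` with a local inverse of `g` composed with `g + d`
    intro z hz
    refine DifferentiableAt.differentiableWithinAt ?_
    have hzp : 0 < ‖z‖ := norm_pos_iff.2 (hz0 z hz)
    have hyz : y z ∈ sector α β ρ := hnear z hz _ ((hy1 z hz).trans (by gcongr))
    have han : HasStrictDerivAt g (deriv g (y z)) (y z) :=
      (hg.diff.analyticAt ((isOpen_sector _ _ _).mem_nhds hyz)).hasStrictDerivAt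
    have hne : deriv g (y z) ≠ 0 :=
      (H α β κ (deriv g) hα hg.rel z (hsub hz) _ ((hy1 z hz).trans (by gcongr))).ne_zero
        (by norm_num) (hc0 z hz)
    set L := han.localInverse g _ _ hne with hL
    have hLd : HasStrictDerivAt L (deriv g (y z))⁻¹ (g z + d) := by
      rw [← hy2 z hz]; exact han.to_localInverse hne
    have hLz : L (g z + d) = y z := by
      rw [← hy2 z hz]
      exact HasStrictFDerivAt.localInverse_apply_image _
    have hgd : DifferentiableAt ℂ (fun w => g w + d) z :=
      (hdiff z (hsub2 (hsub hz))).add_const _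
    have hcomp : DifferentiableAt ℂ (fun w => L (g w + d)) z :=
      DifferentiableAt.comp z (g := L) (f := fun w => g w + d)
        hLd.hasDerivAt.differentiableAt hgd
    refine hcomp.congr_of_eventuallyEq ?_
    have hright : ∀ᶠ v in nhds (g z + d), g (L v) = v := by
      rw [← hy2 z hz]
      exact HasStrictFDerivAt.eventually_right_inverse _
    have h1 := hgd.continuousAt.eventually hright
    have h2 : ∀ᶠ w in nhds z, ‖L (g w + d) - w‖ < s * ‖w‖ := by
      have h3 : ContinuousAt (fun w => s * ‖w‖ - ‖L (g w + d) - w‖) z :=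
        ((continuousAt_id.norm).const_mul s).sub ((hcomp.continuousAt.sub continuousAt_id).norm)
      have h4 : 0 < s * ‖z‖ - ‖L (g z + d) - z‖ := by
        rw [hLz, sub_pos]
        exact (hy1 z hz).trans_lt (by gcongr)
      filter_upwards [h3.eventually (lt_mem_nhds h4)] with w hw
      linarith
    filter_upwards [h1, h2, (isOpen_sector _ _ _).mem_nhds hz] with w hw1 hw2 hw3
    exact (hyu w hw3 _ hw2.le hw1).symm

/-- The increment `g(y(z)) - g(z)` of a second function, where `y` moves `z` to the next level of
`g₁`, is again a primitive of a power-like function: its derivative is `g₁'` times the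
increment of `g' / g₁'`. -/
theorem exists_powerPrimitive_increment {q₁ q : ℤ} (hq : q₁ ≠ q) {ρ ε' : ℝ} (hρ0 : 0 < ρ)
    (hρ : ρ ≤ 1) (hε' : 0 < ε') :
    ∃ ε > 0, ∃ τ > 0, ∀ (α β α' β' ρ' κ₁ κ d : ℝ) (g₁ g y : ℂ → ℂ), 0 < α → α ≤ α' → β' ≤ β →
      ρ' ≤ ρ / 4 → d ≠ 0 → PowerPrimitive (sector α β ρ) q₁ κ₁ ε g₁ →
      PowerPrimitive (sector α β ρ) q κ ε g →
      ConjSymm (sector α' β' ρ') y → DifferentiableOn ℂ y (sector α' β' ρ') →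
      (∀ z ∈ sector α' β' ρ', ‖y z - z‖ ≤ τ * ‖z‖ ∧ g₁ (y z) = g₁ z + d) →
      PowerPrimitive (sector α' β' ρ') (q - q₁ - 1) (d * (κ / κ₁ * ((q - q₁ : ℤ) : ℝ))) ε'
        (fun z => g (y z) - g z) := by
  set e := min (1 / 12) (ε' / 12) with he
  have he0 : 0 < e := by positivity
  have he1 : e ≤ 1 / 12 := min_le_left _ _
  obtain ⟨s₁, hs₁, hs₁ρ, ε₁, hε₁, H₁⟩ := exists_relClose_center (q - q₁ - 1) (half_pos hρ0)
    (by linarith : ρ / 2 ≤ 1) he0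
  obtain ⟨s₂, hs₂, hs₂ρ, ε₂, hε₂, H₂⟩ := exists_relClose_center q₁ hρ0 hρ he0
  obtain ⟨ε₃, hε₃, hε₃2, H₃⟩ := exists_powerLike_deriv_div hq hρ0 hρ hε₁
  refine ⟨min ε₂ ε₃, by positivity, min s₁ s₂, by positivity, ?_⟩
  intro α β α' β' ρ' κ₁ κ d g₁ g y hα hαα hββ hρρ hd hg₁ hg hys hyd hy
  have hα' : 0 < α' := hα.trans_le hαα
  have hsub4 : sector α' β' ρ' ⊆ sector α β (ρ / 2 / 2) :=
    sector_mono hα' hαα hββ (by linarith)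
  have hsub2 : sector α β (ρ / 2 / 2) ⊆ sector α β (ρ / 2) :=
    sector_mono hα le_rfl le_rfl (by linarith)
  have hsub1 : sector α β (ρ / 2) ⊆ sector α β ρ := sector_mono hα le_rfl le_rfl (by linarith)
  have hopen := isOpen_sector α β ρ
  have hyΩ : ∀ z ∈ sector α' β' ρ', y z ∈ sector α β ρ := fun z hz =>
    mem_sector_of_near hα hρ0 hρ (hsub2 (hsub4 hz)) ((hy z hz).1.trans
      (by gcongr; exact (min_le_right _ _).trans hs₂ρ))
  have hdg : ∀ v ∈ sector α β ρ, DifferentiableAt ℂ g v := fun v hv =>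
    (hg.diff v hv).differentiableAt (hopen.mem_nhds hv)
  have hdg₁ : ∀ v ∈ sector α β ρ, DifferentiableAt ℂ g₁ v := fun v hv =>
    (hg₁.diff v hv).differentiableAt (hopen.mem_nhds hv)
  have hdy : ∀ z ∈ sector α' β' ρ', DifferentiableAt ℂ y z := fun v hv =>
    (hyd v hv).differentiableAt ((isOpen_sector _ _ _).mem_nhds hv)
  obtain ⟨hR, hRp⟩ := H₃ α β κ₁ κ hα (deriv g₁) (deriv g)
    (hg₁.powerLike.mono subset_rfl (min_le_right _ _))
    (hg.powerLike.mono subset_rfl (min_le_right _ _))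
  have hz0 : ∀ z ∈ sector α β ρ, z ≠ 0 := fun z hz => ne_zero_of_mem_sector hα hρ hz
  have hg₁0 : ∀ z ∈ sector α β ρ, deriv g₁ z ≠ 0 := fun z hz =>
    (hg₁.powerLike.mono (ε' := 1 / 2) subset_rfl ((min_le_right _ _).trans hε₃2)).ne_zero
      (by norm_num) hz (hz0 z hz)
  refine ⟨?_, ?_, ?_, ?_⟩
  · intro z hz
    exact (((hdg _ (hyΩ z hz)).comp z (hdy z hz)).sub
      (hdg z (hsub1 (hsub2 (hsub4 hz))))).differentiableWithinAt
  · intro z hz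
    simp only [hys z hz, hg.symm _ (hyΩ z hz), hg.symm z (hsub1 (hsub2 (hsub4 hz))), map_sub]
  · refine mul_ne_zero hd (mul_ne_zero (div_ne_zero hg.ne hg₁.ne) ?_)
    exact_mod_cast sub_ne_zero.2 hq.symm
  intro z hz
  have hz4 := hsub4 hz
  have hz2 := hsub2 hz4
  have hz1 := hsub1 hz2
  have hyz := hyΩ z hz
  obtain ⟨hy1, hy2⟩ := hy z hz
  have hyne : y z - z ≠ 0 := by
    intro h
    rw [sub_eq_zero.1 h] at hy2
    exact hd (by simpa using hy2)
  set R : ℂ → ℂ := fun z => deriv g z / deriv g₁ z with hRdef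
  -- the derivative of the increment
  have hder : deriv (fun z => g (y z) - g z) z = deriv g₁ z * (R (y z) - R z) := by
    have h1 : HasDerivAt (fun w => g₁ (y w)) (deriv g₁ (y z) * deriv y z) z :=
      (hdg₁ _ hyz).hasDerivAt.comp z (hdy z hz).hasDerivAt
    have h2 : HasDerivAt (fun w => g₁ (y w)) (deriv g₁ z) z := by
      have h3 : (fun w => g₁ (y w)) =ᶠ[nhds z] fun w => g₁ w + d := by
        filter_upwards [(isOpen_sector _ _ _).mem_nhds hz] with w hw
        exact (hy w hw).2
      exact ((hdg₁ z hz1).hasDerivAt.add_const _).congr_of_eventuallyEq h3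
    have h4 := h1.unique h2
    have h5 : HasDerivAt (fun w => g (y w) - g w) (deriv g (y z) * deriv y z - deriv g z) z :=
      ((hdg _ hyz).hasDerivAt.comp z (hdy z hz).hasDerivAt).sub (hdg z hz1).hasDerivAt
    rw [h5.deriv, hRdef]
    have h6 := hg₁0 _ hyz
    have h7 := hg₁0 _ hz1
    have h8 : deriv y z = deriv g₁ z / deriv g₁ (y z) := by
      rw [eq_div_iff h6, ← h4]; ring
    rw [h8]
    field_simp
  set B : ℂ := κ₁ * z ^ q₁ with hB
  set c : ℂ := ((κ / κ₁ * ((q - q₁ : ℤ) : ℝ) : ℝ) : ℂ) * z ^ (q - q₁ - 1) with hc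
  have hzz : ∀ t : ℝ, 0 ≤ t → ‖z - z‖ ≤ t * ‖z‖ := fun t ht => by
    rw [sub_self, norm_zero]; positivity
  have hB0 : B ≠ 0 := mul_ne_zero (by exact_mod_cast hg₁.ne) (zpow_ne_zero _ (hz0 z hz1))
  have hr₂ := H₂ α β κ₁ (deriv g₁) hα (fun z hz => (hg₁.rel z hz).mono (min_le_left _ _)) z hz2
  -- `g₁'`, the increment of `R` and `d` are compared with exact powers; in the quotient the
  -- unknown `y z - z` cancels
  have e1 : RelClose e (deriv g₁ z) B := hr₂ z (hzz _ hs₂.le)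
  have e2 : RelClose e (R (y z) - R z) (c * (y z - z)) := by
    have hr₁ := H₁ α β _ (deriv R) hα hRp.rel z hz4
    exact (relClose_sub_of_relClose_deriv (fun v hv => (hR v
      (mem_sector_of_near hα hρ0 hρ hz2 (hv.trans (by gcongr; linarith)))).differentiableAt
      (hopen.mem_nhds (mem_sector_of_near hα hρ0 hρ hz2 (hv.trans (by gcongr; linarith)))))
      hr₁ (hy1.trans (by gcongr; exact min_le_left _ _)) (hzz _ hs₁.le))
  have e3 : RelClose e (d : ℂ) (B * (y z - z)) := by
    have := (relClose_sub_of_relClose_deriv (fun v hv => hdg₁ v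
      (mem_sector_of_near hα hρ0 hρ hz2 (hv.trans (by gcongr))))
      hr₂ (hy1.trans (by gcongr; exact min_le_right _ _)) (hzz _ hs₂.le))
    rwa [hy2, add_sub_cancel_left] at this
  have hd0 : (d : ℂ) ≠ 0 := by exact_mod_cast hd
  have e4 := (e1.mul e2 he0.le (by linarith)).div (e3.mono (by linarith : e ≤ 3 * e))
    (by positivity) (by linarith) (mul_ne_zero hB0 hyne)
  have e5 : B * (c * (y z - z)) / (B * (y z - z)) = c := by field_simp
  rw [e5, ← hder] at e4
  have e6 := e4.const_mul (d : ℂ)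
  rw [mul_div_cancel₀ _ hd0] at e6
  have e7 : ((d * (κ / κ₁ * ((q - q₁ : ℤ) : ℝ)) : ℝ) : ℂ) * z ^ (q - q₁ - 1) = d * c := by
    rw [hc]; push_cast; ring
  rw [e7]
  refine e6.mono ?_
  have : e ≤ ε' / 12 := min_le_right _ _
  linarith

/-! ### Thinning out a finite set -/

theorem exists_large_fiber {ι : Type*} [DecidableEq ι] {X : Finset ℝ} {t : Finset ι} {c : ℝ → ι}
    (hc : ∀ x ∈ X, c x ∈ t) (ht : t.Nonempty) :
    ∃ i ∈ t, (X.card : ℝ) ≤ t.card * ((X.filter fun x => c x = i).card : ℝ) := by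
  have ht0 : (0 : ℝ) < t.card := by exact_mod_cast ht.card_pos
  obtain ⟨i, hi, h⟩ := Finset.exists_le_card_fiber_of_nsmul_le_card_of_maps_to (M := ℝ)
    (b := X.card / t.card) hc ht (by rw [nsmul_eq_mul, mul_div_cancel₀ _ ht0.ne'])
  exact ⟨i, hi, by rwa [div_le_iff₀' ht0] at h⟩

/-- If the derivative of `h` has at most `k` zeros, then `h` is strictly monotone on a subset of
`X` of size at least `|X| / (k + 1)`. -/
theorem exists_strictMonoOn_subset {k : ℕ} {α β : ℝ} {h F : ℝ → ℝ}
    (hF : ∀ x ∈ Set.Icc α β, HasDerivAt h (F x) x)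
    (hz : ∀ z : Fin (k + 1) → ℝ, StrictMono z → (∀ l, z l ∈ Set.Icc α β) → ¬ ∀ l, F (z l) = 0)
    {X : Finset ℝ} (hX : (X : Set ℝ) ⊆ Set.Icc α β) :
    ∃ X' ⊆ X, (X.card : ℝ) ≤ (k + 1 : ℕ) * (X'.card : ℝ) ∧
      (StrictMonoOn h X' ∨ StrictAntiOn h X') := by
  classical
  have hcard : ∀ S : Finset ℝ, (S : Set ℝ) ⊆ {x ∈ Set.Icc α β | F x = 0} → S.card ≤ k := by
    intro S hS
    by_contra hlt
    push Not at hlt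
    obtain ⟨S', hS', hk⟩ := Finset.exists_subset_card_eq (Nat.succ_le_of_lt hlt)
    refine hz (S'.orderEmbOfFin hk) (S'.orderEmbOfFin hk).strictMono (fun l => ?_) fun l => ?_
    · exact (hS (hS' (S'.orderEmbOfFin_mem hk l))).1
    · exact (hS (hS' (S'.orderEmbOfFin_mem hk l))).2
  have hfin : {x ∈ Set.Icc α β | F x = 0}.Finite := by
    by_contra hinf
    obtain ⟨S, hS, hSk⟩ := Set.Infinite.exists_subset_card_eq hinf (k + 1)
    have := hcard S hS
    omega
  set Z := hfin.toFinset with hZ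
  have hZk : Z.card ≤ k := hcard Z (by simp [hZ])
  -- points are classified by the number of zeros of `F` to their left
  set c : ℝ → ℕ := fun x => (Z.filter fun z => z < x).card with hc
  obtain ⟨i, -, hi⟩ := exists_large_fiber (X := X) (t := Finset.range (k + 1)) (c := c)
    (fun x _ => Finset.mem_range.2
      (Nat.lt_succ_of_le ((Finset.card_le_card (Finset.filter_subset _ _)).trans hZk)))
    ⟨0, by simp⟩
  set X' := X.filter fun x => c x = i with hX'
  refine ⟨X', Finset.filter_subset _ _, by simpa using hi, ?_⟩
  rcases X'.eq_empty_or_nonempty with h0 | hne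
  · left; rw [h0]; intro x hx; simp at hx
  set x₀ := X'.min' hne
  set x₁ := X'.max' hne
  have hx₀ := Finset.mem_filter.1 (X'.min'_mem hne)
  have hx₁ := Finset.mem_filter.1 (X'.max'_mem hne)
  have hsub : Set.Icc x₀ x₁ ⊆ Set.Icc α β := Set.Icc_subset_Icc (hX hx₀.1).1 (hX hx₁.1).2
  have hXsub : (X' : Set ℝ) ⊆ Set.Icc x₀ x₁ := fun x hx =>
    ⟨X'.min'_le x hx, X'.le_max' x hx⟩
  have hnz : ∀ x ∈ Set.Ico x₀ x₁, F x ≠ 0 := by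
    intro x hx h
    have hxZ : x ∈ Z := by
      rw [hZ, Set.Finite.mem_toFinset]
      exact ⟨hsub (Set.Ico_subset_Icc_self hx), h⟩
    have hlt : c x₀ < c x₁ := by
      refine Finset.card_lt_card (Finset.ssubset_iff_subset_ne.2 ⟨fun z hz => ?_, fun heq => ?_⟩)
      · rw [Finset.mem_filter] at hz ⊢
        exact ⟨hz.1, hz.2.trans (hx.1.trans_lt hx.2)⟩
      · have h1 : x ∈ Z.filter fun z => z < x₁ := Finset.mem_filter.2 ⟨hxZ, hx.2⟩
        rw [← heq, Finset.mem_filter] at h1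
        exact absurd hx.1 (not_le.2 h1.2)
    rw [hx₀.2, hx₁.2] at hlt
    exact lt_irrefl _ hlt
  have hcont : ContinuousOn h (Set.Icc x₀ x₁) := fun x hx =>
    (hF x (hsub hx)).continuousAt.continuousWithinAt
  have hint : ∀ x ∈ interior (Set.Icc x₀ x₁), x ∈ Set.Ico x₀ x₁ := fun x hx => by
    rw [interior_Icc] at hx; exact Set.Ioo_subset_Ico_self hx
  rcases hasDerivWithinAt_forall_lt_or_forall_gt_of_forall_ne (convex_Ico x₀ x₁)
    (fun x hx => (hF x (hsub (Set.Ico_subset_Icc_self hx))).hasDerivWithinAt) hnz with hs | hs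
  · right
    refine (strictAntiOn_of_deriv_neg (convex_Icc x₀ x₁) hcont fun x hx => ?_).mono hXsub
    rw [(hF x (hsub (Set.Ico_subset_Icc_self (hint x hx)))).deriv]
    exact hs x (hint x hx)
  · left
    refine (strictMonoOn_of_deriv_pos (convex_Icc x₀ x₁) hcont fun x hx => ?_).mono hXsub
    rw [(hF x (hsub (Set.Ico_subset_Icc_self (hint x hx)))).deriv]
    exact hs x (hint x hx)

theorem exists_common_strictMonoOn_subset {ι : Type*} {k : ℕ} {α β : ℝ} {h F : ι → ℝ → ℝ}
    (hF : ∀ i, ∀ x ∈ Set.Icc α β, HasDerivAt (h i) (F i x) x)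
    (hz : ∀ i, ∀ z : Fin (k + 1) → ℝ, StrictMono z → (∀ l, z l ∈ Set.Icc α β) →
      ¬ ∀ l, F i (z l) = 0)
    {X : Finset ℝ} (hX : (X : Set ℝ) ⊆ Set.Icc α β) (s : Finset ι) :
    ∃ X' ⊆ X, (X.card : ℝ) ≤ ((k + 1 : ℕ) : ℝ) ^ s.card * (X'.card : ℝ) ∧
      ∀ i ∈ s, StrictMonoOn (h i) X' ∨ StrictAntiOn (h i) X' := by
  classical
  induction s using Finset.induction_on with
  | empty => exact ⟨X, subset_rfl, by simp, by simp⟩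
  | insert i s hi ih =>
    obtain ⟨X₁, h1, h2, h3⟩ := ih
    obtain ⟨X₂, h4, h5, h6⟩ := exists_strictMonoOn_subset (hF i) (hz i)
      (X := X₁) (subset_trans (by exact_mod_cast h1) hX)
    refine ⟨X₂, h4.trans h1, ?_, ?_⟩
    · rw [Finset.card_insert_of_notMem hi, pow_succ, mul_assoc]
      exact h2.trans (by gcongr)
    · intro j hj
      rcases Finset.mem_insert.1 hj with rfl | hj
      · exact h6
      · exact (h3 j hj).imp (fun h => h.mono (by exact_mod_cast h4))
          fun h => h.mono (by exact_mod_cast h4)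

/-- A set of positive numbers with many large gaps contains a large lacunary subset. -/
theorem exists_lacunary_subset {η : ℝ} (hη : 0 < η) :
    ∃ s : ℕ, 0 < s ∧ ∀ E : Finset ℝ, (∀ x ∈ E, 0 < x) →
      (∀ x ∈ E, ∀ x' ∈ E, x < x' → (1 + η) * x < x') →
      ∃ E' ⊆ E, (E.card : ℝ) ≤ s * E'.card ∧ ∀ x ∈ E', ∀ x' ∈ E', x < x' → 4 * x ≤ x' := by
  obtain ⟨r, hr⟩ := pow_unbounded_of_one_lt 4 (by linarith : 1 < 1 + η)
  have hl : 0 < Real.log (1 + η) := Real.log_pos (by linarith)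
  refine ⟨r + 1, Nat.succ_pos r, fun E hE0 hE => ?_⟩
  -- distinct points have distinct logarithmic scales `f x`; keep one residue class modulo `r + 1`
  set f : ℝ → ℤ := fun x => ⌊Real.log x / Real.log (1 + η)⌋ with hf
  obtain ⟨i, -, hi⟩ := exists_large_fiber (X := E) (t := Finset.Ico (0 : ℤ) (r + 1 : ℕ))
    (c := fun x => f x % (r + 1 : ℕ))
    (fun x _ => Finset.mem_Ico.2
      ⟨Int.emod_nonneg _ (by positivity), Int.emod_lt_of_pos _ (by positivity)⟩)
    ⟨0, by simp⟩
  refine ⟨_, Finset.filter_subset _ E, by simpa using hi, ?_⟩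
  intro x hx x' hx' hlt
  rw [Finset.mem_filter] at hx hx'
  have hx0 := hE0 x hx.1
  have hx'0 := hE0 x' hx'.1
  have h1 := hE x hx.1 x' hx'.1 hlt
  have h2 : Real.log x / Real.log (1 + η) + 1 ≤ Real.log x' / Real.log (1 + η) := by
    rw [div_add_one hl.ne', div_le_div_iff_of_pos_right hl,
      ← Real.log_mul hx0.ne' (by linarith)]
    exact Real.log_le_log (by positivity) (by linarith)
  have h3 : f x + 1 ≤ f x' := by
    have := Int.floor_le_floor h2
    rwa [Int.floor_add_one] at this
  have h4 : ((r + 1 : ℕ) : ℤ) ∣ f x' - f x :=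
    Int.dvd_of_emod_eq_zero (Int.emod_eq_emod_iff_emod_sub_eq_zero.1 (hx'.2.trans hx.2.symm))
  have h5 : ((r + 1 : ℕ) : ℤ) ≤ f x' - f x := Int.le_of_dvd (by linarith) h4
  have h6 : (r : ℝ) ≤ Real.log x' / Real.log (1 + η) - Real.log x / Real.log (1 + η) := by
    have h7 : ((f x' - f x : ℤ) : ℝ) ≥ (r + 1 : ℕ) := by exact_mod_cast h5
    have h8 := Int.floor_le (Real.log x' / Real.log (1 + η))
    have h9 := Int.lt_floor_add_one (Real.log x / Real.log (1 + η))
    push_cast at h7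
    simp only [hf] at h7
    linarith
  rw [← sub_div, le_div_iff₀ hl, ← Real.log_div hx'0.ne' hx0.ne', ← Real.log_pow] at h6
  have h7 := (Real.log_le_log_iff (by positivity) (by positivity)).1 h6
  have h8 : 4 ≤ x' / x := hr.le.trans h7
  rwa [le_div_iff₀ hx0] at h8

/-! ### Gaps of a power-like function on lacunary sets -/

theorem PowerPrimitive.exists_sub_eq {α β ρ κ ε : ℝ} {q : ℤ} {g : ℂ → ℂ} (hα : 0 < α)
    (hρ0 : 0 < ρ) (hq : q ≠ -1) (hg : PowerPrimitive (sector α β ρ) q κ ε g)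
    {x y : ℝ} (hx : α ≤ x) (hxy : x < y) (hy : y ≤ β) :
    ∃ e, |e| ≤ ε ∧ (g y).re - (g x).re =
      κ / ((q + 1 : ℤ) : ℝ) * (y ^ (q + 1) - x ^ (q + 1)) * (1 + e) := by
  have hq1 : (((q + 1 : ℤ)) : ℝ) ≠ 0 := by
    exact_mod_cast fun h : q + 1 = 0 => hq (by omega)
  have hmem : ∀ t ∈ Set.Icc x y, (t : ℂ) ∈ sector α β ρ := fun t ht =>
    ofReal_mem_sector hα hρ0 ⟨hx.trans ht.1, ht.2.trans hy⟩
  have h1 : ∀ t ∈ Set.Icc x y, HasDerivAt (fun t : ℝ => (g t).re) (deriv g t).re t :=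
    fun t ht => hasDerivAt_re (isOpen_sector _ _ _) hg.diff (hmem t ht)
  have h2 : ∀ t ∈ Set.Icc x y, HasDerivAt (fun t : ℝ => t ^ (q + 1))
      (((q + 1 : ℤ) : ℝ) * t ^ q) t := fun t ht => by
    have := hasDerivAt_zpow (q + 1) t (Or.inl ((hα.trans_le hx).trans_le ht.1).ne')
    simpa using this
  obtain ⟨ξ, hξ, hξe⟩ := exists_ratio_hasDerivAt_eq_ratio_slope (fun t : ℝ => (g t).re)
    (fun t : ℝ => (deriv g t).re) hxy
    (fun t ht => (h1 t ht).continuousAt.continuousWithinAt)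
    (fun t ht => h1 t (Set.Ioo_subset_Icc_self ht)) (fun t : ℝ => t ^ (q + 1))
    (fun t => ((q + 1 : ℤ) : ℝ) * t ^ q)
    (fun t ht => (h2 t ht).continuousAt.continuousWithinAt)
    (fun t ht => h2 t (Set.Ioo_subset_Icc_self ht))
  have hξI := Set.Ioo_subset_Icc_self hξ
  have hξ0 : 0 < ξ := (hα.trans_le hx).trans_le hξI.1
  have h3 := hg.rel ξ (hmem ξ hξI)
  have h4 : |(deriv g ξ).re - κ * ξ ^ q| ≤ ε * |κ * ξ ^ q| := by
    have h5 : ((deriv g ξ) - (κ : ℂ) * (ξ : ℂ) ^ q).re = (deriv g ξ).re - κ * ξ ^ q := by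
      rw [Complex.sub_re, ← Complex.ofReal_zpow, ← Complex.ofReal_mul, Complex.ofReal_re]
    rw [← h5]
    refine (Complex.abs_re_le_norm _).trans (le_trans h3 (le_of_eq ?_))
    rw [← Complex.ofReal_zpow, ← Complex.ofReal_mul, Complex.norm_real, Real.norm_eq_abs]
  have hξq : κ * ξ ^ q ≠ 0 := mul_ne_zero hg.ne (zpow_ne_zero _ hξ0.ne')
  refine ⟨((deriv g ξ).re - κ * ξ ^ q) / (κ * ξ ^ q), ?_, ?_⟩
  · rw [abs_div, div_le_iff₀ (abs_pos.2 hξq)]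
    exact h4
  · have hξq' : ξ ^ q ≠ 0 := zpow_ne_zero _ hξ0.ne'
    have hκ := hg.ne
    have h6 : (g y).re - (g x).re =
        (y ^ (q + 1) - x ^ (q + 1)) * (deriv g ξ).re / (((q + 1 : ℤ) : ℝ) * ξ ^ q) := by
      rw [eq_div_iff (mul_ne_zero hq1 hξq'), hξe]
    rw [h6]
    field_simp
    ring

theorem four_mul_zpow_le {a : ℤ} (ha : 0 < a) {x y : ℝ} (hx : 0 < x) (h : 4 * x ≤ y) :
    4 * x ^ a ≤ y ^ a := by
  have h1 : (4 * x) ^ a ≤ y ^ a := zpow_le_zpow_left₀ ha.le (by positivity) h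
  rw [mul_zpow] at h1
  have h2 : (4 : ℝ) ≤ 4 ^ a := by
    have := zpow_le_zpow_right₀ (by norm_num : (1 : ℝ) ≤ 4) (by omega : (1 : ℤ) ≤ a)
    simpa using this
  have : 0 < x ^ a := zpow_pos hx a
  nlinarith

/-- Over a lacunary set, a power-like primitive has pairwise distinct gaps. -/
theorem PowerPrimitive.gap_ne {α β ρ κ ε : ℝ} {q : ℤ} {g : ℂ → ℂ} (hα : 0 < α)
    (hρ0 : 0 < ρ) (hq : q ≠ -1) (hε : ε ≤ 1 / 4) (hg : PowerPrimitive (sector α β ρ) q κ ε g)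
    {x y x' y' : ℝ} (hx : α ≤ x) (hxy : 4 * x ≤ y) (hyx : y ≤ x') (hxy' : 4 * x' ≤ y')
    (hy' : y' ≤ β) : (g y).re - (g x).re ≠ (g y').re - (g x').re := by
  have hx0 : 0 < x := hα.trans_le hx
  have hy0 : 0 < y := by linarith
  have hx'0 : 0 < x' := by linarith
  have hy'0 : 0 < y' := by linarith
  obtain ⟨e, he, h1⟩ := hg.exists_sub_eq hα hρ0 hq hx (by linarith : x < y) (by linarith)
  obtain ⟨e', he', h2⟩ := hg.exists_sub_eq hα hρ0 hq (by linarith : α ≤ x')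
    (by linarith : x' < y') hy'
  rw [h1, h2]
  have hq1 : (((q + 1 : ℤ)) : ℝ) ≠ 0 := by
    exact_mod_cast fun h : q + 1 = 0 => hq (by omega)
  have hk : κ / ((q + 1 : ℤ) : ℝ) ≠ 0 := div_ne_zero hg.ne hq1
  rw [mul_assoc, mul_assoc]
  intro h
  have h3 := mul_left_cancel₀ hk h
  obtain ⟨he1, he2⟩ := abs_le.1 he
  obtain ⟨he'1, he'2⟩ := abs_le.1 he'
  have hpy : 0 < y ^ (q + 1) := zpow_pos hy0 _
  have hpx : 0 < x ^ (q + 1) := zpow_pos hx0 _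
  have hpx' : 0 < x' ^ (q + 1) := zpow_pos hx'0 _
  have hpy' : 0 < y' ^ (q + 1) := zpow_pos hy'0 _
  rcases lt_or_gt_of_ne (fun h : q + 1 = 0 => hq (by omega)) with hneg | hpos
  · -- decreasing powers: the gap at the smaller point is larger
    have hinv : ∀ u v : ℝ, 0 < u → 4 * u ≤ v → 4 * v ^ (q + 1) ≤ u ^ (q + 1) := by
      intro u v hu huv
      have hv : 0 < v := by linarith
      have h4 := four_mul_zpow_le (a := -(q + 1)) (by omega) (inv_pos.2 hv)
        (y := u⁻¹) (by rw [← div_eq_mul_inv, ← one_div, div_le_div_iff₀ hv hu]; linarith)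
      simpa using h4
    have h4 := hinv x y hx0 hxy
    have h5 := hinv x' y' hx'0 hxy'
    have h6 : x' ^ (q + 1) ≤ y ^ (q + 1) := by
      have h7 := zpow_le_zpow_left₀ (a := x'⁻¹) (b := y⁻¹) (by omega : 0 ≤ -(q + 1))
        (by positivity) (inv_anti₀ hy0 hyx)
      simpa using h7
    nlinarith
  · have h4 := four_mul_zpow_le (a := q + 1) (by omega) hx0 hxy
    have h5 := four_mul_zpow_le (a := q + 1) (by omega) hx'0 hxy'
    have h6 : y ^ (q + 1) ≤ x' ^ (q + 1) := zpow_le_zpow_left₀ (by omega) hy0.le hyx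
    nlinarith

theorem min_zpow_le {a : ℤ} {u v x : ℝ} (hu : 0 < u) (hx : x ∈ Set.Icc u v) :
    min (u ^ a) (v ^ a) ≤ x ^ a := by
  have hx0 : 0 < x := hu.trans_le hx.1
  have hv0 : 0 < v := hx0.trans_le hx.2
  rcases le_total 0 a with ha | ha
  · exact (min_le_left _ _).trans (zpow_le_zpow_left₀ ha hu.le hx.1)
  · refine (min_le_right _ _).trans ?_
    have h7 := zpow_le_zpow_left₀ (a := v⁻¹) (b := x⁻¹) (by omega : 0 ≤ -a)
      (by positivity) (inv_anti₀ hx0 hx.2)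
    simpa using h7

/-! ### The exponent sequence -/

theorem one_le_growthExponent (n : ℕ) : 1 ≤ growthExponent n := by
  induction n using Nat.strong_induction_on with
  | _ n ih =>
    match n with
    | 0 => simp [growthExponent]
    | 1 => simp [growthExponent]
    | n + 2 =>
      have := ih (n + 1) (by omega)
      rw [growthExponent]
      have h1 : 0 < growthExponent (n + 1) := by linarith
      have : 0 < 1 / (1 + 1 / growthExponent (n + 1)) := by positivity
      linarith

theorem growthExponent_le_two (n : ℕ) : growthExponent n ≤ 2 := by
  match n with
  | 0 => simp [growthExponent]
  | 1 => simp [growthExponent]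
  | n + 2 =>
    have h1 : 0 < growthExponent (n + 1) := by linarith [one_le_growthExponent (n + 1)]
    rw [growthExponent]
    have h2 : 1 / (1 + 1 / growthExponent (n + 1)) ≤ 1 := by
      rw [div_le_one (by positivity)]
      have : 0 < 1 / growthExponent (n + 1) := by positivity
      linarith
    linarith

/-- The recursion for the exponents balances the bounds `A P` and `A (A / P) ^ φ`. -/
theorem rpow_growthExponent_le_or (n : ℕ) {A P : ℝ} (hA : 1 ≤ A) (hP : 0 < P) :
    A ^ growthExponent (n + 2) ≤ A * P ∨
      A ^ growthExponent (n + 2) ≤ A * (A / P) ^ growthExponent (n + 1) := by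
  set φ' := growthExponent (n + 1) with hφ'
  have hφ0 : 0 < φ' := by linarith [one_le_growthExponent (n + 1)]
  have hA0 : 0 < A := by linarith
  set t := 1 / (1 + 1 / φ') with ht
  have hφ : growthExponent (n + 2) = 1 + t := by rw [growthExponent]
  have ht1 : (1 - t) * φ' = t := by
    rw [ht]; field_simp; ring
  rw [hφ, Real.rpow_add hA0, Real.rpow_one]
  rcases le_total (A ^ t) P with h | h
  · left; gcongr
  · right
    gcongr
    have h1 : A ^ (1 - t) ≤ A / P := by
      rw [Real.rpow_sub hA0, Real.rpow_one]
      gcongr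
    calc A ^ t = (A ^ (1 - t)) ^ φ' := by rw [← Real.rpow_mul hA0.le, ht1]
      _ ≤ (A / P) ^ φ' := by gcongr

/-! ### Growth for tuples of power-like functions -/

/-- The sparse case of the induction step: over a lacunary set the gaps of a power-like primitive are
pairwise distinct, so inserting the smaller half of them into the larger half gives a quadratic
number of elements. -/
theorem rich_of_lacunary (m : ℕ) {α β ρ κ ε a b : ℝ} {q : ℤ} {g : ℂ → ℂ} (hα : 0 < α)
    (hρ0 : 0 < ρ) (hq : q ≠ -1) (hε : ε ≤ 1 / 4) (hg : PowerPrimitive (sector α β ρ) q κ ε g)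
    (ha : a ≠ 0) {h : ℝ → ℝ} {X : Finset ℝ} (hX : (X : Set ℝ) ⊆ Set.Icc α β)
    (hmono : StrictMonoOn h X ∨ StrictAntiOn h X) (hh : ∀ x ∈ X, h x = a * (g x).re + b)
    (hlac : ∀ x ∈ X, ∀ x' ∈ X, x < x' → 4 * x ≤ x') (hcard : 4 ≤ X.card) :
    Rich (m + 1) h X ((X.card : ℝ) ^ 2 / 32) := by
  classical
  have he := card_le_card_nonMax X
  have hne : (nonMax X).Nonempty := Finset.card_pos.1 (by omega)
  obtain ⟨B, hB, hBk, τ, h1, h2⟩ := exists_top (fun x => |h (nxt X x) - h x|) (nonMax X)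
    (Nat.div_le_self (nonMax X).card 2) hne
  have key : ∀ x ∈ nonMax X, ∀ x' ∈ nonMax X, x < x' →
      h (nxt X x) - h x ≠ h (nxt X x') - h x' := by
    intro x hx x' hx' hlt heq
    have hxX := nonMax_subset X hx
    have hxX' := nonMax_subset X hx'
    rw [hh _ (nxt_mem hx), hh _ hxX, hh _ (nxt_mem hx'), hh _ hxX'] at heq
    refine hg.gap_ne hα hρ0 hq hε (hX hxX).1 (hlac _ hxX _ (nxt_mem hx) (lt_nxt hx))
      (nxt_le hxX' hlt) (hlac _ hxX' _ (nxt_mem hx') (lt_nxt hx')) (hX (nxt_mem hx')).2 ?_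
    exact mul_left_cancel₀ ha (by linarith)
  have hinj : Set.InjOn (fun x => h (nxt X x) - h x) (nonMax X) := by
    intro x hx x' hx' heq
    rcases lt_trichotomy x x' with hlt | heq' | hlt
    · exact absurd heq (key x hx x' hx' hlt)
    · exact heq'
    · exact absurd heq.symm (key x' hx' x hx hlt)
  have hX0 : X.Nonempty := Finset.card_pos.1 (by omega)
  have hr := rich_of_distinct_gaps (m := m) (Y := nonMax X \ B) hmono hX0 Finset.sdiff_subset hB
    (fun x hx => h2 x (Finset.mem_sdiff.1 hx).1 (Finset.mem_sdiff.1 hx).2) h1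
  rw [Finset.card_image_of_injOn (hinj.mono (by
    exact_mod_cast (Finset.sdiff_subset : nonMax X \ B ⊆ nonMax X))),
    Finset.card_sdiff_of_subset hB, hBk] at hr
  refine hr.mono subset_rfl ?_
  set e := (nonMax X).card
  have h3 : e ≤ 2 * (e / 2) + 1 := by omega
  have h4 : e ≤ 2 * (e - e / 2) := by omega
  have h3' : (e : ℝ) ≤ 2 * ((e / 2 : ℕ) : ℝ) + 1 := by exact_mod_cast h3
  have h4' : (e : ℝ) ≤ 2 * ((e - e / 2 : ℕ) : ℝ) := by exact_mod_cast h4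
  have he' : (X.card : ℝ) ≤ e + 1 := by exact_mod_cast he
  have hc' : (4 : ℝ) ≤ X.card := by exact_mod_cast hcard
  have h5 : (X.card : ℝ) / 4 ≤ ((e / 2 : ℕ) : ℝ) := by linarith
  have h6 : (X.card : ℝ) / 8 ≤ ((e - e / 2 : ℕ) : ℝ) := by linarith
  calc (X.card : ℝ) ^ 2 / 32 = (X.card : ℝ) / 4 * ((X.card : ℝ) / 8) := by ring
    _ ≤ _ := by gcongr

/-- Points of `C ⊆ E` at which none of the functions `γ i` takes one of its largest values on `E`;
they still make up at least a quarter of `E`. -/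
theorem exists_small_values {L : ℕ} (hL : 0 < L) {E C : Finset ℝ} (γ : Fin L → ℝ → ℝ)
    (hC : C ⊆ E) (hC2 : (E.card : ℝ) ≤ 2 * C.card) (hE : 4 * L ≤ E.card) :
    ∃ (B : Fin L → Finset ℝ) (τ : Fin L → ℝ) (S : Finset ℝ), S ⊆ C ∧ (∀ i, B i ⊆ E) ∧
      (∀ i, (E.card : ℝ) / (8 * L) ≤ (B i).card) ∧ (∀ i, ∀ x ∈ B i, τ i ≤ γ i x) ∧
      (∀ i, ∀ x ∈ S, γ i x ≤ τ i) ∧ (E.card : ℝ) / 4 ≤ S.card := by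
  classical
  set k := E.card / (4 * L) with hk
  have hne : E.Nonempty := Finset.card_pos.1 (by omega)
  choose B hB hBk τ h1 h2 using fun i => exists_top (γ i) E
    (Nat.div_le_self E.card (4 * L)) hne
  have hL' : (0 : ℝ) < L := by exact_mod_cast hL
  have hk1 : 1 ≤ k := (Nat.one_le_div_iff (by omega)).2 hE
  have hk2 : k * (4 * L) ≤ E.card := Nat.div_mul_le_self _ _
  have hk3 : E.card < (k + 1) * (4 * L) := by
    have := Nat.lt_div_mul_add (a := E.card) (b := 4 * L) (by omega)
    rw [add_mul, one_mul]; exact this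
  have hk1' : (1 : ℝ) ≤ k := by exact_mod_cast hk1
  have hk2' : (k : ℝ) * (4 * L) ≤ E.card := by exact_mod_cast hk2
  have hk3' : (E.card : ℝ) < (k + 1) * (4 * L) := by exact_mod_cast hk3
  refine ⟨B, τ, C \ Finset.univ.biUnion B, Finset.sdiff_subset, hB, ?_, h1, ?_, ?_⟩
  · intro i
    rw [hBk i, div_le_iff₀ (by positivity)]
    nlinarith
  · intro i x hx
    rw [Finset.mem_sdiff, Finset.mem_biUnion] at hx
    exact h2 i x (hC hx.1) fun hxB => hx.2 ⟨i, Finset.mem_univ i, hxB⟩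
  · have h3 : (Finset.univ.biUnion B).card ≤ L * k := by
      refine Finset.card_biUnion_le.trans ?_
      simp [hBk]
      rfl
    have h4 := Finset.le_card_sdiff (Finset.univ.biUnion B) C
    have h5 : C.card ≤ (C \ Finset.univ.biUnion B).card + L * k := by omega
    have h5' : (C.card : ℝ) ≤ (C \ Finset.univ.biUnion B).card + L * k := by exact_mod_cast h5
    nlinarith

theorem exists_large_fiber_image {S : Finset ℝ} (hS : S.Nonempty) (D : ℝ → ℝ) :
    ∃ d ∈ S.image D,
      (S.card : ℝ) ≤ (S.image D).card * ((S.filter fun x => D x = d).card : ℝ) := by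
  classical
  exact exists_large_fiber (fun x hx => Finset.mem_image_of_mem D hx) (hS.image D)

theorem hasDerivAt_combination {α β ρ : ℝ} {n : ℕ} {g : Fin n → ℂ → ℂ} (hα : 0 < α)
    (hρ0 : 0 < ρ) (hg : ∀ i, DifferentiableOn ℂ (g i) (sector α β ρ)) (T : Fin n → ℝ) (t : ℝ)
    {x : ℝ} (hx : x ∈ Set.Icc α β) :
    HasDerivAt (fun x : ℝ => ∑ j, T j * (g j x).re + t) (∑ j, T j * (deriv (g j) x).re) x :=
  (HasDerivAt.fun_sum fun j _ => (hasDerivAt_re (isOpen_sector _ _ _) (hg j)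
    (ofReal_mem_sector hα hρ0 hx)).const_mul (T j)).add_const _

theorem mul_div_rpow_eq {A P L : ℝ} (hA : 0 ≤ A) (hP : 0 < P) (hL : 0 < L) (c φ : ℝ) :
    c / (8 * L * 4 ^ φ) * (A * (A / P) ^ φ) = A / (8 * L) * (c * (A / (4 * P)) ^ φ) := by
  rw [mul_comm 4 P, ← div_div A P 4, Real.div_rpow (div_nonneg hA hP.le) (by norm_num)]
  have : (0 : ℝ) < 4 ^ φ := by positivity
  field_simp

set_option maxHeartbeats 600000 in
/-- The dense case of the induction step: among gaps that are short relative to the position, a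
popular length `d` of the gaps of the first function yields a tuple of increments of the other
functions. -/
theorem exists_rich_of_close_gaps {m : ℕ} {q : Fin (m + 2) → ℤ} (hq : Function.Injective q)
    {ρ : ℝ} (hρ0 : 0 < ρ) (hρ : ρ ≤ 1)
    (ih : ∀ q : Fin (m + 1) → ℤ, Function.Injective q → q 0 ≠ -1 → ∀ ρ : ℝ, 0 < ρ → ρ ≤ 1 →
      ∃ ε > 0, ∃ c > 0, ∀ α β : ℝ, 0 < α → ∀ (κ : Fin (m + 1) → ℝ) (g : Fin (m + 1) → ℂ → ℂ),
      (∀ i, PowerPrimitive (sector α β ρ) (q i) (κ i) ε (g i)) →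
      ∀ (T : Fin (m + 1) → Fin (m + 1) → ℝ) (t : Fin (m + 1) → ℝ), (∀ i j, i < j → T i j = 0) →
      (∀ i, T i i ≠ 0) → ∀ X : Finset ℝ, X.Nonempty → (X : Set ℝ) ⊆ Set.Icc α β →
      ∃ i, Rich m (fun x => ∑ j, T i j * (g j x).re + t i) X
        (c * (X.card : ℝ) ^ growthExponent (m + 1))) :
    ∃ ε > 0, ∃ η > 0, ∃ c > 0, ∀ α β : ℝ, 0 < α →
      ∀ (κ : Fin (m + 2) → ℝ) (g : Fin (m + 2) → ℂ → ℂ),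
      (∀ i, PowerPrimitive (sector α β ρ) (q i) (κ i) ε (g i)) →
      ∀ (T : Fin (m + 2) → Fin (m + 2) → ℝ) (t : Fin (m + 2) → ℝ), (∀ i j, i < j → T i j = 0) →
      (∀ i, T i i ≠ 0) → ∀ X C : Finset ℝ, (X : Set ℝ) ⊆ Set.Icc α β →
      (∀ i, StrictMonoOn (fun x : ℝ => ∑ j, T i j * (g j x).re + t i) X ∨
        StrictAntiOn (fun x : ℝ => ∑ j, T i j * (g j x).re + t i) X) →
      C ⊆ nonMax X → ((nonMax X).card : ℝ) ≤ 2 * C.card → 4 * (m + 2) ≤ (nonMax X).card →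
      (∀ x ∈ C, nxt X x ≤ (1 + η) * x) →
      ∃ i, Rich (m + 1) (fun x => ∑ j, T i j * (g j x).re + t i) X
        (c * ((nonMax X).card : ℝ) ^ growthExponent (m + 2)) := by
  classical
  obtain ⟨ρ', hρ'0, hρ'ρ, s, hs, εL, hεL, HL⟩ := exists_level_map (q 0) hρ0 hρ
  have hq' : Function.Injective fun i : Fin (m + 1) => q i.succ - q 0 - 1 := fun i j hij => by
    have : q i.succ = q j.succ := by simpa using hij
    exact Fin.succ_injective _ (hq this)
  have hne : ∀ i : Fin (m + 1), q 0 ≠ q i.succ := fun i h => Fin.succ_ne_zero i (hq h).symm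
  obtain ⟨ε', hε', c', hc', IH⟩ := ih (fun i => q i.succ - q 0 - 1) hq'
    (fun h => hne 0 (by have h' : q (Fin.succ 0) - q 0 - 1 = -1 := h; omega)) ρ' hρ'0 (by linarith)
  choose eI heI τI hτI HI using fun i : Fin (m + 1) =>
    exists_powerPrimitive_increment (hne i) hρ0 hρ hε'
  obtain ⟨ε₂, hε₂, hε₂e⟩ := exists_pos_forall_le eI heI
  obtain ⟨τ, hτ, hττ⟩ := exists_pos_forall_le τI hτI
  obtain ⟨ηL, hηL, HL⟩ := HL τ hτ
  obtain ⟨s₁, hs₁, Hs₁⟩ := exists_rel_zpow (q 0) one_pos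
  set η := min s (min s₁ (ηL / 4)) with hη
  have hη0 : 0 < η := by positivity
  have hηs : η ≤ s := min_le_left _ _
  have hηs₁ : η ≤ s₁ := (min_le_right _ _).trans (min_le_left _ _)
  have hηL' : η ≤ ηL / 4 := (min_le_right _ _).trans (min_le_right _ _)
  set φ' := growthExponent (m + 1) with hφ'
  have hφ'0 : 0 < φ' := by linarith [one_le_growthExponent (m + 1)]
  set L : ℝ := ((m + 2 : ℕ) : ℝ) with hL
  have hL0 : 0 < L := by positivity
  refine ⟨min 1 (min εL ε₂), by positivity, η, hη0,
    min (1 / (8 * L)) (c' / (8 * L * 4 ^ φ')), by positivity, ?_⟩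
  intro α β hα κ g hg T t hT hT0 X C hX hmono hC hC2 hE hclose
  set h : Fin (m + 2) → ℝ → ℝ := fun i x => ∑ j, T i j * (g j x).re + t i with hh
  have hXne : X.Nonempty := by
    have h1 : (nonMax X).Nonempty := Finset.card_pos.1 (by omega)
    exact h1.mono (nonMax_subset X)
  obtain ⟨B, τB, S, hSC, hBE, hBk, hBτ, hSτ, hSk⟩ :=
    exists_small_values (Nat.succ_pos (m + 1)) (fun i x => |h i (nxt X x) - h i x|) hC hC2 hE
  have hSE : S ⊆ nonMax X := hSC.trans hC
  set A : ℝ := ((nonMax X).card : ℝ) with hA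
  have hA1 : 1 ≤ A := by
    rw [hA]; exact_mod_cast (by omega : 1 ≤ (nonMax X).card)
  have hSne : S.Nonempty := by
    rw [← Finset.card_pos]
    have : (0 : ℝ) < S.card := by linarith
    exact_mod_cast this
  set D₀ : ℝ → ℝ := fun x => h 0 (nxt X x) - h 0 x with hD₀
  obtain ⟨d₀, hd₀, hfib⟩ := exists_large_fiber_image hSne D₀
  set P : ℝ := ((S.image D₀).card : ℝ) with hP
  have hP0 : 0 < P := by
    rw [hP]; exact_mod_cast (hSne.image D₀).card_pos
  set Xd := S.filter fun x => D₀ x = d₀ with hXd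
  have hXdS : Xd ⊆ S := Finset.filter_subset _ _
  have hXdcard : A / (4 * P) ≤ Xd.card := by
    rw [div_le_iff₀ (by positivity)]
    linarith
  -- few distinct gap lengths of the first function, or the first function already wins
  rcases rpow_growthExponent_le_or m hA1 hP0 with hcase | hcase
  · refine ⟨0, (rich_of_distinct_gaps (m := m) (hmono 0) hXne hSE (hBE 0) (hSτ 0) (hBτ 0)).mono
      subset_rfl ?_⟩
    calc _ ≤ 1 / (8 * L) * (A * P) := by
          gcongr
          exact min_le_left _ _
      _ = A / (8 * L) * P := by ring
      _ ≤ (B 0).card * P := by gcongr; exact hBk 0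
  have hXdne : Xd.Nonempty := by
    obtain ⟨x, hx, hxd⟩ := Finset.mem_image.1 hd₀
    exact ⟨x, Finset.mem_filter.2 ⟨hx, hxd⟩⟩
  set α' := Xd.min' hXdne with hα'
  set β' := Xd.max' hXdne with hβ'
  have hXdX : Xd ⊆ X := hXdS.trans (hSE.trans (nonMax_subset X))
  have hαα : α ≤ α' := (hX (hXdX (Xd.min'_mem hXdne))).1
  have hββ : β' ≤ β := (hX (hXdX (Xd.max'_mem hXdne))).2
  have hα'0 : 0 < α' := hα.trans_le hαα
  have hXdI : (Xd : Set ℝ) ⊆ Set.Icc α' β' := fun x hx => ⟨Xd.min'_le x hx, Xd.le_max' x hx⟩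
  set d : ℝ := d₀ / T 0 0 with hd
  have hmem : ∀ x ∈ X, (x : ℂ) ∈ sector α β ρ := fun x hx => ofReal_mem_sector hα hρ0 (hX hx)
  have hh0 : ∀ x, h 0 x = T 0 0 * (g 0 x).re + t 0 := by
    intro x
    rw [hh]
    simp only
    rw [Fin.sum_univ_succ, Finset.sum_eq_zero, add_zero]
    intro i _
    rw [hT 0 i.succ (Fin.succ_pos i), zero_mul]
  have hXdd : ∀ x ∈ Xd, (g 0 (nxt X x)).re - (g 0 x).re = d := by
    intro x hx
    have h1 := (Finset.mem_filter.1 hx).2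
    simp only [hD₀, hh0] at h1
    rw [hd, eq_div_iff (hT0 0), ← h1]
    ring
  have hd0 : d ≠ 0 := by
    obtain ⟨x, hx⟩ := hXdne
    have hxE := hSE (hXdS hx)
    rw [← hXdd x hx]
    intro h0
    have h1 : h 0 (nxt X x) = h 0 x := by rw [hh0, hh0, sub_eq_zero.1 h0]
    rcases hmono 0 with hm | hm
    · exact (hm (hXdX hx) (nxt_mem hxE) (lt_nxt hxE)).ne' h1
    · exact (hm (hXdX hx) (nxt_mem hxE) (lt_nxt hxE)).ne h1
  -- the popular gap is short relative to the position
  have hdXd : ∀ x ∈ Xd, |d| ≤ ηL * (|κ 0| * x ^ q 0 * x) := by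
    intro x hx
    have hxE := hSE (hXdS hx)
    have hx0 : 0 < x := hα.trans_le (hX (hXdX hx)).1
    have hlt := lt_nxt hxE
    have hnx := hclose x (hSC (hXdS hx))
    have hsub : Set.Icc x (nxt X x) ⊆ Set.Icc α β :=
      Set.Icc_subset_Icc (hX (hXdX hx)).1 (hX (nxt_mem hxE)).2
    obtain ⟨ξ, hξ, hξe⟩ := exists_hasDerivAt_eq_slope (fun u : ℝ => (g 0 u).re)
      (fun u : ℝ => (deriv (g 0) u).re) hlt
      (fun u hu => (hasDerivAt_re (isOpen_sector _ _ _) (hg 0).diff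
        (ofReal_mem_sector hα hρ0 (hsub hu))).continuousAt.continuousWithinAt)
      (fun u hu => hasDerivAt_re (isOpen_sector _ _ _) (hg 0).diff
        (ofReal_mem_sector hα hρ0 (hsub (Set.Ioo_subset_Icc_self hu))))
    rw [hXdd x hx, eq_div_iff (by linarith)] at hξe
    have h1 := ((hg 0).rel ξ (ofReal_mem_sector hα hρ0 (hsub (Set.Ioo_subset_Icc_self hξ)))).mono
      (min_le_left _ _) |>.norm_le
    have h2 : RelClose 1 ((ξ : ℂ) ^ q 0) ((x : ℂ) ^ q 0) := by
      refine Hs₁ ξ x (by exact_mod_cast hx0.ne') ?_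
      unfold RelClose
      rw [← Complex.ofReal_sub, Complex.norm_real, Complex.norm_real, Real.norm_eq_abs,
        abs_of_pos (sub_pos.2 hξ.1), Real.norm_of_nonneg hx0.le]
      have : η * x ≤ s₁ * x := by gcongr
      linarith [hξ.2]
    have h3 := h2.norm_le
    rw [norm_zpow (x : ℂ), Complex.norm_real, Real.norm_of_nonneg hx0.le] at h3
    rw [norm_mul, Complex.norm_real, Real.norm_eq_abs] at h1
    have h4 : |(deriv (g 0) ξ).re| ≤ 4 * (|κ 0| * x ^ q 0) :=
      calc |(deriv (g 0) ξ).re| ≤ ‖deriv (g 0) ξ‖ := Complex.abs_re_le_norm _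
        _ ≤ (1 + 1) * (|κ 0| * ‖(ξ : ℂ) ^ q 0‖) := h1
        _ ≤ (1 + 1) * (|κ 0| * ((1 + 1) * x ^ q 0)) := by gcongr
        _ = 4 * (|κ 0| * x ^ q 0) := by ring
    have h5 : 0 ≤ |κ 0| * x ^ q 0 := mul_nonneg (abs_nonneg _) (zpow_nonneg hx0.le _)
    calc |d| = |(deriv (g 0) ξ).re| * (nxt X x - x) := by
          rw [← hξe, abs_mul, abs_of_pos (sub_pos.2 hlt)]
      _ ≤ 4 * (|κ 0| * x ^ q 0) * (ηL / 4 * x) := by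
          gcongr
          have : η * x ≤ ηL / 4 * x := by gcongr
          linarith
      _ = ηL * (|κ 0| * x ^ q 0 * x) := by ring
  have hdI : ∀ x ∈ Set.Icc α' β', |d| ≤ ηL * (|κ 0| * x ^ q 0 * x) := by
    intro x hx
    have hx0 : 0 < x := hα'0.trans_le hx.1
    have h1 := min_zpow_le (a := q 0 + 1) hα'0 hx
    have hform : ∀ u : ℝ, 0 < u → ηL * (|κ 0| * u ^ q 0 * u) = ηL * |κ 0| * u ^ (q 0 + 1) :=
      fun u hu => by rw [zpow_add_one₀ hu.ne']; ring
    have h2 := hdXd α' (Xd.min'_mem hXdne)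
    have h3 := hdXd β' (Xd.max'_mem hXdne)
    rw [hform _ hα'0] at h2
    rw [hform _ (hx0.trans_le hx.2)] at h3
    rw [hform _ hx0]
    rcases min_le_iff.1 h1 with h4 | h4
    · exact h2.trans (by gcongr)
    · exact h3.trans (by gcongr)
  obtain ⟨y, hys, hyd, hy⟩ := HL α β α' β' (κ 0) d (g 0) hα hαα hββ
    ((hg 0).mono subset_rfl ((min_le_right _ _).trans (min_le_left _ _))) hdI
  have hynxt : ∀ x ∈ Xd, y x = (nxt X x : ℝ) := by
    intro x hx
    have hxE := hSE (hXdS hx)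
    have hx0 : 0 < x := hα.trans_le (hX (hXdX hx)).1
    symm
    refine (hy x (ofReal_mem_sector hα'0 hρ'0 (hXdI hx))).2.2 _ ?_ ?_
    · rw [← Complex.ofReal_sub, Complex.norm_real, Complex.norm_real, Real.norm_eq_abs,
        abs_of_pos (sub_pos.2 (lt_nxt hxE)), Real.norm_of_nonneg hx0.le]
      have h1 := hclose x (hSC (hXdS hx))
      have : η * x ≤ s * x := by gcongr
      linarith
    · rw [← (hg 0).symm.ofReal_re (hmem _ (nxt_mem hxE)),
        ← (hg 0).symm.ofReal_re (hmem _ (hXdX hx)), ← hXdd x hx]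
      push_cast
      ring
  -- apply the induction hypothesis to the increments of the remaining functions
  have hinc : ∀ i : Fin (m + 1), PowerPrimitive (sector α' β' ρ') (q i.succ - q 0 - 1)
      (d * (κ i.succ / κ 0 * ((q i.succ - q 0 : ℤ) : ℝ))) ε'
      (fun z => g i.succ (y z) - g i.succ z) := by
    intro i
    have h1 : min 1 (min εL ε₂) ≤ eI i :=
      ((min_le_right _ _).trans (min_le_right _ _)).trans (hε₂e i)
    refine HI i α β α' β' ρ' (κ 0) (κ i.succ) d (g 0) (g i.succ) y hα hαα hββ hρ'ρ hd0
      ((hg 0).mono subset_rfl h1) ((hg i.succ).mono subset_rfl h1) hys hyd fun z hz => ?_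
    have h2 := hy z hz
    exact ⟨h2.1.trans (by gcongr; exact hττ i), h2.2.1⟩
  obtain ⟨i, hi⟩ := IH α' β' hα'0 _ _ hinc (fun i j => T i.succ j.succ) (fun i => T i.succ 0 * d)
    (fun i j hij => hT _ _ (Fin.succ_lt_succ_iff.2 hij)) (fun i => hT0 _) Xd hXdne hXdI
  have hi' : Rich m (fun x => h i.succ (nxt X x) - h i.succ x) Xd
      (c' * (Xd.card : ℝ) ^ φ') := by
    refine hi.congr fun x hx => ?_
    have h1 : h i.succ (nxt X x) - h i.succ x = T i.succ 0 * d +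
        ∑ j : Fin (m + 1), T i.succ j.succ * ((g j.succ (nxt X x)).re - (g j.succ x).re) := by
      rw [← hXdd x hx, ← Fin.sum_univ_succ fun j => T i.succ j * ((g j (nxt X x)).re - (g j x).re)]
      simp only [hh, mul_sub, Finset.sum_sub_distrib]
      ring
    rw [h1, add_comm]
    congr 1
    refine Finset.sum_congr rfl fun j _ => ?_
    rw [hynxt x hx, Complex.sub_re]
  refine ⟨i.succ, (Rich.squeeze (hmono i.succ) (hXdS.trans hSE) (hBE i.succ)
    (fun x hx => hSτ i.succ x (hXdS hx)) (hBτ i.succ) hi').mono subset_rfl ?_⟩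
  calc _ ≤ c' / (8 * L * 4 ^ φ') * (A * (A / P) ^ φ') := by
        gcongr
        exact min_le_right _ _
    _ = A / (8 * L) * (c' * (A / (4 * P)) ^ φ') := mul_div_rpow_eq (by linarith) hP0 hL0 c' φ'
    _ ≤ (B i.succ).card * (c' * (Xd.card : ℝ) ^ φ') := by
        have h1 : 0 ≤ A / (4 * P) := div_nonneg (by linarith) (by linarith)
        exact mul_le_mul (hBk i.succ) (mul_le_mul_of_nonneg_left
          (Real.rpow_le_rpow h1 hXdcard hφ'0.le) hc'.le)
          (mul_nonneg hc'.le (Real.rpow_nonneg h1 _)) (Nat.cast_nonneg _)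

/-- Growth for a lower triangular tuple of combinations of power-like primitives with distinct
exponents: one of the combinations is rich on every finite subset of the domain, with constants
that depend only on the exponents. -/
theorem exists_rich_of_powerPrimitive (m : ℕ) : ∀ q : Fin (m + 1) → ℤ, Function.Injective q →
    q 0 ≠ -1 → ∀ ρ : ℝ, 0 < ρ → ρ ≤ 1 →
    ∃ ε > 0, ∃ c > 0, ∀ α β : ℝ, 0 < α → ∀ (κ : Fin (m + 1) → ℝ) (g : Fin (m + 1) → ℂ → ℂ),
    (∀ i, PowerPrimitive (sector α β ρ) (q i) (κ i) ε (g i)) →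
    ∀ (T : Fin (m + 1) → Fin (m + 1) → ℝ) (t : Fin (m + 1) → ℝ), (∀ i j, i < j → T i j = 0) →
    (∀ i, T i i ≠ 0) → ∀ X : Finset ℝ, X.Nonempty → (X : Set ℝ) ⊆ Set.Icc α β →
    ∃ i, Rich m (fun x => ∑ j, T i j * (g j x).re + t i) X
      (c * (X.card : ℝ) ^ growthExponent (m + 1)) := by
  classical
  induction m with
  | zero =>
    intro q hq _ ρ hρ0 hρ
    obtain ⟨ε, hε, Z⟩ := exists_no_zeros_combination 0 q hq hρ0 hρ
    refine ⟨ε, hε, 1, one_pos, fun α β hα κ g hg T t _ hT0 X hX hXI => ⟨0, ?_⟩⟩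
    obtain ⟨X', hX', hcard, hmono⟩ := exists_strictMonoOn_subset (k := 0)
      (fun x hx => hasDerivAt_combination hα hρ0 (fun i => (hg i).diff) (T 0) (t 0) hx)
      (fun z hz hzI => Z α β hα κ _ (fun i => (hg i).powerLike) (T 0)
        (fun h => hT0 0 (congrFun h 0)) z hz hzI) hXI
    have hinj : Set.InjOn (fun x : ℝ => ∑ j, T 0 j * (g j x).re + t 0) X' :=
      hmono.elim (fun h => h.injOn) fun h => h.injOn
    refine rich_zero.mono hX' ?_
    rw [Finset.card_image_of_injOn hinj]
    have h1 : growthExponent (0 + 1) = 1 := by simp [growthExponent]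
    rw [h1, Real.rpow_one, one_mul]
    simpa using hcard
  | succ m ih =>
    intro q hq hq0 ρ hρ0 hρ
    obtain ⟨ε₀, hε₀, Z⟩ := exists_no_zeros_combination (m + 1) q hq hρ0 hρ
    obtain ⟨ε₁, hε₁, η, hη, c₁, hc₁, D⟩ := exists_rich_of_close_gaps hq hρ0 hρ ih
    obtain ⟨s, hs, LAC⟩ := exists_lacunary_subset hη
    set K : ℝ := ((m + 1 + 1 : ℕ) : ℝ) ^ (Finset.univ : Finset (Fin (m + 2))).card with hK
    have hK0 : 0 < K := by positivity
    set M : ℕ := 8 * s + 4 * (m + 2) + 1 with hM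
    have hs0 : (0 : ℝ) < s := by exact_mod_cast hs
    have hM0 : (0 : ℝ) < M := by rw [hM]; positivity
    set φ := growthExponent (m + 2) with hφ
    have hφ1 : 1 ≤ φ := one_le_growthExponent _
    have hφ0 : 0 ≤ φ := by linarith
    set c := min (1 / (K * M) ^ φ) (min (c₁ / (2 * K) ^ φ) (1 / (512 * K ^ 2 * s ^ 2))) with hc
    have hc0 : 0 < c := by positivity
    refine ⟨min (1 / 4) (min ε₀ ε₁), by positivity, c, hc0, ?_⟩
    intro α β hα κ g hg T t hT hT0 X hX hXI
    have hN0 : (0 : ℝ) < X.card := by exact_mod_cast hX.card_pos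
    -- for small sets the bound is at most one
    by_cases hsmall : (X.card : ℝ) ≤ K * M
    · refine ⟨0, rich_one_of_nonempty _ hX ?_⟩
      calc c * (X.card : ℝ) ^ φ ≤ 1 / (K * M) ^ φ * (K * M) ^ φ := by
            gcongr
            exact min_le_left _ _
        _ = 1 := by
            have : (0 : ℝ) < (K * M) ^ φ := by positivity
            field_simp
    push Not at hsmall
    obtain ⟨X₁, hX₁, hcard, hmono⟩ := exists_common_strictMonoOn_subset (k := m + 1)
      (h := fun i x => ∑ j, T i j * (g j x).re + t i)
      (F := fun i x => ∑ j, T i j * (deriv (g j) x).re)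
      (fun i x hx => hasDerivAt_combination hα hρ0 (fun i => (hg i).diff) (T i) (t i) hx)
      (fun i z hz hzI => Z α β hα κ _ (fun i => (hg i).powerLike.mono subset_rfl
        ((min_le_right _ _).trans (min_le_left _ _))) (T i)
        (fun h => hT0 i (congrFun h i)) z hz hzI) hXI Finset.univ
    change (X.card : ℝ) ≤ K * X₁.card at hcard
    have hX₁I : (X₁ : Set ℝ) ⊆ Set.Icc α β := subset_trans (by exact_mod_cast hX₁) hXI
    have hX₁M : M < X₁.card := by
      have : (M : ℝ) < X₁.card := by
        by_contra hcon
        push Not at hcon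
        have : K * X₁.card ≤ K * M := by gcongr
        linarith
      exact_mod_cast this
    have hE := card_le_card_nonMax X₁
    set E := nonMax X₁ with hEdef
    have hE2 : (X.card : ℝ) / (2 * K) ≤ E.card := by
      have h1 : (X₁.card : ℝ) ≤ 2 * E.card := by exact_mod_cast (by omega)
      rw [div_le_iff₀ (by positivity)]
      calc (X.card : ℝ) ≤ K * X₁.card := hcard
        _ ≤ K * (2 * E.card) := by gcongr
        _ = _ := by ring
    have hsplit := Finset.card_filter_add_card_filter_not (s := E)
      (fun x => nxt X₁ x ≤ (1 + η) * x)
    rcases le_total E.card (2 * (E.filter fun x => nxt X₁ x ≤ (1 + η) * x).card) with h | h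
    · obtain ⟨i, hi⟩ := D α β hα κ g (fun i => (hg i).mono subset_rfl
        ((min_le_right _ _).trans (min_le_right _ _))) T t hT hT0 X₁ _ hX₁I
        (fun i => hmono i (Finset.mem_univ i)) (Finset.filter_subset _ E)
        (by exact_mod_cast h) (by change _ ≤ E.card; omega) (fun x hx => (Finset.mem_filter.1 hx).2)
      refine ⟨i, hi.mono hX₁ ?_⟩
      calc c * (X.card : ℝ) ^ φ ≤ c₁ / (2 * K) ^ φ * (X.card : ℝ) ^ φ := by
            gcongr
            exact (min_le_right _ _).trans (min_le_left _ _)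
        _ = c₁ * ((X.card : ℝ) / (2 * K)) ^ φ := by
            rw [Real.div_rpow (by positivity) (by positivity)]
            ring
        _ ≤ _ := by gcongr
    · obtain ⟨E', hE'F, hE'c, hlac⟩ := LAC (E.filter fun x => ¬ nxt X₁ x ≤ (1 + η) * x)
        (fun x hx => hα.trans_le
          (hX₁I (nonMax_subset _ (Finset.filter_subset _ E hx))).1)
        (fun x hx x' hx' hlt => (not_le.1 (Finset.mem_filter.1 hx).2).trans_le
          (nxt_le (nonMax_subset _ (Finset.filter_subset _ E hx')) hlt))
      have hE'X₁ : E' ⊆ X₁ := hE'F.trans ((Finset.filter_subset _ E).trans (nonMax_subset _))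
      have h1 : (E.card : ℝ) ≤ 2 * s * E'.card := by
        have h2 : E.card ≤ 2 * (E.filter fun x => ¬ nxt X₁ x ≤ (1 + η) * x).card := by omega
        have h2' : (E.card : ℝ) ≤ 2 * (E.filter fun x => ¬ nxt X₁ x ≤ (1 + η) * x).card := by
          exact_mod_cast h2
        linarith
      have h4 : 4 ≤ E'.card := by
        have h2 : E.card ≤ 2 * s * E'.card := by exact_mod_cast h1
        have h3 : 2 * s * 4 ≤ 2 * s * E'.card := by omega
        exact Nat.le_of_mul_le_mul_left h3 (by omega)
      have hE'coe : (E' : Set ℝ) ⊆ X₁ := by exact_mod_cast hE'X₁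
      refine ⟨0, (rich_of_lacunary m hα hρ0 hq0 (min_le_left _ _) (hg 0) (hT0 0)
        (hE'coe.trans hX₁I) ((hmono 0 (Finset.mem_univ 0)).imp (fun h => h.mono hE'coe)
          fun h => h.mono hE'coe) (b := t 0) (fun x _ => ?_) hlac h4).mono
        (hE'X₁.trans hX₁) ?_⟩
      · rw [Fin.sum_univ_succ, Finset.sum_eq_zero, add_zero]
        intro i _
        rw [hT 0 i.succ (Fin.succ_pos i), zero_mul]
      · have hN1 : (1 : ℝ) ≤ X.card := by exact_mod_cast hX.card_pos
        have h5 : (X.card : ℝ) ≤ 4 * K * s * E'.card := by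
          rw [div_le_iff₀ (by positivity)] at hE2
          calc (X.card : ℝ) ≤ E.card * (2 * K) := hE2
            _ ≤ 2 * s * E'.card * (2 * K) := by gcongr
            _ = _ := by ring
        calc c * (X.card : ℝ) ^ φ ≤ 1 / (512 * K ^ 2 * s ^ 2) * (X.card : ℝ) ^ (2 : ℝ) := by
              gcongr
              · exact (min_le_right _ _).trans (min_le_right _ _)
              · exact growthExponent_le_two _
          _ = 1 / (512 * K ^ 2 * s ^ 2) * (X.card : ℝ) ^ 2 := by rw [Real.rpow_two]
          _ ≤ 1 / (512 * K ^ 2 * s ^ 2) * (4 * K * s * E'.card) ^ 2 := by gcongr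
          _ = (E'.card : ℝ) ^ 2 / 32 := by field_simp; norm_num

/-! ### Annihilating moments -/

/-- The powers of `t` numbers in `[-1, 1]` satisfy a common linear recurrence of order `t` with
bounded coefficients, namely those of the monic polynomial with these roots. -/
theorem exists_power_recurrence {t : ℕ} {x : Fin t → ℝ} (hx : ∀ j, |x j| ≤ 1) :
    ∃ e : ℕ → ℝ, (∀ i, |e i| ≤ t.choose i) ∧
      ∀ j, x j ^ t = -∑ i ∈ Finset.range t, e i * x j ^ i := by
  obtain ⟨p, hp⟩ : ∃ p : Polynomial ℝ, p = ∏ j, (Polynomial.X - Polynomial.C (x j)) := ⟨_, rfl⟩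
  have hmonic : p.Monic := hp ▸ Polynomial.monic_prod_X_sub_C x Finset.univ
  have hdeg : p.natDegree = t := by
    rw [hp, Polynomial.natDegree_finsetProd_X_sub_C_eq_card]; simp
  have hroots : p.roots = Finset.univ.val.map x := by
    rw [hp]
    exact Polynomial.roots_multiset_prod_X_sub_C (Finset.univ.val.map x) ▸ by
      rw [Multiset.map_map]; rfl
  have hsplit : p.Splits := by
    rw [Polynomial.splits_iff_card_roots, hroots, hdeg]; simp
  refine ⟨p.coeff, fun i => ?_, fun j => ?_⟩
  · have := Polynomial.coeff_le_of_roots_le (f := RingHom.id ℝ) (B := 1) i hmonic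
      (by rwa [Polynomial.map_id]) (fun z hz => by
        rw [Polynomial.map_id, hroots, Multiset.mem_map] at hz
        obtain ⟨j, -, rfl⟩ := hz
        exact hx j)
    rw [Polynomial.map_id, hdeg, one_pow, one_mul] at this
    exact this
  · have h0 : p.eval (x j) = 0 := by
      rw [hp, Polynomial.eval_prod]
      exact Finset.prod_eq_zero (Finset.mem_univ j) (by simp)
    rw [Polynomial.eval_eq_sum_range, hdeg, Finset.sum_range_succ] at h0
    have h1 : p.coeff t = 1 := by rw [← hdeg]; exact hmonic
    rw [h1, one_mul] at h0
    linarith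

/-- Moments of a measure supported on `t` points of `[-1, 1]` grow at most geometrically in terms
of the first `t` moments. -/
theorem abs_moment_le {t : ℕ} {x d : Fin t → ℝ} (hx : ∀ j, |x j| ≤ 1) {N : ℝ} (hN0 : 0 ≤ N)
    (hN : ∀ i < t, |∑ j, d j * x j ^ i| ≤ N) (m : ℕ) :
    |∑ j, d j * x j ^ m| ≤ (2 ^ t) ^ m * N := by
  obtain ⟨e', hcoeff, hrec⟩ := exists_power_recurrence hx
  induction m using Nat.strong_induction_on with
  | _ m ih =>
    rcases lt_or_ge m t with hm | hm
    · refine (hN m hm).trans (le_mul_of_one_le_left hN0 ?_)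
      exact one_le_pow₀ (one_le_pow₀ (by norm_num))
    rcases Nat.eq_zero_or_pos m with rfl | hm0
    · obtain rfl : t = 0 := by omega
      simpa using hN0
    obtain ⟨e, rfl⟩ := Nat.exists_eq_add_of_le hm
    have h1 : ∑ j, d j * x j ^ (t + e) =
        -∑ i ∈ Finset.range t, e' i * ∑ j, d j * x j ^ (i + e) := by
      simp only [Finset.mul_sum]
      rw [Finset.sum_comm, ← Finset.sum_neg_distrib]
      refine Finset.sum_congr rfl fun j _ => ?_
      rw [pow_add, hrec j, neg_mul, mul_neg, Finset.sum_mul, Finset.mul_sum]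
      congr 1
      refine Finset.sum_congr rfl fun i _ => ?_
      rw [pow_add]
      ring
    have h2 : (1 : ℝ) ≤ 2 ^ t := one_le_pow₀ (by norm_num)
    have h3 : ∑ i ∈ Finset.range t, (t.choose i : ℝ) ≤ 2 ^ t := by
      have h4 : ∑ i ∈ Finset.range t, t.choose i ≤ 2 ^ t := by
        rw [← Nat.sum_range_choose, Finset.sum_range_succ]
        omega
      exact_mod_cast h4
    rw [h1, abs_neg]
    calc |∑ i ∈ Finset.range t, e' i * ∑ j, d j * x j ^ (i + e)|
        ≤ ∑ i ∈ Finset.range t, |e' i * ∑ j, d j * x j ^ (i + e)| :=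
          Finset.abs_sum_le_sum_abs _ _
      _ ≤ ∑ i ∈ Finset.range t, (t.choose i : ℝ) * ((2 ^ t) ^ (t + e - 1) * N) := by
          refine Finset.sum_le_sum fun i hi => ?_
          have hi' := Finset.mem_range.1 hi
          rw [abs_mul]
          have h5 := ih (i + e) (by omega)
          have h6 : ((2 : ℝ) ^ t) ^ (i + e) ≤ (2 ^ t) ^ (t + e - 1) :=
            pow_le_pow_right₀ h2 (by omega)
          have h7 := hcoeff i
          gcongr
          exact h5.trans (by gcongr)
      _ = (∑ i ∈ Finset.range t, (t.choose i : ℝ)) * ((2 ^ t) ^ (t + e - 1) * N) := by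
          rw [Finset.sum_mul]
      _ ≤ 2 ^ t * ((2 ^ t) ^ (t + e - 1) * N) := by gcongr
      _ = (2 ^ t) ^ (t + e) * N := by
          rw [← mul_assoc, ← pow_succ', Nat.sub_add_cancel hm0]

/-- The linear recurrence with coefficients `-b` has a basis of solutions dual to the initial values,
all of which grow at most geometrically. -/
theorem exists_fundamental_solutions {s : ℕ} (b : Fin s → ℝ) :
    ∃ (S : Fin s → ℕ → ℝ) (B : ℝ), 1 ≤ B ∧ (∀ k : Fin s, ∀ i < s, S k i = if i = k then 1 else 0) ∧
      (∀ k m, S k (m + s) = -∑ i : Fin s, b i * S k (m + i)) ∧ ∀ k m, |S k m| ≤ B ^ m := by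
  classical
  set R : LinearRecurrence ℝ := ⟨s, fun i => -b i⟩ with hR
  set S : Fin s → ℕ → ℝ := fun k => R.mkSol (Pi.single k 1) with hS
  set B : ℝ := 1 + ∑ i, |b i| with hB
  have hb : 0 ≤ ∑ i, |b i| := Finset.sum_nonneg fun i _ => abs_nonneg _
  have hB1 : 1 ≤ B := by linarith
  have hinit : ∀ k : Fin s, ∀ i < s, S k i = if i = k then 1 else 0 := by
    intro k i hi
    have := R.mkSol_eq_init (Pi.single k 1) ⟨i, hi⟩
    rw [hS]
    simp only
    rw [this, Pi.single_apply]
    simp [Fin.ext_iff]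
  have hrec : ∀ k m, S k (m + s) = -∑ i : Fin s, b i * S k (m + i) := by
    intro k m
    have := R.is_sol_mkSol (Pi.single k 1) m
    rw [← Finset.sum_neg_distrib]
    simp only [← neg_mul]
    exact this
  refine ⟨S, B, hB1, hinit, hrec, fun k m => ?_⟩
  induction m using Nat.strong_induction_on with
  | _ m ih =>
    rcases lt_or_ge m s with hm | hm
    · rw [hinit k m hm]
      have : (1 : ℝ) ≤ B ^ m := one_le_pow₀ hB1
      split_ifs
      · simpa using this
      · simpa using zero_le_one.trans this
    · obtain ⟨e, rfl⟩ := Nat.exists_eq_add_of_le' hm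
      have hs : 0 < s := k.pos
      rw [hrec, abs_neg]
      calc |∑ i : Fin s, b i * S k (e + i)| ≤ ∑ i : Fin s, |b i * S k (e + i)| :=
            Finset.abs_sum_le_sum_abs _ _
        _ ≤ ∑ i : Fin s, |b i| * B ^ (e + s - 1) := by
            refine Finset.sum_le_sum fun i _ => ?_
            rw [abs_mul]
            have h1 := ih (e + i) (by omega)
            have h2 : B ^ (e + i : ℕ) ≤ B ^ (e + s - 1) := pow_le_pow_right₀ hB1 (by omega)
            gcongr
            exact h1.trans h2
        _ = (∑ i, |b i|) * B ^ (e + s - 1) := by rw [Finset.sum_mul]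
        _ ≤ B * B ^ (e + s - 1) := by gcongr; linarith
        _ = B ^ (e + s) := by rw [← pow_succ', Nat.sub_add_cancel (by omega)]

/-- A vanishing condition involving the fundamental solution with index `k` makes the `k`-th
moment small compared with the others. -/
theorem abs_moment_le_half {s k : ℕ} (hk : k < s) {S : ℕ → ℝ} {A B Δ N : ℝ} {μ : ℕ → ℝ}
    (hS : ∀ i < s, S i = if i = k then 1 else 0) (hSB : ∀ m, |S m| ≤ B ^ m) (hB : 1 ≤ B)
    (hA : 1 ≤ A) (hΔ0 : 0 < Δ) (hΔ : A * B * Δ ≤ 1 / 2)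
    (hΔ' : 4 * (s.factorial : ℝ) * (A * B) ^ s * Δ ≤ 1) (hN0 : 0 ≤ N)
    (hμ : ∀ m, |μ m| ≤ A ^ m * N * Δ ^ (m + 1))
    (hsum : HasSum (fun m => μ m * S m / ((m + 1).factorial : ℝ)) 0) :
    |μ k| ≤ N / 2 * Δ ^ (k + 1) := by
  have hAB : 1 ≤ A * B := by nlinarith
  have hΔ1 : Δ ≤ 1 := by nlinarith
  have h1 := (hasSum_nat_add_iff' s).2 hsum
  have h2 : ∑ i ∈ Finset.range s, μ i * S i / ((i + 1).factorial : ℝ) =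
      μ k / ((k + 1).factorial : ℝ) := by
    rw [Finset.sum_eq_single_of_mem k (Finset.mem_range.2 hk)]
    · rw [hS k hk, if_pos rfl, mul_one]
    · intro i hi hik
      rw [hS i (Finset.mem_range.1 hi), if_neg hik]
      simp
  rw [h2, zero_sub] at h1
  have h3 : HasSum (fun i : ℕ => N * Δ * (A * B * Δ) ^ s * (1 / 2) ^ i)
      (N * Δ * (A * B * Δ) ^ s * 2) := hasSum_geometric_two.mul_left _
  have h4 := h1.norm_le_of_bounded h3 fun i => by
    have hf : (1 : ℝ) ≤ ((i + s + 1).factorial : ℝ) := by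
      exact_mod_cast Nat.one_le_iff_ne_zero.2 (Nat.factorial_ne_zero _)
    rw [Real.norm_eq_abs, abs_div, abs_mul,
      abs_of_nonneg (by linarith : (0 : ℝ) ≤ ((i + s + 1).factorial : ℝ))]
    calc |μ (i + s)| * |S (i + s)| / ((i + s + 1).factorial : ℝ)
        ≤ |μ (i + s)| * |S (i + s)| := div_le_self (by positivity) hf
      _ ≤ A ^ (i + s) * N * Δ ^ (i + s + 1) * B ^ (i + s) := by
          gcongr
          · exact hμ _
          · exact hSB _
      _ = N * Δ * (A * B * Δ) ^ s * (A * B * Δ) ^ i := by ring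
      _ ≤ _ := by gcongr
  have hf : (0 : ℝ) < ((k + 1).factorial : ℝ) := by exact_mod_cast Nat.factorial_pos _
  have hfs : ((k + 1).factorial : ℝ) ≤ (s.factorial : ℝ) := by
    exact_mod_cast Nat.factorial_le hk
  rw [norm_neg, Real.norm_eq_abs, abs_div, abs_of_pos hf, div_le_iff₀ hf] at h4
  have h5 : Δ ^ s ≤ Δ ^ (k + 1) := pow_le_pow_of_le_one hΔ0.le hΔ1 hk
  calc |μ k| ≤ N * Δ * (A * B * Δ) ^ s * 2 * ((k + 1).factorial : ℝ) := h4
    _ = N * Δ * (A * B) ^ s * 2 * Δ ^ s * ((k + 1).factorial : ℝ) := by rw [mul_pow]; ring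
    _ ≤ N * Δ * (A * B) ^ s * 2 * Δ ^ (k + 1) * (s.factorial : ℝ) := by gcongr
    _ = N / 2 * Δ ^ (k + 1) * (4 * (s.factorial : ℝ) * (A * B) ^ s * Δ) := by ring
    _ ≤ N / 2 * Δ ^ (k + 1) := mul_le_of_le_one_right (by positivity) hΔ'

theorem eq_zero_of_moment_eq_zero {t : ℕ} {δ c : Fin t → ℝ} (hδ : Function.Injective δ)
    (hδ0 : ∀ j, 0 < δ j) (h : ∀ i : Fin t, ∑ j, c j * δ j ^ ((i : ℕ) + 1) = 0) : c = 0 := by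
  have h1 : (fun j => c j * δ j) = 0 := Matrix.eq_zero_of_forall_pow_sum_mul_pow_eq_zero hδ
    fun i => by
      rw [← h i]
      exact Finset.sum_congr rfl fun j _ => by rw [pow_succ']; ring
  funext j
  exact (mul_eq_zero.1 (congrFun h1 j)).resolve_right (hδ0 j).ne'

/-- If `t` coefficients `c` at points `δ ∈ (0, Δ]` satisfy the vanishing conditions for all
fundamental solutions, then the (normalized) moments of index less than `t` are dominated by one
of index at least `s`. -/
theorem exists_dominant_moment {s t : ℕ} (ht : t ≤ s + 1) {S : Fin s → ℕ → ℝ} {B Δ : ℝ}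
    (hB : 1 ≤ B) (hS : ∀ k : Fin s, ∀ i < s, S k i = if i = k then 1 else 0)
    (hSB : ∀ k m, |S k m| ≤ B ^ m) (hΔ0 : 0 < Δ) (hΔ : 2 ^ (s + 1) * B * Δ ≤ 1 / 2)
    (hΔ' : 4 * (s.factorial : ℝ) * (2 ^ (s + 1) * B) ^ s * Δ ≤ 1) {δ c : Fin t → ℝ}
    (hδ : Function.Injective δ) (hδ0 : ∀ j, 0 < δ j) (hδΔ : ∀ j, δ j ≤ Δ) (hc : c ≠ 0)
    (hsum : ∀ k, HasSum (fun m => (∑ j, c j * δ j ^ (m + 1)) * S k m /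
      ((m + 1).factorial : ℝ)) 0) :
    ∃ i < t, s ≤ i ∧ ∑ j, c j * δ j ^ (i + 1) ≠ 0 ∧ ∀ m,
      |∑ j, c j * δ j ^ (m + 1)| ≤
        (2 ^ (s + 1)) ^ m * (|∑ j, c j * δ j ^ (i + 1)| / Δ ^ (i + 1)) * Δ ^ (m + 1) := by
  have ht0 : Nonempty (Fin t) := by
    by_contra h
    rw [not_nonempty_iff] at h
    exact hc (Subsingleton.elim _ _)
  set μ : ℕ → ℝ := fun m => ∑ j, c j * δ j ^ (m + 1) with hμ
  obtain ⟨i, hi⟩ := Finite.exists_max fun i : Fin t => |μ i| / Δ ^ ((i : ℕ) + 1)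
  set N := |μ i| / Δ ^ ((i : ℕ) + 1) with hN
  have hN0 : 0 ≤ N := by positivity
  have hscale : ∀ m, |∑ j, c j * (δ j / Δ) * (δ j / Δ) ^ m| = |μ m| / Δ ^ (m + 1) := by
    intro m
    rw [hμ]
    simp only
    rw [← abs_of_pos (pow_pos hΔ0 (m + 1)), ← abs_div, Finset.sum_div]
    congr 1
    refine Finset.sum_congr rfl fun j _ => ?_
    rw [mul_assoc, ← pow_succ', div_pow, mul_div_assoc]
  have hbound : ∀ m, |μ m| ≤ (2 ^ (s + 1)) ^ m * N * Δ ^ (m + 1) := by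
    intro m
    have h1 := abs_moment_le (x := fun j => δ j / Δ) (d := fun j => c j * (δ j / Δ))
      (fun j => by
        rw [abs_of_pos (div_pos (hδ0 j) hΔ0), div_le_one hΔ0]
        exact hδΔ j) hN0
      (fun l hl => by rw [hscale]; exact hi ⟨l, hl⟩) m
    rw [hscale, div_le_iff₀ (by positivity)] at h1
    refine h1.trans ?_
    gcongr
    norm_num
  have hNpos : 0 < N := by
    refine hN0.lt_of_ne fun h => hc (eq_zero_of_moment_eq_zero hδ hδ0 fun l => ?_)
    have h1 := hi l
    rw [← h, div_le_iff₀ (by positivity), zero_mul] at h1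
    exact abs_nonpos_iff.1 h1
  have hμi : |μ i| = N * Δ ^ ((i : ℕ) + 1) := by
    rw [hN, div_mul_cancel₀]
    positivity
  refine ⟨i, i.2, ?_, ?_, hbound⟩
  · by_contra hlt
    push Not at hlt
    have h1 := abs_moment_le_half hlt (hS ⟨i, hlt⟩) (hSB ⟨i, hlt⟩) hB
      (one_le_pow₀ (by norm_num)) hΔ0 hΔ hΔ' hN0 hbound (hsum ⟨i, hlt⟩)
    rw [hμi] at h1
    have : 0 < Δ ^ ((i : ℕ) + 1) := by positivity
    nlinarith
  · intro h0
    have h1 : |μ i| = 0 := by rw [hμ]; simp only; rw [h0, abs_zero]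
    rw [hμi] at h1
    have : 0 < N * Δ ^ ((i : ℕ) + 1) := by positivity
    linarith

theorem summable_fundamental {S : ℕ → ℝ} {B : ℝ} (hSB : ∀ m, |S m| ≤ B ^ m) (x : ℝ) :
    Summable fun m => x ^ (m + 1) * S m / ((m + 1).factorial : ℝ) := by
  refine Summable.of_norm_bounded ((Real.summable_pow_div_factorial (|x| * B)).mul_left |x|)
    fun m => ?_
  have hf : (0 : ℝ) < (m.factorial : ℝ) := by exact_mod_cast Nat.factorial_pos _
  have hf' : (m.factorial : ℝ) ≤ ((m + 1).factorial : ℝ) := by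
    exact_mod_cast Nat.factorial_le (Nat.le_succ m)
  rw [Real.norm_eq_abs, abs_div, abs_mul, abs_pow, abs_of_pos (hf.trans_le hf')]
  calc |x| ^ (m + 1) * |S m| / ((m + 1).factorial : ℝ)
      ≤ |x| ^ (m + 1) * B ^ m / (m.factorial : ℝ) := by
        have h1 : 0 ≤ B ^ m := (abs_nonneg _).trans (hSB m)
        gcongr
        exact hSB m
    _ = |x| * ((|x| * B) ^ m / (m.factorial : ℝ)) := by rw [mul_pow]; ring

/-- There is a unitriangular choice of coefficients for which the lower moments are annihilated
by the fundamental solutions and the moment of index `s` dominates the higher ones. -/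
theorem exists_annihilating_coeff {s : ℕ} {S : Fin s → ℕ → ℝ} {B : ℝ} (hB : 1 ≤ B)
    (hS : ∀ k : Fin s, ∀ i < s, S k i = if i = k then 1 else 0)
    (hSB : ∀ k m, |S k m| ≤ B ^ m) :
    ∃ r > 0, ∀ (Δ : ℝ) (δ : Fin (s + 1) → ℝ), Δ ≤ r → Function.Injective δ → (∀ j, 0 < δ j) →
      (∀ j, δ j ≤ Δ) → ∃ c : Fin (s + 1) → ℝ, c (Fin.last s) = 1 ∧
        ∑ j, c j * δ j ^ (s + 1) ≠ 0 ∧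
        (∀ l, |∑ j, c j * δ j ^ (s + l + 1)| ≤
          |∑ j, c j * δ j ^ (s + 1)| * (2 ^ (s + 1)) ^ s * (2 ^ (s + 1) * Δ) ^ l) ∧
        ∀ k, HasSum (fun m => (∑ j, c j * δ j ^ (m + 1)) * S k m /
          ((m + 1).factorial : ℝ)) 0 := by
  have hf : (0 : ℝ) < (s.factorial : ℝ) := by exact_mod_cast Nat.factorial_pos _
  refine ⟨min (1 / (2 * (2 ^ (s + 1) * B))) (1 / (4 * (s.factorial : ℝ) * (2 ^ (s + 1) * B) ^ s)),
    by positivity, ?_⟩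
  intro Δ δ hΔr hδ hδ0 hδΔ
  have hΔ0 : 0 < Δ := (hδ0 0).trans_le (hδΔ 0)
  have hΔ : 2 ^ (s + 1) * B * Δ ≤ 1 / 2 := by
    have h1 := hΔr.trans (min_le_left _ _)
    rw [le_div_iff₀ (by positivity)] at h1
    linarith
  have hΔ' : 4 * (s.factorial : ℝ) * (2 ^ (s + 1) * B) ^ s * Δ ≤ 1 := by
    have h1 := hΔr.trans (min_le_right _ _)
    rw [le_div_iff₀ (by positivity)] at h1
    linarith
  set σ : Fin s → ℝ → ℝ := fun k x => ∑' m : ℕ, x ^ (m + 1) * S k m / ((m + 1).factorial : ℝ)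
    with hσ
  have hsum : ∀ (t : ℕ) (c x : Fin t → ℝ) (k : Fin s), HasSum (fun m : ℕ =>
      (∑ j, c j * x j ^ (m + 1)) * S k m / ((m + 1).factorial : ℝ)) (∑ j, c j * σ k (x j)) := by
    intro t c x k
    have h1 := hasSum_sum (s := Finset.univ)
      fun j (_ : j ∈ Finset.univ) => (summable_fundamental (hSB k) (x j)).hasSum.mul_left (c j)
    refine h1.congr_fun fun m => ?_
    rw [Finset.sum_mul, Finset.sum_div]
    exact Finset.sum_congr rfl fun j _ => by ring
  set Λ := Matrix.mulVecLin (Matrix.of fun (k j : Fin s) => σ k (δ j.castSucc)) with hΛ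
  have hΛapp : ∀ c k, Λ c k = ∑ j, c j * σ k (δ j.castSucc) := by
    intro c k
    rw [hΛ, Matrix.mulVecLin_apply, Matrix.mulVec, dotProduct]
    exact Finset.sum_congr rfl fun j _ => by rw [Matrix.of_apply, mul_comm]
  have hinj : Function.Injective Λ := by
    rw [← LinearMap.ker_eq_bot, LinearMap.ker_eq_bot']
    intro c hc
    by_contra hc0
    obtain ⟨i, hi, hsi, -⟩ := exists_dominant_moment (Nat.le_succ s) hB hS hSB hΔ0 hΔ hΔ'
      (δ := fun j : Fin s => δ j.castSucc) (hδ.comp (Fin.castSucc_injective s))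
      (fun j => hδ0 _) (fun j => hδΔ _) hc0 (fun k => by
        have h1 := hsum s c (fun j => δ j.castSucc) k
        rwa [← hΛapp, hc] at h1)
    omega
  obtain ⟨c, hc⟩ := LinearMap.injective_iff_surjective.1 hinj fun k => -σ k (δ (Fin.last s))
  set c' : Fin (s + 1) → ℝ := Fin.snoc c 1 with hc'
  have hlast : c' (Fin.last s) = 1 := by simp [hc']
  have hc'0 : c' ≠ 0 := fun h => by
    rw [h] at hlast
    exact zero_ne_one hlast
  have hzero : ∀ k, HasSum (fun m => (∑ j, c' j * δ j ^ (m + 1)) * S k m /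
      ((m + 1).factorial : ℝ)) 0 := by
    intro k
    have h1 := hsum (s + 1) c' δ k
    have h2 : ∑ j, c' j * σ k (δ j) = 0 := by
      rw [Fin.sum_univ_castSucc, hlast]
      have h3 := congrFun hc k
      rw [hΛapp] at h3
      simp only [hc', Fin.snoc_castSucc]
      rw [h3]
      ring
    rwa [h2] at h1
  obtain ⟨i, hi, hsi, hne, hbd⟩ := exists_dominant_moment le_rfl hB hS hSB hΔ0 hΔ hΔ' hδ hδ0 hδΔ
    hc'0 hzero
  obtain rfl : i = s := by omega
  refine ⟨c', hlast, hne, fun l => (hbd (i + l)).trans (le_of_eq ?_), hzero⟩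
  rw [pow_add _ i l, mul_pow, show i + l + 1 = (i + 1) + l by ring, pow_add Δ]
  have h1 : Δ ^ (i + 1) ≠ 0 := by positivity
  have h2 := div_mul_cancel₀ |∑ j, c' j * δ j ^ (i + 1)| h1
  set M := |∑ j, c' j * δ j ^ (i + 1)|
  calc _ = (2 ^ (i + 1)) ^ i * (2 ^ (i + 1)) ^ l * (M / Δ ^ (i + 1) * Δ ^ (i + 1)) * Δ ^ l := by
        ring
    _ = _ := by rw [h2]; ring

/-! ### Combinations of differences and linear differential operators -/

theorem iteratedDeriv_iteratedDeriv_eq (m n : ℕ) (w : ℂ → ℂ) :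
    iteratedDeriv m (iteratedDeriv n w) = iteratedDeriv (m + n) w := by
  simp only [iteratedDeriv_eq_iterate, Function.iterate_add_apply]

/-- The differential operator `w ↦ w^(s+1) + ∑_{i<s} b_i w^(i+1)`. -/
noncomputable def linDiffOp {s : ℕ} (b : Fin s → ℝ) (w : ℂ → ℂ) (z : ℂ) : ℂ :=
  iteratedDeriv (s + 1) w z + ∑ i : Fin s, (b i : ℂ) * iteratedDeriv (i + 1) w z

theorem DifferentiableOn.contDiffAt_iteratedDeriv {Ω : Set ℂ} (hΩ : IsOpen Ω) {w : ℂ → ℂ}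
    (hw : DifferentiableOn ℂ w Ω) (k : ℕ) (n : WithTop ℕ∞) {z : ℂ} (hz : z ∈ Ω) :
    ContDiffAt ℂ n (iteratedDeriv k w) z := by
  rw [iteratedDeriv_eq_iterate]
  exact ((hw.analyticAt (hΩ.mem_nhds hz)).iterated_deriv k).contDiffAt

theorem differentiableOn_linDiffOp {s : ℕ} (b : Fin s → ℝ) {Ω : Set ℂ} (hΩ : IsOpen Ω)
    {w : ℂ → ℂ} (hw : DifferentiableOn ℂ w Ω) : DifferentiableOn ℂ (linDiffOp b w) Ω := by
  have h : ∀ k, DifferentiableOn ℂ (iteratedDeriv k w) Ω := fun k z hz =>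
    ((hw.contDiffAt_iteratedDeriv hΩ k 1 hz).differentiableAt one_ne_zero).differentiableWithinAt
  exact (h _).add (DifferentiableOn.fun_sum fun i _ => (h _).const_mul _)

theorem iteratedDeriv_linDiffOp {s : ℕ} (b : Fin s → ℝ) {Ω : Set ℂ} (hΩ : IsOpen Ω)
    {w : ℂ → ℂ} (hw : DifferentiableOn ℂ w Ω) (m : ℕ) {z : ℂ} (hz : z ∈ Ω) :
    iteratedDeriv m (linDiffOp b w) z = iteratedDeriv (m + s + 1) w z +
      ∑ i : Fin s, (b i : ℂ) * iteratedDeriv (m + i + 1) w z := by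
  have h : ∀ k, ContDiffAt ℂ m (iteratedDeriv k w) z := fun k =>
    hw.contDiffAt_iteratedDeriv hΩ k m hz
  unfold linDiffOp
  rw [iteratedDeriv_fun_add (h _) (ContDiffAt.sum fun i _ => contDiffAt_const.mul (h _)),
    iteratedDeriv_fun_sum fun i _ => contDiffAt_const.mul (h _), iteratedDeriv_iteratedDeriv_eq,
    add_assoc]
  congr 1
  refine Finset.sum_congr rfl fun i _ => ?_
  rw [iteratedDeriv_const_mul_field, iteratedDeriv_iteratedDeriv_eq, add_assoc]

/-- The difference between a sequence and the solution of the homogeneous recurrence with the same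
initial values is controlled by the inhomogeneous term. -/
theorem norm_residual_le {s : ℕ} {b : Fin s → ℝ} {V E : ℕ → ℂ} {C x : ℝ}
    (hE0 : ∀ i < s, E i = 0) (hE : ∀ m, E (m + s) = V m - ∑ i : Fin s, (b i : ℂ) * E (m + i))
    (hC : 0 ≤ C) (hx : 1 ≤ x) (hV : ∀ m : ℕ, ‖V m‖ ≤ (m.factorial : ℝ) * C * x ^ m) (m : ℕ) :
    ‖E (m + s)‖ ≤ (m.factorial : ℝ) * (2 * C) * (2 * (1 + ∑ i, |b i|) * x) ^ m := by
  have hb : 0 ≤ ∑ i, |b i| := Finset.sum_nonneg fun i _ => abs_nonneg _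
  set Q : ℝ := 2 * (1 + ∑ i, |b i|) with hQ
  have hQ1 : 1 ≤ Q := by linarith
  have hQx : 1 ≤ Q * x := by nlinarith
  induction m using Nat.strong_induction_on with
  | _ m ih =>
    have h1 : ∀ i : Fin s, ‖E (m + i)‖ ≤ (m.factorial : ℝ) * (2 * C) * ((Q * x) ^ m / Q) := by
      intro i
      rcases lt_or_ge (m + i) s with h | h
      · rw [hE0 _ h, norm_zero]
        positivity
      · obtain ⟨l, hl⟩ := Nat.exists_eq_add_of_le' h
        have hlm : l < m := by omega
        have h2 : (l.factorial : ℝ) ≤ (m.factorial : ℝ) := by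
          exact_mod_cast Nat.factorial_le hlm.le
        have h3 : (Q * x) ^ l ≤ (Q * x) ^ m / Q := by
          rw [le_div_iff₀ (by linarith)]
          calc (Q * x) ^ l * Q ≤ (Q * x) ^ l * (Q * x) := by
                gcongr
                nlinarith
            _ = (Q * x) ^ (l + 1) := by rw [pow_succ]
            _ ≤ (Q * x) ^ m := pow_le_pow_right₀ hQx hlm
        rw [hl]
        exact (ih l hlm).trans (by gcongr)
    have h4 : x ^ m ≤ (Q * x) ^ m := by gcongr; nlinarith
    rw [hE]
    calc ‖V m - ∑ i : Fin s, (b i : ℂ) * E (m + i)‖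
        ≤ ‖V m‖ + ∑ i : Fin s, ‖(b i : ℂ) * E (m + i)‖ :=
          (norm_sub_le _ _).trans (by gcongr; exact norm_sum_le _ _)
      _ ≤ (m.factorial : ℝ) * C * (Q * x) ^ m +
          ∑ i : Fin s, |b i| * ((m.factorial : ℝ) * (2 * C) * ((Q * x) ^ m / Q)) := by
        gcongr with i
        · exact (hV m).trans (by gcongr)
        · rw [norm_mul, Complex.norm_real, Real.norm_eq_abs]
          gcongr
          exact h1 i
      _ = (m.factorial : ℝ) * C * (Q * x) ^ m * (1 + 2 * (∑ i, |b i|) / Q) := by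
        rw [← Finset.sum_mul]
        ring
      _ ≤ (m.factorial : ℝ) * C * (Q * x) ^ m * (1 + 1) := by
        gcongr
        rw [div_le_one (by linarith)]
        linarith
      _ = _ := by ring

/-- Taylor expansion of a combination of differences whose lower moments are annihilated by the
fundamental solutions `S` of the recurrence with coefficients `-b`: only the residuals `E`
contribute. -/
theorem exists_hasSum_residual {s : ℕ} {b : Fin s → ℝ} {S : Fin s → ℕ → ℝ}
    (hS : ∀ k : Fin s, ∀ i < s, S k i = if i = k then 1 else 0)
    (hrec : ∀ k m, S k (m + s) = -∑ i : Fin s, b i * S k (m + i)) {t : ℕ} {c δ : Fin t → ℝ}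
    (hc : ∀ k, HasSum (fun m => (∑ j, c j * δ j ^ (m + 1)) * S k m / ((m + 1).factorial : ℝ)) 0)
    {w : ℂ → ℂ} {R : ℝ} (hw : DifferentiableOn ℂ w (Metric.ball 0 R)) {z : ℂ}
    (hz : ∀ j, ‖z‖ + |δ j| < R) (hzR : ‖z‖ < R) :
    ∃ E : ℕ → ℂ, (∀ i < s, E i = 0) ∧
      (∀ m, E (m + s) = iteratedDeriv m (linDiffOp b w) z - ∑ i : Fin s, (b i : ℂ) * E (m + i)) ∧
      HasSum (fun l => ((∑ j, c j * δ j ^ (l + s + 1) : ℝ) : ℂ) / ((l + s + 1).factorial : ℂ) *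
        E (l + s)) (∑ j, (c j : ℂ) * (w (z + δ j) - w z)) := by
  have hzb : z ∈ Metric.ball (0 : ℂ) R := by simpa using hzR
  set a : ℕ → ℂ := fun m => iteratedDeriv (m + 1) w z with ha
  set E : ℕ → ℂ := fun m => a m - ∑ k : Fin s, (S k m : ℂ) * a k with hE
  have hE0 : ∀ i < s, E i = 0 := by
    intro i hi
    rw [hE]
    simp only
    rw [Finset.sum_eq_single (⟨i, hi⟩ : Fin s)]
    · rw [hS _ i hi]; simp
    · intro k _ hk
      rw [hS _ i hi, if_neg fun h => hk (Fin.ext h.symm)]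
      simp
    · simp
  refine ⟨E, hE0, fun m => ?_, ?_⟩
  · rw [iteratedDeriv_linDiffOp b Metric.isOpen_ball hw m hzb]
    simp only [hE, ha, hrec, mul_sub, Finset.sum_sub_distrib, Finset.mul_sum]
    push_cast
    simp only [neg_mul, Finset.sum_neg_distrib, Finset.sum_mul]
    rw [Finset.sum_comm]
    simp only [mul_assoc]
    ring
  · have h1 : ∀ j, HasSum (fun m : ℕ => (δ j : ℂ) ^ (m + 1) / ((m + 1).factorial : ℂ) * a m)
        (w (z + δ j) - w z) := by
      intro j
      have hsub : Metric.ball z (R - ‖z‖) ⊆ Metric.ball (0 : ℂ) R := by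
        refine Metric.ball_subset_ball' ?_
        rw [dist_zero_right]
        linarith
      have h2 := Complex.hasSum_taylorSeries_on_ball (z := z + δ j) (hw.mono hsub) (by
        rw [Metric.mem_ball, dist_eq_norm, add_sub_cancel_left, Complex.norm_real,
          Real.norm_eq_abs]
        linarith [hz j])
      have h3 := (hasSum_nat_add_iff' 1).2 h2
      simp only [Finset.range_one, Finset.sum_singleton, pow_zero, one_smul, Nat.factorial_zero,
        Nat.cast_one, inv_one, iteratedDeriv_zero, add_sub_cancel_left] at h3
      refine h3.congr_fun fun m => ?_
      rw [smul_eq_mul, smul_eq_mul]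
      ring
    have h2 : HasSum (fun m : ℕ => ((∑ j, c j * δ j ^ (m + 1) : ℝ) : ℂ) /
        ((m + 1).factorial : ℂ) * a m) (∑ j, (c j : ℂ) * (w (z + δ j) - w z)) := by
      refine (hasSum_sum fun j (_ : j ∈ Finset.univ) => (h1 j).mul_left (c j : ℂ)).congr_fun
        fun m => ?_
      push_cast
      rw [Finset.sum_div, Finset.sum_mul]
      exact Finset.sum_congr rfl fun j _ => by ring
    have h3 : HasSum (fun m : ℕ => ∑ k : Fin s, (((∑ j, c j * δ j ^ (m + 1)) * S k m /
        ((m + 1).factorial : ℝ) : ℝ) : ℂ) * a k) 0 := by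
      have h4 := hasSum_sum fun k (_ : k ∈ (Finset.univ : Finset (Fin s))) =>
        (Complex.hasSum_ofReal.2 (hc k)).mul_right (a k)
      simpa using h4
    have h4 := (h2.sub h3).congr_fun (g := fun m : ℕ =>
      ((∑ j, c j * δ j ^ (m + 1) : ℝ) : ℂ) / ((m + 1).factorial : ℂ) * E m) fun m => by
        rw [hE]
        simp only
        rw [mul_sub, Finset.mul_sum]
        congr 1
        refine Finset.sum_congr rfl fun k _ => ?_
        push_cast
        ring
    have h5 := (hasSum_nat_add_iff' s).2 h4
    have h6 : ∑ i ∈ Finset.range s, ((∑ j, c j * δ j ^ (i + 1) : ℝ) : ℂ) /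
        ((i + 1).factorial : ℂ) * E i = 0 :=
      Finset.sum_eq_zero fun i hi => by rw [hE0 i (Finset.mem_range.1 hi), mul_zero]
    rwa [h6, sub_zero, sub_zero] at h5

/-- If a linear differential operator annihilates `w`, a corresponding combination of differences
of `w` vanishes. -/
theorem exists_combination_eq_zero {s : ℕ} {b : Fin s → ℝ} {w : ℂ → ℂ} {R : ℝ} (hR : 0 < R)
    (hw : DifferentiableOn ℂ w (Metric.ball 0 R))
    (hv : ∀ z ∈ Metric.ball (0 : ℂ) R, linDiffOp b w z = 0) :
    ∃ r > 0, ∀ (δ : Fin (s + 1) → ℝ), Function.Injective δ → (∀ j, 0 < δ j) → (∀ j, δ j ≤ r) →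
      ∃ c : Fin (s + 1) → ℝ, c (Fin.last s) = 1 ∧
        ∀ z : ℂ, ‖z‖ < r → ∑ j, (c j : ℂ) * (w (z + δ j) - w z) = 0 := by
  obtain ⟨S, B, hB, hS, hrec, hSB⟩ := exists_fundamental_solutions b
  obtain ⟨r, hr, H⟩ := exists_annihilating_coeff hB hS hSB
  refine ⟨min r (R / 2), by positivity, fun δ hδ hδ0 hδr => ?_⟩
  obtain ⟨c, hc1, -, -, hc⟩ := H r δ le_rfl hδ hδ0 fun j => (hδr j).trans (min_le_left _ _)
  refine ⟨c, hc1, fun z hz => ?_⟩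
  have hz2 : ‖z‖ < R / 2 := hz.trans_le (min_le_right _ _)
  obtain ⟨E, hE0, hE, hsum⟩ := exists_hasSum_residual hS hrec hc hw (z := z)
    (fun j => by
      rw [abs_of_pos (hδ0 j)]
      linarith [(hδr j).trans (min_le_right _ _)]) (by linarith)
  have hV : ∀ m, iteratedDeriv m (linDiffOp b w) z = 0 := by
    intro m
    have h1 : linDiffOp b w =ᶠ[nhds z] fun _ => 0 :=
      Filter.eventually_of_mem (Metric.isOpen_ball.mem_nhds (by
        simpa using (by linarith : ‖z‖ < R))) hv
    rw [h1.iteratedDeriv_eq]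
    simp
  have h1 : ∀ l, E (l + s) = 0 := by
    intro l
    have := norm_residual_le hE0 hE (C := 0) (x := 1) le_rfl le_rfl
      (fun m => by rw [hV, norm_zero]; simp) l
    simpa using this
  refine hsum.unique ?_
  simp only [h1, mul_zero]
  exact hasSum_zero

/-- If a linear differential operator turns `w` into a function that is asymptotically `c₀ z ^ p`
at `0`, a corresponding combination of differences of `w` with steps in `(0, Δ]` behaves like
`z ^ p` for `z` small but large compared with `Δ`. -/
theorem exists_combination_relClose {s p : ℕ} {b : Fin s → ℝ} {w : ℂ → ℂ} {R c₀ : ℝ} (hR : 0 < R)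
    (hw : DifferentiableOn ℂ w (Metric.ball 0 R)) (hc₀ : c₀ ≠ 0)
    (hv : ∀ ε > 0, ∃ r > 0, ∀ z : ℂ, ‖z‖ ≤ r → RelClose ε (linDiffOp b w z) (c₀ * z ^ p))
    {ε : ℝ} (hε : 0 < ε) :
    ∃ L > 0, ∃ r > 0, ∀ (Δ : ℝ) (δ : Fin (s + 1) → ℝ), Δ ≤ r → Function.Injective δ →
      (∀ j, 0 < δ j) → (∀ j, δ j ≤ Δ) → ∃ c : Fin (s + 1) → ℝ, c (Fin.last s) = 1 ∧
        ∃ κ : ℝ, κ ≠ 0 ∧ ∀ z : ℂ, L * Δ ≤ ‖z‖ → ‖z‖ ≤ r →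
          RelClose ε (∑ j, (c j : ℂ) * (w (z + δ j) - w z)) (κ * z ^ p) := by
  obtain ⟨S, B, hB, hS, hrec, hSB⟩ := exists_fundamental_solutions b
  obtain ⟨r₀, hr₀, H⟩ := exists_annihilating_coeff hB hS hSB
  obtain ⟨r₁, hr₁, hv₁⟩ := hv 1 one_pos
  obtain ⟨r₂, hr₂, hv₂⟩ := hv (ε / 2) (half_pos hε)
  have hb : 0 ≤ ∑ i, |b i| := Finset.sum_nonneg fun i _ => abs_nonneg _
  set A : ℝ := 2 ^ (s + 1) with hA
  have hA0 : 0 < A := by positivity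
  set Q : ℝ := 2 * (1 + ∑ i, |b i|) with hQ
  have hQ0 : 0 < Q := by positivity
  set y : ℝ := min (1 / 2) (ε / (A ^ s * 2 ^ (p + 4))) with hy
  have hy0 : 0 < y := by positivity
  set r : ℝ := min (min r₀ (R / 4)) (min (r₁ / 2) (min r₂ 1)) with hr
  have hr0 : 0 < r := by positivity
  have hrr₀ : r ≤ r₀ := (min_le_left _ _).trans (min_le_left _ _)
  have hrR : r ≤ R / 4 := (min_le_left _ _).trans (min_le_right _ _)
  have hrr₁ : r ≤ r₁ / 2 := (min_le_right _ _).trans (min_le_left _ _)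
  have hrr₂ : r ≤ r₂ := (min_le_right _ _).trans ((min_le_right _ _).trans (min_le_left _ _))
  have hr1 : r ≤ 1 := (min_le_right _ _).trans ((min_le_right _ _).trans (min_le_right _ _))
  refine ⟨2 * A * Q / y, by positivity, r, hr0, fun Δ δ hΔr hδ hδ0 hδΔ => ?_⟩
  have hΔ0 : 0 < Δ := (hδ0 0).trans_le (hδΔ 0)
  obtain ⟨c, hc1, hμ0, hμ, hc⟩ := H Δ δ (hΔr.trans hrr₀) hδ hδ0 hδΔ
  set μ : ℝ := ∑ j, c j * δ j ^ (s + 1) with hμdef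
  have hf : (0 : ℝ) < ((s + 1).factorial : ℝ) := by exact_mod_cast Nat.factorial_pos _
  refine ⟨c, hc1, μ / ((s + 1).factorial : ℝ) * c₀, mul_ne_zero (div_ne_zero hμ0 hf.ne') hc₀,
    fun z hzL hzr => ?_⟩
  have hz0 : 0 < ‖z‖ := lt_of_lt_of_le (by positivity) hzL
  obtain ⟨E, hE0, hE, hsum⟩ := exists_hasSum_residual hS hrec hc hw (z := z)
    (fun j => by
      rw [abs_of_pos (hδ0 j)]
      linarith [hδΔ j]) (by linarith)
  -- Cauchy's estimate on a circle of radius half the distance to the origin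
  set C : ℝ := 2 ^ (p + 1) * |c₀| * ‖z‖ ^ p with hC
  have hC0 : 0 ≤ C := by positivity
  have hsub : Metric.closedBall z (‖z‖ / 2) ⊆ Metric.ball (0 : ℂ) R := by
    refine Metric.closedBall_subset_ball' ?_
    rw [dist_zero_right]
    linarith
  have hV : ∀ m : ℕ, ‖iteratedDeriv m (linDiffOp b w) z‖ ≤
      (m.factorial : ℝ) * C * (2 / ‖z‖) ^ m := by
    intro m
    have h1 := Complex.norm_iteratedDeriv_le_of_forall_mem_sphere_norm_le (C := C) m
      (half_pos hz0) (((differentiableOn_linDiffOp b Metric.isOpen_ball hw).mono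
        hsub).diffContOnCl_ball subset_rfl) (fun ζ hζ => ?_)
    · refine h1.trans (le_of_eq ?_)
      rw [div_pow, div_pow]
      field_simp
    · have h2 : ‖ζ‖ ≤ 2 * ‖z‖ := by
        have h3 : ‖ζ - z‖ = ‖z‖ / 2 := by rwa [mem_sphere_iff_norm] at hζ
        have h4 := norm_add_le (ζ - z) z
        rw [sub_add_cancel] at h4
        linarith
      have h3 := (hv₁ ζ (by linarith)).norm_le
      refine h3.trans ?_
      rw [norm_mul, norm_pow, Complex.norm_real, Real.norm_eq_abs]
      calc (1 + 1) * (|c₀| * ‖ζ‖ ^ p) ≤ (1 + 1) * (|c₀| * (2 * ‖z‖) ^ p) := by gcongr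
        _ = C := by rw [hC, mul_pow]; ring
  have hres := norm_residual_le hE0 hE hC0 (x := 2 / ‖z‖)
    (by rw [le_div_iff₀ hz0]; linarith) hV
  have hEs : E (0 + s) = linDiffOp b w z := by
    rw [hE, iteratedDeriv_zero, Finset.sum_eq_zero fun i _ => ?_, sub_zero]
    rw [hE0 _ (by omega), mul_zero]
  have hratio : Q * (2 / ‖z‖) * (A * Δ) ≤ y := by
    rw [show Q * (2 / ‖z‖) * (A * Δ) = 2 * A * Q * Δ / ‖z‖ by ring, div_le_iff₀ hz0]
    rw [div_mul_eq_mul_div, div_le_iff₀ hy0] at hzL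
    linarith
  have h1 := (hasSum_nat_add_iff' 1).2 hsum
  rw [Finset.sum_range_one, hEs] at h1
  set M : ℝ := |μ| / ((s + 1).factorial : ℝ) * A ^ s * (2 * C) with hM
  have hM0 : 0 ≤ M := by positivity
  have hgeo : HasSum (fun l : ℕ => M * y * (1 / 2) ^ l) (M * y * 2) :=
    hasSum_geometric_two.mul_left _
  have h2 := h1.norm_le_of_bounded hgeo fun l => by
    have h3 := hμ (l + 1)
    have h4 := hres (l + 1)
    have hf1 : (0 : ℝ) < ((l + 1 + s + 1).factorial : ℝ) := by
      exact_mod_cast Nat.factorial_pos _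
    have hf2 : ((l + 1).factorial : ℝ) * ((s + 1).factorial : ℝ) ≤
        ((l + 1 + s + 1).factorial : ℝ) := by
      exact_mod_cast Nat.le_of_dvd (Nat.factorial_pos _)
        (Nat.factorial_mul_factorial_dvd_factorial_add (l + 1) (s + 1))
    rw [norm_mul, norm_div, Complex.norm_real, Real.norm_eq_abs, Complex.norm_natCast]
    rw [show l + 1 + s + 1 = s + (l + 1) + 1 by ring] at hf1 hf2 ⊢
    calc |∑ j, c j * δ j ^ (s + (l + 1) + 1)| / ((s + (l + 1) + 1).factorial : ℝ) * ‖E (l + 1 + s)‖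
        ≤ (|μ| * A ^ s * (A * Δ) ^ (l + 1)) / ((s + (l + 1) + 1).factorial : ℝ) *
            (((l + 1).factorial : ℝ) * (2 * C) * (Q * (2 / ‖z‖)) ^ (l + 1)) := by gcongr
      _ = |μ| * A ^ s * (2 * C) * (((l + 1).factorial : ℝ) /
            ((s + (l + 1) + 1).factorial : ℝ)) * (Q * (2 / ‖z‖) * (A * Δ)) ^ (l + 1) := by
          rw [mul_pow (Q * (2 / ‖z‖))]
          ring
      _ ≤ |μ| * A ^ s * (2 * C) * (1 / ((s + 1).factorial : ℝ)) * y ^ (l + 1) := by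
          have h5 : ((l + 1).factorial : ℝ) / ((s + (l + 1) + 1).factorial : ℝ) ≤
              1 / ((s + 1).factorial : ℝ) := by
            rw [div_le_div_iff₀ hf1 hf, one_mul]
            exact hf2
          have h6 : 0 ≤ Q * (2 / ‖z‖) * (A * Δ) := by positivity
          gcongr
      _ = M * y * y ^ l := by rw [hM]; ring
      _ ≤ M * y * (1 / 2) ^ l := by
          gcongr
          exact min_le_left _ _
  have h3 := hv₂ z (hzr.trans hrr₂)
  unfold RelClose at h3 ⊢
  have hκ : ((μ / ((s + 1).factorial : ℝ) * c₀ : ℝ) : ℂ) =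
      (μ : ℂ) / ((s + 1).factorial : ℂ) * c₀ := by push_cast; ring
  rw [zero_add] at h2
  have hnorm : ‖(μ : ℂ) / ((s + 1).factorial : ℂ)‖ = |μ| / ((s + 1).factorial : ℝ) := by
    rw [norm_div, Complex.norm_real, Complex.norm_natCast, Real.norm_eq_abs]
  have hyε : y ≤ ε / (A ^ s * 2 ^ (p + 4)) := min_le_right _ _
  rw [le_div_iff₀ (by positivity)] at hyε
  rw [hκ, mul_assoc]
  set ψ : ℂ := ∑ j, (c j : ℂ) * (w (z + δ j) - w z)
  set g : ℂ := (μ : ℂ) / ((s + 1).factorial : ℂ) with hg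
  calc ‖ψ - g * (c₀ * z ^ p)‖
      = ‖(ψ - g * linDiffOp b w z) + g * (linDiffOp b w z - c₀ * z ^ p)‖ := by congr 1; ring
    _ ≤ M * y * 2 + ‖g‖ * (ε / 2 * ‖(c₀ : ℂ) * z ^ p‖) := by
        refine (norm_add_le _ _).trans ?_
        rw [norm_mul g]
        gcongr
    _ = ‖g‖ * (|c₀| * ‖z‖ ^ p) * (y * (A ^ s * 2 ^ (p + 4)) / 2 + ε / 2) := by
        rw [norm_mul (c₀ : ℂ), norm_pow, Complex.norm_real, Real.norm_eq_abs, hnorm, hM, hC]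
        ring
    _ ≤ ‖g‖ * (|c₀| * ‖z‖ ^ p) * (ε / 2 + ε / 2) := by gcongr
    _ = ε * ‖g * (c₀ * z ^ p)‖ := by
        rw [norm_mul g, norm_mul (c₀ : ℂ), norm_pow, Complex.norm_real, Real.norm_eq_abs]
        ring

/-! ### Elimination -/

/-- Gaussian elimination: finitely many sequences, none of which is a combination of the previous
ones, can be combined in a unitriangular way to sequences with distinct orders of vanishing. -/
theorem exists_triangular_elimination (u : ℕ → ℕ → ℝ) (n : ℕ)
    (hu : ∀ s < n, ∀ b : ℕ → ℝ, ∃ l, u s l + ∑ k ∈ Finset.range s, b k * u k l ≠ 0) :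
    ∃ (C : ℕ → ℕ → ℝ) (p : ℕ → ℕ), (∀ s < n, C s s = 1) ∧ (∀ s < n, ∀ k, s < k → C s k = 0) ∧
      (∀ s < n, ∀ t < n, p s = p t → s = t) ∧
      ∀ s < n, ∑ k ∈ Finset.range n, C s k * u k (p s) ≠ 0 ∧
        ∀ l < p s, ∑ k ∈ Finset.range n, C s k * u k l = 0 := by
  classical
  induction n with
  | zero => exact ⟨0, 0, by simp, by simp, by simp, by simp⟩
  | succ n ih =>
    obtain ⟨C, p, hC1, hC0, hp, hv⟩ := ih fun s hs => hu s (by omega)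
    set v : ℕ → ℕ → ℝ := fun s l => ∑ k ∈ Finset.range n, C s k * u k l with hvdef
    -- the combinations found so far are determined by their coefficients at the indices `p`
    set Λ := Matrix.mulVecLin (Matrix.of fun (k j : Fin n) => v j (p k)) with hΛ
    have hΛapp : ∀ c k, Λ c k = ∑ j : Fin n, c j * v j (p k) := by
      intro c k
      rw [hΛ, Matrix.mulVecLin_apply, Matrix.mulVec, dotProduct]
      exact Finset.sum_congr rfl fun j _ => by rw [Matrix.of_apply, mul_comm]
    have hinj : Function.Injective Λ := by
      rw [← LinearMap.ker_eq_bot, LinearMap.ker_eq_bot']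
      intro c hc
      by_contra hc0
      have hne : (Finset.univ.filter fun j : Fin n => c j ≠ 0).Nonempty := by
        by_contra h
        rw [Finset.not_nonempty_iff_eq_empty, Finset.filter_eq_empty_iff] at h
        exact hc0 (funext fun j => by simpa using h (Finset.mem_univ j))
      obtain ⟨j, hj, hmin⟩ := Finset.exists_min_image _ (fun j : Fin n => p j) hne
      have h1 := congrFun hc j
      rw [hΛapp, Finset.sum_eq_single j] at h1
      · exact mul_ne_zero (Finset.mem_filter.1 hj).2 (hv j j.2).1 h1
      · intro i _ hij
        by_cases hi : c i = 0
        · rw [hi, zero_mul]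
        · have h2 := hmin i (Finset.mem_filter.2 ⟨Finset.mem_univ i, hi⟩)
          have h3 : p j ≠ p i := fun h => hij (Fin.ext (hp _ j.2 _ i.2 h).symm)
          rw [hvdef]
          simp only
          rw [(hv i i.2).2 _ (lt_of_le_of_ne h2 h3), mul_zero]
      · simp
    obtain ⟨c, hc⟩ := LinearMap.injective_iff_surjective.1 hinj fun k => -u n (p k)
    set β : ℕ → ℝ := fun k => ∑ j : Fin n, c j * C j k with hβ
    have hβv : ∀ l, ∑ k ∈ Finset.range n, β k * u k l = ∑ j : Fin n, c j * v j l := by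
      intro l
      simp only [hβ, hvdef, Finset.sum_mul, Finset.mul_sum]
      rw [Finset.sum_comm]
      exact Finset.sum_congr rfl fun j _ => Finset.sum_congr rfl fun k _ => by ring
    have hex := hu n (Nat.lt_succ_self n) β
    set C' : ℕ → ℕ → ℝ := fun s k =>
      if s = n then (if k < n then β k else if k = n then 1 else 0) else C s k with hC'
    set p' : ℕ → ℕ := fun s => if s = n then Nat.find hex else p s with hp'
    have hold : ∀ s < n, ∀ l, ∑ k ∈ Finset.range (n + 1), C' s k * u k l = v s l := by
      intro s hs l
      rw [Finset.sum_range_succ, hC']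
      simp only [if_neg hs.ne]
      rw [hC0 s hs n hs, zero_mul, add_zero]
    have hnew : ∀ l, ∑ k ∈ Finset.range (n + 1), C' n k * u k l =
        u n l + ∑ k ∈ Finset.range n, β k * u k l := by
      intro l
      rw [Finset.sum_range_succ, add_comm]
      simp only [hC', if_true, lt_irrefl, if_false, one_mul]
      congr 1
      refine Finset.sum_congr rfl fun k hk => ?_
      rw [if_pos (Finset.mem_range.1 hk)]
    have hpn : p' n = Nat.find hex := by simp [hp']
    have hps : ∀ s < n, p' s = p s := fun s hs => by simp [hp', hs.ne]
    have hfresh : ∀ s < n, p s ≠ Nat.find hex := by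
      intro s hs h
      have h1 := Nat.find_spec hex
      rw [← h, hβv] at h1
      have h2 := congrFun hc ⟨s, hs⟩
      rw [hΛapp] at h2
      exact h1 (by rw [h2]; ring)
    refine ⟨C', p', ?_, ?_, ?_, ?_⟩
    · intro s hs
      rcases Nat.lt_succ_iff_lt_or_eq.1 hs with h | rfl
      · simp [hC', h.ne, hC1 s h]
      · simp [hC']
    · intro s hs k hk
      rcases Nat.lt_succ_iff_lt_or_eq.1 hs with h | rfl
      · simp [hC', h.ne, hC0 s h k hk]
      · simp [hC', hk.ne', not_lt.2 hk.le]
    · intro s hs t ht h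
      rcases Nat.lt_succ_iff_lt_or_eq.1 hs with hs' | rfl <;>
        rcases Nat.lt_succ_iff_lt_or_eq.1 ht with ht' | rfl
      · rw [hps s hs', hps t ht'] at h
        exact hp s hs' t ht' h
      · rw [hps s hs', hpn] at h
        exact absurd h (hfresh s hs')
      · rw [hps t ht', hpn] at h
        exact absurd h.symm (hfresh t ht')
      · rfl
    · intro s hs
      rcases Nat.lt_succ_iff_lt_or_eq.1 hs with h | rfl
      · rw [hps s h]
        simp only [hold s h]
        exact hv s h
      · rw [hpn]
        simp only [hnew]
        exact ⟨Nat.find_spec hex, fun l hl => not_not.1 (Nat.find_min hex hl)⟩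

/-! ### Complex extension and leading terms -/

/-- A real analytic function extends to a holomorphic function near the origin. -/
theorem exists_complex_extension {f : ℝ → ℝ} (hf : AnalyticAt ℝ f 0) :
    ∃ R > 0, ∃ F : ℂ → ℂ, DifferentiableOn ℂ F (Metric.ball 0 R) ∧
      ConjSymm (Metric.ball 0 R) F ∧ ∀ x : ℝ, |x| < R → F x = f x := by
  obtain ⟨p, hp⟩ := hf
  rw [hasFPowerSeriesAt_iff, Metric.eventually_nhds_iff] at hp
  obtain ⟨r, hr, hp⟩ := hp
  simp only [zero_add, smul_eq_mul, dist_zero_right, Real.norm_eq_abs] at hp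
  have hsum : Summable fun n : ℕ => |(r / 2) ^ n * p.coeff n| :=
    (hp (y := r / 2) (by rw [abs_of_pos (half_pos hr)]; linarith)).summable.abs
  have hR : 0 < r / 2 := half_pos hr
  refine ⟨r / 2, hR, fun z => ∑' n : ℕ, z ^ n * (p.coeff n : ℂ), ?_, ?_, ?_⟩
  · refine Complex.differentiableOn_tsum_of_summable_norm hsum
      (fun n => (differentiableOn_id.pow n).mul_const _) Metric.isOpen_ball fun n z hz => ?_
    rw [mem_ball_zero_iff] at hz
    rw [norm_mul, norm_pow, Complex.norm_real, Real.norm_eq_abs, abs_mul, abs_pow,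
      abs_of_pos hR]
    gcongr
  · intro z _
    simp only
    rw [Complex.conj_tsum]
    exact tsum_congr fun n => by simp
  · intro x hx
    have h1 := Complex.hasSum_ofReal.2 (hp (y := x) (by linarith))
    rw [← h1.tsum_eq]
    exact tsum_congr fun n => by push_cast; rfl

theorem eq_zero_of_iteratedDeriv_eq_zero {g : ℂ → ℂ} {R : ℝ}
    (hg : DifferentiableOn ℂ g (Metric.ball 0 R)) (h : ∀ l, iteratedDeriv l g 0 = 0) :
    ∀ z ∈ Metric.ball (0 : ℂ) R, g z = 0 := by
  intro z hz
  have h1 := Complex.hasSum_taylorSeries_on_ball hg hz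
  simp only [h, smul_zero] at h1
  exact h1.unique hasSum_zero

/-- A holomorphic function is asymptotic to the first nonzero term of its Taylor series. -/
theorem exists_relClose_leading_term {g : ℂ → ℂ} (hg : AnalyticAt ℂ g 0) {p : ℕ} {c : ℝ}
    (h0 : ∀ l < p, iteratedDeriv l g 0 = 0) (hp : iteratedDeriv p g 0 = c) (hc : c ≠ 0) :
    ∀ ε > 0, ∃ r > 0, ∀ z : ℂ, ‖z‖ ≤ r →
      RelClose ε (g z) ((c / (p.factorial : ℝ) : ℝ) * z ^ p) := by
  intro ε hε
  have h1 := hg.hasFPowerSeriesAt.isBigO_sub_partialSum_pow (p + 1)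
  obtain ⟨K, hK, h2⟩ := h1.exists_pos
  rw [Asymptotics.isBigOWith_iff, Metric.eventually_nhds_iff] at h2
  obtain ⟨r, hr, h2⟩ := h2
  have hf : (0 : ℝ) < (p.factorial : ℝ) := by exact_mod_cast Nat.factorial_pos _
  have hcp : 0 < |c / (p.factorial : ℝ)| := abs_pos.2 (div_ne_zero hc hf.ne')
  refine ⟨min (r / 2) (ε * |c / (p.factorial : ℝ)| / K), by positivity, fun z hz => ?_⟩
  have h3 := h2 (y := z) (by
    rw [dist_zero_right]
    linarith [hz.trans (min_le_left _ _)])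
  have h4 : (FormalMultilinearSeries.ofScalars ℂ
      fun n => iteratedDeriv n g 0 / (n.factorial : ℂ)).partialSum (p + 1) z =
      ((c / (p.factorial : ℝ) : ℝ) : ℂ) * z ^ p := by
    rw [FormalMultilinearSeries.partialSum, Finset.sum_range_succ, Finset.sum_eq_zero, zero_add,
      FormalMultilinearSeries.ofScalars_apply_eq, hp, smul_eq_mul]
    · push_cast
      rfl
    · intro l hl
      rw [FormalMultilinearSeries.ofScalars_apply_eq, h0 l (Finset.mem_range.1 hl)]
      simp
  rw [h4, zero_add] at h3
  unfold RelClose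
  rw [norm_mul, Complex.norm_real, Real.norm_eq_abs, norm_pow]
  refine h3.trans ?_
  rw [norm_pow, norm_norm, pow_succ]
  have h5 := hz.trans (min_le_right _ _)
  rw [le_div_iff₀ hK] at h5
  calc K * (‖z‖ ^ p * ‖z‖) = ‖z‖ ^ p * (‖z‖ * K) := by ring
    _ ≤ ‖z‖ ^ p * (ε * |c / (p.factorial : ℝ)|) := by gcongr
    _ = _ := by ring

/-- If no operator `linDiffOp` of order at most `n` annihilates `w`, there are such operators of
each order whose values at `w` have distinct orders of vanishing at the origin. -/
theorem exists_distinct_leading_terms {w : ℂ → ℂ} {R : ℝ} (hR : 0 < R)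
    (hw : DifferentiableOn ℂ w (Metric.ball 0 R)) (hsymm : ConjSymm (Metric.ball 0 R) w) {n : ℕ}
    (hind : ∀ s < n, ∀ b : Fin s → ℝ, ¬ ∀ z ∈ Metric.ball (0 : ℂ) R, linDiffOp b w z = 0) :
    ∃ p : Fin n → ℕ, Function.Injective p ∧ ∀ s : Fin n, ∃ (b : Fin s → ℝ) (c₀ : ℝ), c₀ ≠ 0 ∧
      ∀ ε > 0, ∃ r > 0, ∀ z : ℂ, ‖z‖ ≤ r → RelClose ε (linDiffOp b w z) (c₀ * z ^ p s) := by
  have h0 : (0 : ℂ) ∈ Metric.ball (0 : ℂ) R := by simpa using hR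
  have hconj : ∀ z ∈ Metric.ball (0 : ℂ) R, (starRingEnd ℂ) z ∈ Metric.ball (0 : ℂ) R := by
    intro z hz
    rw [mem_ball_zero_iff] at hz ⊢
    rwa [Complex.norm_conj]
  have hreal : ∀ k, ((iteratedDeriv k w 0).re : ℂ) = iteratedDeriv k w 0 := by
    have h1 : ∀ k, ConjSymm (Metric.ball 0 R) (iteratedDeriv k w) := by
      intro k
      induction k with
      | zero => simpa using hsymm
      | succ k ih =>
        rw [iteratedDeriv_succ]
        exact ih.deriv Metric.isOpen_ball hconj
    intro k
    simpa using (h1 k).ofReal_re (x := 0) (by simpa using hR)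
  set u : ℕ → ℕ → ℝ := fun k l => (iteratedDeriv (l + k + 1) w 0).re with hu
  have hop : ∀ (s : ℕ) (b : Fin s → ℝ) (l : ℕ),
      iteratedDeriv l (linDiffOp b w) 0 = ((u s l + ∑ i : Fin s, b i * u i l : ℝ) : ℂ) := by
    intro s b l
    rw [iteratedDeriv_linDiffOp b Metric.isOpen_ball hw l h0]
    push_cast
    simp only [hu, hreal]
  obtain ⟨C, p, hC1, hC0, hp, hv⟩ := exists_triangular_elimination u n fun s hs b => by
    by_contra hcon
    push Not at hcon
    refine hind s hs (fun i => b i) (eq_zero_of_iteratedDeriv_eq_zero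
      (differentiableOn_linDiffOp _ Metric.isOpen_ball hw) fun l => ?_)
    rw [hop, Fin.sum_univ_eq_sum_range fun i => b i * u i l, hcon l, Complex.ofReal_zero]
  have hsum : ∀ s < n, ∀ l, ∑ k ∈ Finset.range n, C s k * u k l =
      u s l + ∑ i : Fin s, C s i * u i l := by
    intro s hs l
    rw [Fin.sum_univ_eq_sum_range fun i => C s i * u i l, add_comm]
    have h1 : Finset.range (s + 1) ⊆ Finset.range n := Finset.range_subset_range.2 hs
    rw [← Finset.sum_subset h1 fun k _ hk => by
      rw [hC0 s hs k (by simpa using hk), zero_mul], Finset.sum_range_succ, hC1 s hs, one_mul]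
  refine ⟨fun s => p s, fun s t h => Fin.ext (hp s s.2 t t.2 h), fun s => ?_⟩
  obtain ⟨h1, h2⟩ := hv s s.2
  rw [hsum s s.2] at h1
  have hf : (0 : ℝ) < ((p s).factorial : ℝ) := by exact_mod_cast Nat.factorial_pos _
  refine ⟨fun i => C s i, _, div_ne_zero h1 hf.ne', ?_⟩
  refine exists_relClose_leading_term ?_ (fun l hl => ?_) (hop _ _ _) h1
  · exact (differentiableOn_linDiffOp _ Metric.isOpen_ball hw).analyticAt
      (Metric.isOpen_ball.mem_nhds h0)
  · rw [hop, ← hsum s s.2, h2 l hl, Complex.ofReal_zero]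

/-! ### From independence of differences to independence of derivatives -/

theorem ordConnected_commonDomain {ι : Type*} {U : Set ℝ} (hU : U.OrdConnected) (δ : ι → ℝ) :
    (commonDomain U δ).OrdConnected := by
  refine ⟨fun x hx y hy z hz => ⟨hU.out hx.1 hy.1 hz, fun i => hU.out (hx.2 i) (hy.2 i) ?_⟩⟩
  exact ⟨by linarith [hz.1], by linarith [hz.2]⟩

theorem hasDerivAt_discreteDeriv {f : ℝ → ℝ} {U : Set ℝ} (hf : AnalyticOnNhd ℝ f U) {d x : ℝ}
    (hx : x ∈ U) (hxd : x + d ∈ U) :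
    HasDerivAt (discreteDeriv d f) (deriv f (x + d) - deriv f x) x := by
  have h1 : HasDerivAt (fun y => f (y + d)) (deriv f (x + d)) x :=
    ((hf _ hxd).differentiableAt.hasDerivAt).comp_add_const x d
  exact h1.sub (hf _ hx).differentiableAt.hasDerivAt

theorem deriv_extension_eq {f : ℝ → ℝ} {F : ℂ → ℂ} {R : ℝ}
    (hF : DifferentiableOn ℂ F (Metric.ball 0 R)) (hsymm : ConjSymm (Metric.ball 0 R) F)
    (hFf : ∀ x : ℝ, |x| < R → F x = f x) {x : ℝ} (hx : |x| < R) :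
    deriv F x = deriv f x := by
  have hmem : (x : ℂ) ∈ Metric.ball (0 : ℂ) R := by simpa using hx
  have h1 := hasDerivAt_re Metric.isOpen_ball hF hmem
  have h2 : f =ᶠ[nhds x] fun t : ℝ => (F t).re := by
    have : ∀ᶠ t : ℝ in nhds x, |t| < R := continuous_abs.continuousAt.eventually_lt_const hx
    filter_upwards [this] with t ht
    rw [hFf t ht, Complex.ofReal_re]
  rw [h2.deriv_eq, h1.deriv]
  refine ((hsymm.deriv Metric.isOpen_ball fun z hz => ?_).ofReal_re hmem).symm
  rw [mem_ball_zero_iff] at hz ⊢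
  rwa [Complex.norm_conj]

/-- If a linear differential operator annihilated `f'`, a nontrivial combination of the derivatives
of differences `Δ_δ f` with small steps would vanish near the origin, hence everywhere. -/
theorem linDiffOp_ne_zero_of_kIndependentOn {n : ℕ} {a b : ℝ} (hab : a < b) {f : ℝ → ℝ} {U : Set ℝ}
    (hUint : U.OrdConnected) (hU : Set.Icc a b - Set.Icc a b ⊆ U)
    (hf : AnalyticOnNhd ℝ f U)
    (hind : ∀ δ : Fin n → ℝ, Function.Injective δ →
      (∀ i, 0 < δ i ∧ δ i < Metric.diam (Set.Icc a b)) →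
      KIndependentOn 1 (commonDomain U δ) (fun i => discreteDeriv (δ i) f))
    {F : ℂ → ℂ} {R : ℝ} (hR : 0 < R) (hF : DifferentiableOn ℂ F (Metric.ball 0 R))
    (hsymm : ConjSymm (Metric.ball 0 R) F) (hFf : ∀ x : ℝ, |x| < R → F x = f x) {s : ℕ}
    (hs : s < n) (β : Fin s → ℝ) :
    ¬ ∀ z ∈ Metric.ball (0 : ℂ) R, linDiffOp β (deriv F) z = 0 := by
  intro hzero
  obtain ⟨r, hr, H⟩ := exists_combination_eq_zero hR (hF.deriv Metric.isOpen_ball) hzero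
  set ρ : ℝ := min (min r (R / 2)) ((b - a) / 2) with hρ
  have hba : 0 < b - a := by linarith
  have hρ0 : 0 < ρ := by positivity
  have hρr : ρ ≤ r := (min_le_left _ _).trans (min_le_left _ _)
  have hρR : ρ ≤ R / 2 := (min_le_left _ _).trans (min_le_right _ _)
  have hρb : ρ ≤ (b - a) / 2 := min_le_right _ _
  have hn0 : (0 : ℝ) < n := by exact_mod_cast (by omega : 0 < n)
  set δ : Fin n → ℝ := fun i => ρ * (((i : ℕ) + 1 : ℝ) / n) with hδ
  have hδinj : Function.Injective δ := by
    intro i j hij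
    have h1 := mul_left_cancel₀ hρ0.ne' hij
    rw [div_left_inj' hn0.ne'] at h1
    exact Fin.ext (by exact_mod_cast (add_right_cancel h1))
  have hδ0 : ∀ i, 0 < δ i := fun i => by rw [hδ]; positivity
  have hδρ : ∀ i, δ i ≤ ρ := fun i => by
    refine mul_le_of_le_one_right hρ0.le ?_
    rw [div_le_one hn0]
    exact_mod_cast i.2
  have hdiam : Metric.diam (Set.Icc a b) = b - a := Real.diam_Icc hab.le
  have hli := hind δ hδinj fun i => ⟨hδ0 i, by rw [hdiam]; linarith [hδρ i]⟩
  obtain ⟨c, hc1, hc⟩ := H (fun j => δ (Fin.castLE hs j))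
    (hδinj.comp (Fin.castLE_injective hs)) (fun j => hδ0 _) fun j => (hδρ _).trans hρr
  set c' : Fin n → ℝ := Function.extend (Fin.castLE hs) c 0 with hc'
  have hc'e : ∀ j, c' (Fin.castLE hs j) = c j := fun j =>
    (Fin.castLE_injective hs).extend_apply _ _ _
  have hsum : ∀ G : Fin n → ℝ, ∑ i, c' i * G i = ∑ j, c j * G (Fin.castLE hs j) := by
    intro G
    symm
    refine Fintype.sum_of_injective (Fin.castLE hs) (Fin.castLE_injective hs) _ _ ?_ ?_
    · intro i hi
      rw [hc', Function.extend_apply' _ _ _ fun ⟨j, hj⟩ => hi ⟨j, hj⟩]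
      simp
    · intro j
      rw [hc'e]
  set D := commonDomain U δ with hD
  have hI : ∀ t, 0 ≤ t → t ≤ b - a → t ∈ U := fun t h0 h1 =>
    hU ⟨a + t, ⟨by linarith, by linarith⟩, a, ⟨le_rfl, hab.le⟩, by simp⟩
  have h0D : (0 : ℝ) ∈ D := by
    refine ⟨hI 0 le_rfl hba.le, fun i => hI _ ?_ ?_⟩
    · linarith [hδ0 i]
    · linarith [hδρ i]
  set G : ℝ → ℝ := fun x => ∑ i, c' i * (deriv f (x + δ i) - deriv f x) with hG
  have hGan : AnalyticOnNhd ℝ G D := by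
    intro x hx
    refine Finset.analyticAt_fun_sum _ fun i _ => analyticAt_const.mul (AnalyticAt.sub ?_ ?_)
    · exact (hf.deriv _ (hx.2 i)).comp (f := fun y => y + δ i) (by fun_prop)
    · exact hf.deriv _ hx.1
  have hGloc : G =ᶠ[nhds 0] 0 := by
    have h1 : ∀ᶠ t : ℝ in nhds 0, |t| < ρ :=
      continuous_abs.continuousAt.eventually_lt_const (by simpa using hρ0)
    filter_upwards [h1] with x hx
    have h2 := hc x (by
      rw [Complex.norm_real, Real.norm_eq_abs]
      linarith)
    have hreal : ∀ y : ℝ, |y| < R → deriv F y = deriv f y := fun y hy =>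
      deriv_extension_eq hF hsymm hFf hy
    have h3 : ∑ j, (c j : ℂ) * (deriv F (x + δ (Fin.castLE hs j)) - deriv F x) =
        ((∑ j, c j * (deriv f (x + δ (Fin.castLE hs j)) - deriv f x) : ℝ) : ℂ) := by
      push_cast
      refine Finset.sum_congr rfl fun j _ => ?_
      rw [hreal x (by linarith), ← hreal (x + δ (Fin.castLE hs j)) ?_]
      · push_cast
        rfl
      · refine (abs_add_le _ _).trans_lt ?_
        rw [abs_of_pos (hδ0 _)]
        linarith [hδρ (Fin.castLE hs j)]
    rw [h3] at h2
    rw [hG]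
    simp only
    rw [hsum fun i => deriv f (x + δ i) - deriv f x]
    exact_mod_cast h2
  have hG0 : Set.EqOn G 0 D := hGan.eqOn_zero_of_preconnected_of_eventuallyEq_zero
    (ordConnected_commonDomain hUint δ).isPreconnected h0D hGloc
  have h4 := Fintype.linearIndependent_iff.1 hli c' (by
    funext x
    have h5 := hG0 x.2
    simp only [Finset.sum_apply, Pi.smul_apply, Set.domRestrict_apply, smul_eq_mul,
      iteratedDeriv_one]
    refine Eq.trans ?_ h5
    refine Finset.sum_congr rfl fun i _ => ?_
    rw [(hasDerivAt_discreteDeriv hf x.2.1 (x.2.2 i)).deriv]) (Fin.castLE hs (Fin.last s))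
  rw [hc'e, hc1] at h4
  exact one_ne_zero h4

/-! ### Power-like combinations of differences -/

theorem norm_mem_of_mem_sector {α β : ℝ} {z : ℂ} (hz : z ∈ sector α β (1 / 2)) :
    α / 2 ≤ ‖z‖ ∧ ‖z‖ ≤ 2 * β := by
  obtain ⟨x, hx, hxz⟩ := hz
  have hx0 : 0 < x := by
    have := (norm_nonneg _).trans_lt hxz
    linarith
  have h1 := norm_sub_norm_le z x
  have h2 := norm_sub_norm_le (x : ℂ) z
  rw [norm_sub_rev] at h2
  rw [Complex.norm_real, Real.norm_of_nonneg hx0.le] at h1 h2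
  constructor <;> linarith [hx.1, hx.2]

/-- Unitriangular combinations of the differences of `F` with small steps are power-like primitives
with distinct exponents on sectors away from the origin. -/
theorem exists_powerPrimitive_combination {n : ℕ} {F : ℂ → ℂ} {R : ℝ} (hR : 0 < R)
    (hF : DifferentiableOn ℂ F (Metric.ball 0 R)) (hsymm : ConjSymm (Metric.ball 0 R) F)
    (hind : ∀ s < n, ∀ b : Fin s → ℝ,
      ¬ ∀ z ∈ Metric.ball (0 : ℂ) R, linDiffOp b (deriv F) z = 0) :
    ∃ p : Fin n → ℕ, Function.Injective p ∧ ∀ ε > 0, ∃ L > 0, ∃ r > 0, ∀ (Δ : ℝ) (δ : Fin n → ℝ),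
      Δ ≤ r → Function.Injective δ → (∀ j, 0 < δ j) → (∀ j, δ j ≤ Δ) →
      ∃ (C : Fin n → Fin n → ℝ) (κ : Fin n → ℝ), (∀ i, C i i = 1) ∧ (∀ i j, i < j → C i j = 0) ∧
        ∀ α β : ℝ, L * Δ ≤ α → β ≤ r → ∀ i, PowerPrimitive (sector α β (1 / 2)) (p i) (κ i) ε
          fun z => ∑ j, (C i j : ℂ) * (F (z + δ j) - F z) := by
  have hball : ∀ z ∈ Metric.ball (0 : ℂ) R, (starRingEnd ℂ) z ∈ Metric.ball (0 : ℂ) R := by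
    intro z hz
    rw [mem_ball_zero_iff] at hz ⊢
    rwa [Complex.norm_conj]
  have hw := hF.deriv Metric.isOpen_ball
  obtain ⟨p, hp, hlead⟩ := exists_distinct_leading_terms hR hw
    (hsymm.deriv Metric.isOpen_ball hball) hind
  refine ⟨p, hp, fun ε hε => ?_⟩
  choose b c₀ hc₀ hv using hlead
  choose L hL r hr H using fun i => exists_combination_relClose hR hw (hc₀ i) (hv i) hε
  obtain ⟨r₀, hr₀, hrr₀⟩ := exists_pos_forall_le r hr
  obtain ⟨L₀, hL₀⟩ : ∃ L₀, ∀ i, L i ≤ L₀ := ⟨∑ i, L i, fun i =>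
    Finset.single_le_sum (f := L) (fun j _ => (hL j).le) (Finset.mem_univ i)⟩
  set L₁ := max 1 L₀ with hL₁
  have hL₁0 : 0 < L₁ := lt_max_of_lt_left one_pos
  have hLL₁ : ∀ i, L i ≤ L₁ := fun i => (hL₀ i).trans (le_max_right _ _)
  refine ⟨2 * L₁, by positivity, min (r₀ / 2) (R / 8), by positivity, fun Δ δ hΔ hδ hδ0 hδΔ => ?_⟩
  have hΔr : Δ ≤ r₀ / 2 := hΔ.trans (min_le_left _ _)
  have hΔR : Δ ≤ R / 8 := hΔ.trans (min_le_right _ _)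
  choose c hc1 κ hκ hrel using fun i : Fin n => H i Δ (fun j => δ (Fin.castLE i.2 j))
    (by linarith [hrr₀ i]) (hδ.comp (Fin.castLE_injective _)) (fun j => hδ0 _) fun j => hδΔ _
  set C : Fin n → Fin n → ℝ := fun i => Function.extend (Fin.castLE i.2) (c i) 0 with hC
  have hCe : ∀ i j, C i (Fin.castLE i.2 j) = c i j := fun i j =>
    (Fin.castLE_injective i.2).extend_apply _ _ _
  have hC0 : ∀ i j, i < j → C i j = 0 := by
    intro i j hij
    rw [hC]
    simp only
    rw [Function.extend_apply']
    · rfl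
    · rintro ⟨l, rfl⟩
      rw [Fin.lt_def, Fin.val_castLE] at hij
      omega
  have hsum : ∀ (i : Fin n) (G : Fin n → ℂ), ∑ j, (C i j : ℂ) * G j =
      ∑ j, (c i j : ℂ) * G (Fin.castLE i.2 j) := by
    intro i G
    symm
    refine Fintype.sum_of_injective (Fin.castLE i.2) (Fin.castLE_injective i.2) _ _ ?_ ?_
    · intro j hj
      have : C i j = 0 := Function.extend_apply' _ _ _ fun ⟨l, hl⟩ => hj ⟨l, hl⟩
      rw [this]
      simp
    · intro j
      rw [hCe]
  refine ⟨C, κ, fun i => ?_, hC0, fun α β hα hβ i => ?_⟩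
  · have h1 : Fin.castLE i.2 (Fin.last i) = i := Fin.ext (by simp)
    have h2 := hCe i (Fin.last i)
    rwa [h1, hc1] at h2
  have hβr : β ≤ r₀ / 2 := hβ.trans (min_le_left _ _)
  have hβR : β ≤ R / 8 := hβ.trans (min_le_right _ _)
  have hmem : ∀ z ∈ sector α β (1 / 2), ‖z‖ < R / 2 := fun z hz => by
    linarith [(norm_mem_of_mem_sector hz).2]
  have hmem1 : ∀ z ∈ sector α β (1 / 2), z ∈ Metric.ball (0 : ℂ) R := fun z hz => by
    rw [mem_ball_zero_iff]
    linarith [hmem z hz]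
  have hmem2 : ∀ z ∈ sector α β (1 / 2), ∀ j, z + δ j ∈ Metric.ball (0 : ℂ) R := fun z hz j => by
    rw [mem_ball_zero_iff]
    refine (norm_add_le _ _).trans_lt ?_
    rw [Complex.norm_real, Real.norm_of_nonneg (hδ0 j).le]
    linarith [hmem z hz, hδΔ j]
  have hderiv : ∀ z ∈ sector α β (1 / 2), HasDerivAt
      (fun z => ∑ j, (C i j : ℂ) * (F (z + δ j) - F z))
      (∑ j, (C i j : ℂ) * (deriv F (z + δ j) - deriv F z)) z := by
    intro z hz
    refine HasDerivAt.fun_sum fun j _ => HasDerivAt.const_mul _ (HasDerivAt.fun_sub ?_ ?_)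
    · exact ((hF.differentiableAt (Metric.isOpen_ball.mem_nhds
        (hmem2 z hz j))).hasDerivAt).comp_add_const z _
    · exact (hF.differentiableAt (Metric.isOpen_ball.mem_nhds (hmem1 z hz))).hasDerivAt
  refine ⟨fun z hz => (hderiv z hz).differentiableAt.differentiableWithinAt, fun z hz => ?_,
    hκ i, fun z hz => ?_⟩
  · rw [map_sum]
    refine Finset.sum_congr rfl fun j _ => ?_
    rw [map_mul, map_sub, Complex.conj_ofReal, ← hsymm _ (hmem2 z hz j), ← hsymm _ (hmem1 z hz),
      map_add, Complex.conj_ofReal]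
  · rw [(hderiv z hz).deriv, hsum i fun j => deriv F (z + δ j) - deriv F z, zpow_natCast]
    have h1 := norm_mem_of_mem_sector hz
    by_cases hΔ0 : 0 ≤ Δ
    · refine hrel i z ?_ (by linarith [hrr₀ i])
      have : L i * Δ ≤ L₁ * Δ := by gcongr; exact hLL₁ i
      linarith
    · exact absurd ((hδ0 i).le.trans (hδΔ i)) hΔ0

/-- One of the differences `Δ_{δ_i} f` is rich on any finite set of points that are small, but large
compared with the steps `δ_i`. -/
theorem exists_rich_discreteDeriv {m : ℕ} {f : ℝ → ℝ} {F : ℂ → ℂ} {R : ℝ} (hR : 0 < R)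
    (hF : DifferentiableOn ℂ F (Metric.ball 0 R)) (hsymm : ConjSymm (Metric.ball 0 R) F)
    (hFf : ∀ x : ℝ, |x| < R → F x = f x)
    (hind : ∀ s < m + 1, ∀ b : Fin s → ℝ,
      ¬ ∀ z ∈ Metric.ball (0 : ℂ) R, linDiffOp b (deriv F) z = 0) :
    ∃ c > 0, ∃ L > 0, ∃ r > 0, ∀ (Δ : ℝ) (δ : Fin (m + 1) → ℝ), Δ ≤ r → Function.Injective δ →
      (∀ j, 0 < δ j) → (∀ j, δ j ≤ Δ) → ∀ X : Finset ℝ, X.Nonempty →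
      (X : Set ℝ) ⊆ Set.Icc (L * Δ) r →
      ∃ i, Rich m (discreteDeriv (δ i) f) X (c * (X.card : ℝ) ^ growthExponent (m + 1)) := by
  obtain ⟨p, hp, H⟩ := exists_powerPrimitive_combination hR hF hsymm hind
  obtain ⟨ε, hε, c, hc, HR⟩ := exists_rich_of_powerPrimitive m (fun i => (p i : ℤ))
    (fun i j h => hp (Int.ofNat_injective h)) (by omega) (1 / 2) (by norm_num) (by norm_num)
  obtain ⟨L, hL, r, hr, H⟩ := H ε hε
  refine ⟨c, hc, L, hL, min r (R / 4), by positivity, fun Δ δ hΔ hδ hδ0 hδΔ X hX hXI => ?_⟩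
  have hΔ0 : 0 < Δ := (hδ0 0).trans_le (hδΔ 0)
  obtain ⟨C, κ, hC1, hC0, hprim⟩ := H Δ δ (hΔ.trans (min_le_left _ _)) hδ hδ0 hδΔ
  have hprim := hprim (L * Δ) (min r (R / 4)) le_rfl (min_le_left _ _)
  -- invert the triangular matrix to recover the differences
  set M : Matrix (Fin (m + 1)) (Fin (m + 1)) ℝ := Matrix.of C with hM
  have htri : M.BlockTriangular OrderDual.toDual := fun i j hij => hC0 i j hij
  have hdet : M.det = 1 := by
    rw [Matrix.det_of_isLowerTriangular M htri]
    exact Finset.prod_eq_one fun i _ => hC1 i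
  have hunit : IsUnit M.det := by rw [hdet]; exact isUnit_one
  have : Invertible M := Matrix.invertibleOfIsUnitDet M hunit
  have htri' : (M⁻¹).BlockTriangular OrderDual.toDual :=
    Matrix.blockTriangular_inv_of_blockTriangular htri
  have hT0 : ∀ i j, i < j → M⁻¹ i j = 0 := fun i j hij => htri' hij
  have hT1 : ∀ i, M⁻¹ i i ≠ 0 := by
    intro i h
    have h1 : (M⁻¹ * M) i i = 1 := by rw [Matrix.nonsing_inv_mul M hunit, Matrix.one_apply_eq]
    rw [Matrix.mul_apply, Finset.sum_eq_zero] at h1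
    · exact zero_ne_one h1
    · intro j _
      rcases lt_trichotomy i j with hij | rfl | hij
      · rw [hT0 i j hij, zero_mul]
      · rw [h, zero_mul]
      · rw [show M j i = 0 from hC0 j i hij, mul_zero]
  obtain ⟨i, hi⟩ := HR (L * Δ) (min r (R / 4)) (by positivity) κ _ hprim (fun i j => M⁻¹ i j)
    (fun _ => 0) hT0 hT1 X hX hXI
  refine ⟨i, hi.congr fun x hx => ?_⟩
  have hx0 : 0 < x := (mul_pos hL hΔ0).trans_le (hXI hx).1
  have hxR : x ≤ R / 4 := (hXI hx).2.trans (min_le_right _ _)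
  have hreal : ∀ j, F (x + δ j) - F x = ((discreteDeriv (δ j) f x : ℝ) : ℂ) := by
    intro j
    have h1 : Δ ≤ R / 4 := hΔ.trans (min_le_right _ _)
    have h2 := hFf (x + δ j) (by
      rw [abs_of_pos (add_pos hx0 (hδ0 j))]
      linarith [hδΔ j])
    rw [discreteDeriv, Complex.ofReal_sub, ← h2, ← hFf x (by rw [abs_of_pos hx0]; linarith)]
    push_cast
    rfl
  have hre : ∀ j, (∑ l, (C j l : ℂ) * (F (x + δ l) - F x)).re =
      (M.mulVec fun l => discreteDeriv (δ l) f x) j := by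
    intro j
    simp only [hreal]
    rw [← Complex.ofReal_re ((M.mulVec fun l => discreteDeriv (δ l) f x) j), Matrix.mulVec,
      dotProduct]
    push_cast
    rfl
  simp only [hre, add_zero]
  have h1 : (M⁻¹.mulVec (M.mulVec fun l => discreteDeriv (δ l) f x)) i =
      discreteDeriv (δ i) f x := by
    rw [Matrix.mulVec_mulVec, Matrix.nonsing_inv_mul M hunit, Matrix.one_mulVec]
  exact h1

/-! ### Strict monotonicity near the origin -/

theorem exists_strictMonoOn_Icc {f : ℝ → ℝ} (hf : AnalyticAt ℝ f 0)
    (hnz : ¬ ∀ᶠ x in nhds 0, deriv f x = 0) :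
    ∃ r > 0, StrictMonoOn f (Set.Icc 0 r) ∨ StrictAntiOn f (Set.Icc 0 r) := by
  have h1 := hf.deriv.eventually_eq_zero_or_eventually_ne_zero.resolve_left hnz
  rw [eventually_nhdsWithin_iff] at h1
  obtain ⟨r, hr, h2⟩ := Metric.eventually_nhds_iff.1 (h1.and hf.eventually_analyticAt)
  have h3 : ∀ x ∈ Set.Icc 0 (r / 2), dist x 0 < r := fun x hx => by
    rw [dist_zero_right, Real.norm_of_nonneg hx.1]
    linarith [hx.2]
  have hcont : ContinuousOn f (Set.Icc 0 (r / 2)) := fun x hx =>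
    (h2 (h3 x hx)).2.continuousAt.continuousWithinAt
  refine ⟨r / 2, half_pos hr, ?_⟩
  rcases hasDerivWithinAt_forall_lt_or_forall_gt_of_forall_ne (m := 0) (f := f) (f' := deriv f)
    (convex_Ioo 0 (r / 2))
    (fun x hx => (h2 (h3 x ⟨hx.1.le, hx.2.le⟩)).2.differentiableAt.hasDerivAt.hasDerivWithinAt)
    (fun x hx => (h2 (h3 x ⟨hx.1.le, hx.2.le⟩)).1 hx.1.ne') with h | h
  · right
    exact strictAntiOn_of_deriv_neg (convex_Icc _ _) hcont fun x hx => by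
      rw [interior_Icc] at hx
      exact h x hx
  · left
    exact strictMonoOn_of_deriv_pos (convex_Icc _ _) hcont fun x hx => by
      rw [interior_Icc] at hx
      exact h x hx

theorem not_eventually_deriv_eq_zero {f : ℝ → ℝ} {F : ℂ → ℂ} {R : ℝ} (hR : 0 < R)
    (hF : DifferentiableOn ℂ F (Metric.ball 0 R)) (hsymm : ConjSymm (Metric.ball 0 R) F)
    (hFf : ∀ x : ℝ, |x| < R → F x = f x)
    (hind : ∀ b : Fin 0 → ℝ, ¬ ∀ z ∈ Metric.ball (0 : ℂ) R, linDiffOp b (deriv F) z = 0) :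
    ¬ ∀ᶠ x in nhds 0, deriv f x = 0 := by
  intro h
  have h0 : (0 : ℂ) ∈ Metric.ball (0 : ℂ) R := by simpa using hR
  have hw := hF.deriv Metric.isOpen_ball
  have h1 : ∀ᶠ x : ℝ in nhdsWithin 0 {0}ᶜ, deriv F x = 0 := by
    have h2 : ∀ᶠ x : ℝ in nhds 0, |x| < R :=
      continuous_abs.continuousAt.eventually_lt_const (by simpa using hR)
    refine ((h.and h2).filter_mono nhdsWithin_le_nhds).mono fun x hx => ?_
    rw [deriv_extension_eq hF hsymm hFf hx.2, hx.1, Complex.ofReal_zero]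
  have h2 : Filter.Tendsto (fun x : ℝ => (x : ℂ)) (nhdsWithin 0 {0}ᶜ) (nhdsWithin 0 {0}ᶜ) := by
    refine tendsto_nhdsWithin_iff.2 ⟨?_, ?_⟩
    · have := (Complex.continuous_ofReal.tendsto 0).mono_left
        (nhdsWithin_le_nhds (s := {0}ᶜ))
      simpa using this
    · filter_upwards [self_mem_nhdsWithin] with x hx
      simpa using hx
  have h3 : Set.EqOn (deriv F) 0 (Metric.ball 0 R) :=
    (hw.analyticOnNhd Metric.isOpen_ball).eqOn_zero_of_preconnected_of_frequently_eq_zero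
      (convex_ball _ _).isPreconnected h0 (h2.frequently h1.frequently)
  refine hind 0 fun z hz => ?_
  have h4 : deriv F =ᶠ[nhds z] fun _ => 0 :=
    Filter.eventually_of_mem (Metric.isOpen_ball.mem_nhds hz) h3
  simp only [linDiffOp, Finset.univ_eq_empty, Finset.sum_empty, add_zero, zero_add,
    iteratedDeriv_one]
  rw [h4.deriv_eq]
  simp

/-! ### Squeezing differences into the gaps of `f` -/

/-- The squeezing step for an increasing function: small elements generated by `Δ_{δ_i} f` on the
points where none of these functions is among its largest values are inserted after the values
`f(x)` at the points where `Δ_{δ_i} f` is large. -/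
theorem exists_large_sumDiffSet_of_strictMonoOn {m : ℕ} {f : ℝ → ℝ} {r c : ℝ} (hc : 0 < c)
    (hf : StrictMonoOn f (Set.Icc 0 r)) {V₀ : Set ℝ} {Δ : ℝ}
    {δ : Fin (m + 1) → ℝ} (hδ0 : ∀ i, 0 < δ i) (hδΔ : ∀ i, δ i ≤ Δ) {X : Finset ℝ}
    (hX0 : ∀ x ∈ X, 0 ≤ x) (hXr : ∀ x ∈ X, x + Δ ≤ r)
    (hgap : ∀ x ∈ X, ∀ x' ∈ X, x < x' → x + Δ ≤ x') (hXV : ∀ x ∈ X, x ∈ V₀)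
    (hXV' : ∀ x ∈ X, ∀ i, x + δ i ∈ V₀) (hcard : 4 * (m + 1) ≤ X.card)
    (H : ∀ Y ⊆ X, Y.Nonempty →
      ∃ i, Rich m (discreteDeriv (δ i) f) Y (c * (Y.card : ℝ) ^ growthExponent (m + 1))) :
    ∃ S : Finset ℝ, (S : Set ℝ) ⊆ sumDiffSet (2 ^ (m + 1)) (2 ^ (m + 1) - 1) (f '' V₀) ∧
      c / (8 * (m + 1 : ℕ) * 4 ^ growthExponent (m + 1)) *
        (X.card : ℝ) ^ (1 + growthExponent (m + 1)) ≤ S.card := by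
  obtain ⟨B, τ, Y, hYX, hBX, hBk, hBτ, hYτ, hYk⟩ := exists_small_values (Nat.succ_pos m)
    (fun i x => discreteDeriv (δ i) f x) (subset_refl X)
    (by linarith [(Nat.cast_nonneg X.card : (0 : ℝ) ≤ X.card)]) hcard
  have hX1 : (0 : ℝ) < X.card := by exact_mod_cast (by omega : 0 < X.card)
  have hY : Y.Nonempty := by
    rw [← Finset.card_pos]
    have : (0 : ℝ) < Y.card := by linarith
    exact_mod_cast this
  obtain ⟨i, S, hS1, hS2, hS3⟩ := H Y hYX hY
  have hmem : ∀ x ∈ X, ∀ d, 0 ≤ d → d ≤ Δ → x + d ∈ Set.Icc 0 r := fun x hx d h0 h1 =>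
    ⟨by linarith [hX0 x hx], by linarith [hXr x hx]⟩
  have hΔ : 0 ≤ Δ := (hδ0 i).le.trans (hδΔ i)
  have hmem0 : ∀ x ∈ X, x ∈ Set.Icc 0 r := fun x hx => by
    simpa using hmem x hx 0 le_rfl hΔ
  have hpos : ∀ x ∈ X, 0 < discreteDeriv (δ i) f x := fun x hx =>
    sub_pos.2 (hf (hmem0 x hx) (hmem x hx _ (hδ0 i).le (hδΔ i)) (by linarith [hδ0 i]))
  obtain ⟨S', h1, h2, -⟩ := squeeze_core (m := m) (V := f '' V₀)
    (D := discreteDeriv (δ i) f '' (Y : Set ℝ)) (B := B i) (S := S) (u := f) (τ := τ i)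
    (fun x hx => ⟨x, hXV x (hBX i hx), rfl⟩)
    (fun x hx x' hx' hlt => by
      have h3 := hBτ i x hx
      have h4 := hf.monotoneOn (hmem x (hBX i hx) _ (hδ0 i).le (hδΔ i)) (hmem0 x' (hBX i hx'))
        (by linarith [hgap x (hBX i hx) x' (hBX i hx') hlt, hδΔ i])
      simp only [discreteDeriv] at h3
      linarith)
    (fun s hs => by
      obtain ⟨x, hx, x', hx', h3, h4⟩ := hS2 s hs
      exact ⟨(hpos x (hYX hx)).trans_le h3, h4.trans (hYτ i x' hx')⟩) hS1
    (by
      rintro y ⟨x, hx, rfl⟩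
      exact sub_mem_sumDiffSet ⟨_, hXV' x (hYX hx) i, rfl⟩ ⟨_, hXV x (hYX hx), rfl⟩)
  refine ⟨S', h1, ?_⟩
  rw [h2]
  set φ := growthExponent (m + 1)
  have hφ0 : 0 ≤ φ := by linarith [one_le_growthExponent (m + 1)]
  push_cast only [Nat.cast_mul]
  calc c / (8 * (m + 1 : ℕ) * 4 ^ φ) * (X.card : ℝ) ^ (1 + φ)
      = (X.card : ℝ) / (8 * (m + 1 : ℕ)) * (c * ((X.card : ℝ) / 4) ^ φ) := by
        rw [Real.rpow_add hX1, Real.rpow_one, Real.div_rpow hX1.le (by norm_num)]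
        have : (0 : ℝ) < 4 ^ φ := by positivity
        field_simp
    _ ≤ (B i).card * (c * (Y.card : ℝ) ^ φ) := by
        gcongr
        exact hBk i
    _ ≤ (B i).card * S.card := by gcongr

theorem exists_large_sumDiffSet {m : ℕ} {f : ℝ → ℝ} {r c : ℝ} (hc : 0 < c)
    (hf : StrictMonoOn f (Set.Icc 0 r) ∨ StrictAntiOn f (Set.Icc 0 r)) {V₀ : Set ℝ} {Δ : ℝ}
    {δ : Fin (m + 1) → ℝ} (hδ0 : ∀ i, 0 < δ i) (hδΔ : ∀ i, δ i ≤ Δ) {X : Finset ℝ}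
    (hX0 : ∀ x ∈ X, 0 ≤ x) (hXr : ∀ x ∈ X, x + Δ ≤ r)
    (hgap : ∀ x ∈ X, ∀ x' ∈ X, x < x' → x + Δ ≤ x') (hXV : ∀ x ∈ X, x ∈ V₀)
    (hXV' : ∀ x ∈ X, ∀ i, x + δ i ∈ V₀) (hcard : 4 * (m + 1) ≤ X.card)
    (H : ∀ Y ⊆ X, Y.Nonempty →
      ∃ i, Rich m (discreteDeriv (δ i) f) Y (c * (Y.card : ℝ) ^ growthExponent (m + 1))) :
    ∃ S : Finset ℝ, (S : Set ℝ) ⊆ sumDiffSet (2 ^ (m + 1)) (2 ^ (m + 1) - 1) (f '' V₀) ∧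
      c / (8 * (m + 1 : ℕ) * 4 ^ growthExponent (m + 1)) *
        (X.card : ℝ) ^ (1 + growthExponent (m + 1)) ≤ S.card := by
  classical
  rcases hf with hf | hf
  · exact exists_large_sumDiffSet_of_strictMonoOn hc hf hδ0 hδΔ hX0 hXr hgap hXV hXV' hcard H
  · obtain ⟨S, h1, h2⟩ := exists_large_sumDiffSet_of_strictMonoOn (f := fun x => -f x) hc hf.neg
      hδ0 hδΔ hX0 hXr hgap hXV hXV' hcard fun Y hY hYne => by
        obtain ⟨i, hi⟩ := H Y hY hYne
        exact ⟨i, hi.neg.congr fun x _ => by simp only [discreteDeriv]; ring⟩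
    refine ⟨S.image fun x => -x, ?_, ?_⟩
    · intro z hz
      obtain ⟨s, hs, rfl⟩ := Finset.mem_image.1 (Finset.mem_coe.1 hz)
      refine sumDiffSet_mono ?_ (neg_mem_sumDiffSet_neg (h1 hs))
      rintro y ⟨x, hx, hxy⟩
      exact ⟨x, hx, by linarith⟩
    · rwa [Finset.card_image_of_injective _ neg_injective]

/-- The configuration obtained from a cluster of minimal length: a sequence of differences `x j`
with gaps at least `Δ`, which stay differences when one of the steps `δ i ≤ Δ` is added. -/
theorem exists_large_sumDiffSet_of_sequence {m : ℕ} {f : ℝ → ℝ} {r c L : ℝ} (hc : 0 < c)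
    (hf : StrictMonoOn f (Set.Icc 0 r) ∨ StrictAntiOn f (Set.Icc 0 r))
    (H : ∀ (Δ : ℝ) (δ : Fin (m + 1) → ℝ), Δ ≤ r → Function.Injective δ →
      (∀ j, 0 < δ j) → (∀ j, δ j ≤ Δ) → ∀ X : Finset ℝ, X.Nonempty →
      (X : Set ℝ) ⊆ Set.Icc (L * Δ) r →
      ∃ i, Rich m (discreteDeriv (δ i) f) X (c * (X.card : ℝ) ^ growthExponent (m + 1)))
    {V₀ : Set ℝ} {Δ : ℝ} {δ : Fin (m + 1) → ℝ} (hδ : Function.Injective δ) (hδ0 : ∀ i, 0 < δ i)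
    (hδΔ : ∀ i, δ i ≤ Δ) {x : ℕ → ℝ} {J l : ℕ} (hl : L ≤ l) (hx0 : x 0 = 0)
    (hstep : ∀ j < J, x j + Δ ≤ x (j + 1)) (hxJ : x J ≤ r / 2) (hxV : ∀ j ≤ J, x j ∈ V₀)
    (hxV' : ∀ j ≤ J, ∀ i, x j + δ i ∈ V₀) (hJ : 4 * (m + 1) + l ≤ J) :
    ∃ S : Finset ℝ, (S : Set ℝ) ⊆ sumDiffSet (2 ^ (m + 1)) (2 ^ (m + 1) - 1) (f '' V₀) ∧
      c / (8 * (m + 1 : ℕ) * 4 ^ growthExponent (m + 1)) *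
        ((J - l : ℕ) : ℝ) ^ (1 + growthExponent (m + 1)) ≤ S.card := by
  classical
  have hΔ0 : 0 < Δ := (hδ0 0).trans_le (hδΔ 0)
  have hdist : ∀ k j, j + k ≤ J → x j + k * Δ ≤ x (j + k) := by
    intro k
    induction k with
    | zero => intro j _; simp
    | succ k ih =>
      intro j hj
      have h1 := ih j (by omega)
      have h2 := hstep (j + k) (by omega)
      rw [← add_assoc j k 1]
      push_cast
      linarith
  have hpos : ∀ j ≤ J, j * Δ ≤ x j := fun j hj => by
    have := hdist j 0 (by omega)
    rwa [hx0, zero_add, zero_add] at this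
  have hlt : ∀ i j, i < j → j ≤ J → x i + Δ ≤ x j := by
    intro i j hij hj
    have h1 := hdist (j - i) i (by omega)
    rw [Nat.add_sub_cancel' hij.le] at h1
    have h2 : (1 : ℝ) ≤ ((j - i : ℕ) : ℝ) := by exact_mod_cast (by omega : 1 ≤ j - i)
    nlinarith
  have hinj : Set.InjOn x (Finset.Ioc l J : Finset ℕ) := by
    intro i hi j hj hij
    rw [Finset.mem_coe, Finset.mem_Ioc] at hi hj
    rcases lt_trichotomy i j with h | h | h
    · linarith [hlt i j h hj.2]
    · exact h
    · linarith [hlt j i h hi.2]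
  have hle : ∀ j ≤ J, x j ≤ r / 2 := by
    intro j hj
    rcases hj.lt_or_eq with h | rfl
    · linarith [hlt j J h le_rfl]
    · exact hxJ
  have hΔr : Δ ≤ r / 2 := by
    have h1 := hlt 0 1 one_pos (by omega)
    linarith [hle 1 (by omega)]
  have hr0 : 0 < r := by linarith
  have hcard : ((Finset.Ioc l J).image x).card = J - l := by
    rw [Finset.card_image_of_injOn hinj, Nat.card_Ioc]
  have := exists_large_sumDiffSet (X := (Finset.Ioc l J).image x) hc hf hδ0 hδΔ (V₀ := V₀)
    ?_ ?_ ?_ ?_ ?_ (by rw [hcard]; omega) ?_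
  · rwa [hcard] at this
  · intro y hy
    obtain ⟨j, hj, rfl⟩ := Finset.mem_image.1 hy
    exact le_trans (by positivity) (hpos j (Finset.mem_Ioc.1 hj).2)
  · intro y hy
    obtain ⟨j, hj, rfl⟩ := Finset.mem_image.1 hy
    linarith [hle j (Finset.mem_Ioc.1 hj).2]
  · intro y hy y' hy' h
    obtain ⟨j, hj, rfl⟩ := Finset.mem_image.1 hy
    obtain ⟨j', hj', rfl⟩ := Finset.mem_image.1 hy'
    rw [Finset.mem_Ioc] at hj hj'
    rcases lt_trichotomy j j' with h' | rfl | h'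
    · exact hlt _ _ h' hj'.2
    · exact absurd h (lt_irrefl _)
    · linarith [hlt _ _ h' hj.2]
  · intro y hy
    obtain ⟨j, hj, rfl⟩ := Finset.mem_image.1 hy
    exact hxV j (Finset.mem_Ioc.1 hj).2
  · intro y hy i
    obtain ⟨j, hj, rfl⟩ := Finset.mem_image.1 hy
    exact hxV' j (Finset.mem_Ioc.1 hj).2 i
  · intro Y hY hYne
    refine H Δ δ (by linarith) hδ hδ0 hδΔ Y hYne fun y hy => ?_
    obtain ⟨j, hj, rfl⟩ := Finset.mem_image.1 (hY hy)
    rw [Finset.mem_Ioc] at hj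
    refine ⟨?_, by linarith [hle j hj.2]⟩
    have h1 : L ≤ j := hl.trans (by exact_mod_cast hj.1.le)
    exact le_trans (by gcongr) (hpos j hj.2)

/-! ### Clusters of minimal length -/

theorem exists_enumeration (A : Finset ℝ) : ∃ a : ℕ → ℝ, (∀ k < A.card, a k ∈ A) ∧
    ∀ i j, i < j → j < A.card → a i < a j := by
  refine ⟨fun k => if h : k < A.card then A.orderEmbOfFin rfl ⟨k, h⟩ else 0, fun k hk => ?_,
    fun i j hij hj => ?_⟩
  · simp only [dif_pos hk]
    exact A.orderEmbOfFin_mem rfl _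
  · simp only [dif_pos hj, dif_pos (hij.trans hj)]
    exact (A.orderEmbOfFin rfl).strictMono hij

/-- Among `m + 2` consecutive points of `A`, a cluster of minimal length provides the steps `δ i`,
and the points on the longer side of the cluster, thinned out, provide the sequence `x`. -/
theorem exists_sequence_of_cluster (m : ℕ) {A : Finset ℝ} {ℓ : ℝ}
    (hA : ∀ x ∈ A, ∀ y ∈ A, x - y ≤ ℓ) (hcard : m + 2 ≤ A.card) :
    ∃ (Δ : ℝ) (δ : Fin (m + 1) → ℝ) (x : ℕ → ℝ) (J : ℕ), Function.Injective δ ∧ (∀ i, 0 < δ i) ∧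
      (∀ i, δ i ≤ Δ) ∧ x 0 = 0 ∧ (∀ j < J, x j + Δ ≤ x (j + 1)) ∧ x J ≤ ℓ ∧
      (∀ j ≤ J, x j ∈ (A : Set ℝ) - (A : Set ℝ)) ∧
      (∀ j ≤ J, ∀ i, x j + δ i ∈ (A : Set ℝ) - (A : Set ℝ)) ∧
      A.card ≤ 2 * (m + 1) * (J + 1) + m + 2 := by
  obtain ⟨a, haA, hlt⟩ := exists_enumeration A
  have hle : ∀ i j, i ≤ j → j < A.card → a i ≤ a j := fun i j hij hj => by
    rcases hij.lt_or_eq with h | rfl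
    · exact (hlt i j h hj).le
    · exact le_rfl
  obtain ⟨k, hk, hmin⟩ := Finset.exists_min_image (Finset.range (A.card - (m + 1)))
    (fun k => a (k + (m + 1)) - a k) ⟨0, Finset.mem_range.2 (by omega)⟩
  rw [Finset.mem_range] at hk
  have hmin' : ∀ k', k' + (m + 1) < A.card → a (k + (m + 1)) - a k ≤ a (k' + (m + 1)) - a k' :=
    fun k' hk' => hmin k' (Finset.mem_range.2 (by omega))
  set p := k + (m + 1) with hp
  rcases le_total (A.card - 1 - p) k with h | h
  · -- the cluster leaves more points on its left
    have hJ : k / (m + 1) * (m + 1) ≤ k := Nat.div_mul_le_self _ _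
    have hidx : ∀ j ≤ k / (m + 1), j * (m + 1) ≤ k := fun j hj =>
      (Nat.mul_le_mul_right _ hj).trans hJ
    refine ⟨a p - a k, fun i => a (k + 1 + i) - a k, fun j => a k - a (k - j * (m + 1)),
      k / (m + 1), ?_, ?_, ?_, by simp, ?_, ?_, ?_, ?_, ?_⟩
    · intro i j hij
      have h1 : a (k + 1 + i) = a (k + 1 + j) := by simpa using hij
      rcases lt_trichotomy i j with h2 | h2 | h2
      · exact absurd h1 (hlt _ _ (by omega) (by omega)).ne
      · exact h2
      · exact absurd h1 (hlt _ _ (by omega) (by omega)).ne'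
    · exact fun i => sub_pos.2 (hlt _ _ (by omega) (by omega))
    · intro i
      have := hle (k + 1 + i) p (by omega) (by omega)
      simp only
      linarith
    · intro j hj
      have h1 := hidx (j + 1) hj
      rw [add_mul, one_mul] at h1
      have h2 := hmin' (k - (j + 1) * (m + 1)) (by omega)
      rw [show k - (j + 1) * (m + 1) + (m + 1) = k - j * (m + 1) by
        rw [add_mul, one_mul]; omega] at h2
      simp only
      linarith
    · exact hA _ (haA _ (by omega)) _ (haA _ (by omega))
    · exact fun j hj => ⟨_, haA _ (by omega), _, haA _ (by omega), rfl⟩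
    · intro j hj i
      refine ⟨_, haA (k + 1 + i) (by omega), _, haA (k - j * (m + 1)) (by omega), ?_⟩
      simp only
      ring
    · have h1 := Nat.lt_div_mul_add (a := k) (b := m + 1) (by omega)
      have h2 : 2 * (m + 1) * (k / (m + 1) + 1) = 2 * (k / (m + 1) * (m + 1) + (m + 1)) := by ring
      omega
  · -- the cluster leaves more points on its right
    set q := A.card - 1 - p with hq
    have hJ : q / (m + 1) * (m + 1) ≤ q := Nat.div_mul_le_self _ _
    have hidx : ∀ j ≤ q / (m + 1), j * (m + 1) ≤ q := fun j hj =>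
      (Nat.mul_le_mul_right _ hj).trans hJ
    refine ⟨a p - a k, fun i => a p - a (k + i), fun j => a (p + j * (m + 1)) - a p,
      q / (m + 1), ?_, ?_, ?_, by simp, ?_, ?_, ?_, ?_, ?_⟩
    · intro i j hij
      have h1 : a (k + i) = a (k + j) := by simpa using hij
      rcases lt_trichotomy i j with h2 | h2 | h2
      · exact absurd h1 (hlt _ _ (by omega) (by omega)).ne
      · exact h2
      · exact absurd h1 (hlt _ _ (by omega) (by omega)).ne'
    · exact fun i => sub_pos.2 (hlt _ _ (by omega) (by omega))
    · intro i
      have := hle k (k + i) (by omega) (by omega)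
      simp only
      linarith
    · intro j hj
      have h1 := hidx (j + 1) hj
      rw [add_mul, one_mul] at h1
      have h2 := hmin' (p + j * (m + 1)) (by omega)
      rw [show p + j * (m + 1) + (m + 1) = p + (j + 1) * (m + 1) by ring] at h2
      simp only
      linarith
    · exact hA _ (haA _ (by omega)) _ (haA _ (by omega))
    · intro j hj
      have h1 := hidx j hj
      exact ⟨_, haA _ (by omega), _, haA _ (by omega), rfl⟩
    · intro j hj i
      have h1 := hidx j hj
      refine ⟨_, haA (p + j * (m + 1)) (by omega), _, haA (k + i) (by omega), ?_⟩
      simp only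
      ring
    · have h1 := Nat.lt_div_mul_add (a := q) (b := m + 1) (by omega)
      have h2 : 2 * (m + 1) * (q / (m + 1) + 1) = 2 * (q / (m + 1) * (m + 1) + (m + 1)) := by ring
      omega

theorem exists_short_subset {a b ℓ : ℝ} (hℓ : 0 < ℓ) (hab : a ≤ b) :
    ∃ K > (0 : ℝ), ∀ A : Finset ℝ, (A : Set ℝ) ⊆ Set.Icc a b →
      ∃ A' ⊆ A, (A.card : ℝ) ≤ K * A'.card ∧ ∀ x ∈ A', ∀ y ∈ A', x - y ≤ ℓ := by
  have hn : (0 : ℤ) ≤ ⌊(b - a) / ℓ⌋ := Int.floor_nonneg.2 (div_nonneg (by linarith) hℓ.le)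
  refine ⟨((Finset.Icc (0 : ℤ) ⌊(b - a) / ℓ⌋).card : ℝ), ?_, fun A hA => ?_⟩
  · exact_mod_cast Finset.card_pos.2 ⟨0, Finset.mem_Icc.2 ⟨le_rfl, hn⟩⟩
  · obtain ⟨i, -, hi⟩ := exists_large_fiber (X := A) (t := Finset.Icc (0 : ℤ) ⌊(b - a) / ℓ⌋)
      (c := fun x => ⌊(x - a) / ℓ⌋)
      (fun x hx => Finset.mem_Icc.2 ⟨Int.floor_nonneg.2
        (div_nonneg (by linarith [(hA hx).1]) hℓ.le),
        Int.floor_le_floor (by gcongr; exact (hA hx).2)⟩) ⟨0, Finset.mem_Icc.2 ⟨le_rfl, hn⟩⟩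
    refine ⟨_, Finset.filter_subset _ A, hi, fun x hx y hy => ?_⟩
    have h1 := (Finset.mem_filter.1 hx).2
    have h2 := (Finset.mem_filter.1 hy).2
    have h3 := Int.abs_sub_lt_one_of_floor_eq_floor (h1.trans h2.symm)
    have h4 := (abs_lt.1 h3).2
    rw [← sub_div, div_lt_one hℓ] at h4
    linarith

theorem sumDiffSet_nonempty {X : Set ℝ} (hX : X.Nonempty) (k l : ℕ) :
    (sumDiffSet k l X).Nonempty := by
  obtain ⟨x, hx⟩ := hX
  exact ⟨_, fun _ => x, fun _ => x, fun _ => hx, fun _ => hx, rfl⟩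

theorem theorem1p7 (n : ℕ) (hn : 1 ≤ n) (a b : ℝ) (hab : a ≤ b) (f : ℝ → ℝ)
    (U : Set ℝ) (hUopen : IsOpen U) (hUint : U.OrdConnected)
    (hU : Set.Icc a b - Set.Icc a b ⊆ U) (hf : AnalyticOnNhd ℝ f U)
    (hind : ∀ δ : Fin n → ℝ, Function.Injective δ →
      (∀ i, 0 < δ i ∧ δ i < Metric.diam (Set.Icc a b)) →
      KIndependentOn 1 (commonDomain U δ) (fun i => discreteDeriv (δ i) f)) :
    ∃ c : ℝ, 0 < c ∧ ∀ A : Finset ℝ, (A : Set ℝ) ⊆ Set.Icc a b →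
      c * (A.card : ℝ) ^ (1 + growthExponent n) ≤
        ((sumDiffSet (2 ^ n) (2 ^ n - 1) (f '' ((A : Set ℝ) - (A : Set ℝ)))).ncard : ℝ) := by
  obtain ⟨m, rfl⟩ := Nat.exists_eq_add_of_le' hn
  set φ := growthExponent (m + 1) with hφ
  have hφ1 : 1 ≤ φ := one_le_growthExponent _
  have hfin : ∀ A : Finset ℝ, (sumDiffSet (2 ^ (m + 1)) (2 ^ (m + 1) - 1)
      (f '' ((A : Set ℝ) - (A : Set ℝ)))).Finite := fun A =>
    sumDiffSet_finite ((A.finite_toSet.sub A.finite_toSet).image f)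
  -- a bounded number of points is dealt with by the trivial lower bound
  have hsmall : ∀ (A : Finset ℝ) (c : ℝ), 0 < c → c * (A.card : ℝ) ^ (1 + φ) ≤ 1 →
      c * (A.card : ℝ) ^ (1 + φ) ≤ ((sumDiffSet (2 ^ (m + 1)) (2 ^ (m + 1) - 1)
        (f '' ((A : Set ℝ) - (A : Set ℝ)))).ncard : ℝ) := by
    intro A c hc h
    rcases A.eq_empty_or_nonempty with rfl | hA
    · rw [Finset.card_empty, Nat.cast_zero, Real.zero_rpow (by linarith), mul_zero]
      exact Nat.cast_nonneg _
    · have hne : (A : Set ℝ).Nonempty := by simpa using hA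
      have h1 := (Set.ncard_pos (hfin A)).2 (sumDiffSet_nonempty ((hne.sub hne).image f) _ _)
      refine h.trans ?_
      exact_mod_cast h1
  rcases hab.eq_or_lt with rfl | hlt
  · refine ⟨1, one_pos, fun A hA => hsmall A 1 one_pos ?_⟩
    have h1 : A.card ≤ 1 := by
      refine Finset.card_le_one.2 fun x hx y hy => ?_
      have hx' := hA hx
      have hy' := hA hy
      rw [Set.Icc_self, Set.mem_singleton_iff] at hx' hy'
      rw [hx', hy']
    rw [one_mul]
    exact Real.rpow_le_one (Nat.cast_nonneg _) (by exact_mod_cast h1) (by linarith)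
  have h0U : (0 : ℝ) ∈ U := hU ⟨a, ⟨le_rfl, hab⟩, a, ⟨le_rfl, hab⟩, sub_self a⟩
  obtain ⟨R, hR, F, hF, hsymm, hFf⟩ := exists_complex_extension (hf 0 h0U)
  have hind' : ∀ s < m + 1, ∀ β : Fin s → ℝ,
      ¬ ∀ z ∈ Metric.ball (0 : ℂ) R, linDiffOp β (deriv F) z = 0 := fun s hs β =>
    linDiffOp_ne_zero_of_kIndependentOn hlt hUint hU hf hind hR hF hsymm hFf hs β
  obtain ⟨c, hc, L, hL, r, hr, H⟩ := exists_rich_discreteDeriv hR hF hsymm hFf hind'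
  obtain ⟨r', hr', hmono⟩ := exists_strictMonoOn_Icc (hf 0 h0U)
    (not_eventually_deriv_eq_zero hR hF hsymm hFf (hind' 0 (Nat.succ_pos m)))
  set ρ := min r r' with hρ
  have hρ0 : 0 < ρ := lt_min hr hr'
  have hsub : Set.Icc 0 ρ ⊆ Set.Icc 0 r' := Set.Icc_subset_Icc le_rfl (min_le_right _ _)
  obtain ⟨K, hK, hshort⟩ := exists_short_subset (half_pos hρ0) hab
  obtain ⟨l, hl⟩ := exists_nat_ge L
  -- beyond this size the sequence of thinned points is long enough
  set M : ℕ := 4 * (m + 1) * (4 * (m + 1) + l + 1) + 2 * (m + 2) with hM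
  have hM0 : (0 : ℝ) < M := by exact_mod_cast (by omega : 0 < M)
  set c₁ : ℝ := c / (8 * (m + 1 : ℕ) * 4 ^ φ) with hc₁
  have hc₁0 : 0 < c₁ := by positivity
  set c₂ := min (1 / (K * M) ^ (1 + φ)) (c₁ / (8 * (m + 1 : ℕ) * K) ^ (1 + φ)) with hc₂
  have hc₂0 : 0 < c₂ := by positivity
  refine ⟨c₂, hc₂0, fun A hA => ?_⟩
  rcases le_or_gt (A.card : ℝ) (K * M) with hcase | hcase
  · refine hsmall A c₂ hc₂0 ?_
    calc c₂ * (A.card : ℝ) ^ (1 + φ) ≤ 1 / (K * M) ^ (1 + φ) * (K * M) ^ (1 + φ) := by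
          gcongr
          exact min_le_left _ _
      _ = 1 := by
          have : (0 : ℝ) < (K * M) ^ (1 + φ) := by positivity
          field_simp
  · obtain ⟨A', hA', hcard, hA'ℓ⟩ := hshort A hA
    have hA'M : M < A'.card := by
      have h1 : K * M < K * A'.card := hcase.trans_le hcard
      exact_mod_cast lt_of_mul_lt_mul_left h1 hK.le
    obtain ⟨Δ, δ, x, J, hδ, hδ0, hδΔ, hx0, hstep, hxJ, hxV, hxV', hJ⟩ :=
      exists_sequence_of_cluster m hA'ℓ (by omega)
    have hJ1 : 4 * (m + 1) + l < J + 1 := by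
      by_contra hcon
      push Not at hcon
      have h1 : 2 * (m + 1) * (J + 1) ≤ 2 * (m + 1) * (4 * (m + 1) + l) :=
        Nat.mul_le_mul_left _ hcon
      nlinarith
    have hJ2 : A'.card ≤ 8 * (m + 1) * (J - l) := by
      obtain ⟨e, rfl⟩ := Nat.exists_eq_add_of_le (by omega : l ≤ J)
      rw [Nat.add_sub_cancel_left]
      nlinarith
    obtain ⟨S, hS1, hS2⟩ := exists_large_sumDiffSet_of_sequence hc
      (hmono.imp (fun h => h.mono hsub) fun h => h.mono hsub)
      (fun Δ δ h1 h2 h3 h4 X h5 h6 => H Δ δ (h1.trans (min_le_left _ _)) h2 h3 h4 X h5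
        (h6.trans (Set.Icc_subset_Icc le_rfl (min_le_left _ _))))
      hδ hδ0 hδΔ hl hx0 hstep hxJ hxV hxV' (by omega)
    have hA'c : (A' : Set ℝ) ⊆ A := by exact_mod_cast hA'
    have hSA : (S : Set ℝ) ⊆ sumDiffSet (2 ^ (m + 1)) (2 ^ (m + 1) - 1)
        (f '' ((A : Set ℝ) - (A : Set ℝ))) :=
      hS1.trans (sumDiffSet_mono (Set.image_mono (Set.sub_subset_sub hA'c hA'c)))
    have hcardS : S.card ≤ (sumDiffSet (2 ^ (m + 1)) (2 ^ (m + 1) - 1)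
        (f '' ((A : Set ℝ) - (A : Set ℝ)))).ncard := by
      rw [← Set.ncard_coe_finset S]
      exact Set.ncard_le_ncard hSA (hfin A)
    have hAJ : (A.card : ℝ) ≤ 8 * (m + 1 : ℕ) * K * (J - l : ℕ) := by
      have h1 : (A'.card : ℝ) ≤ 8 * (m + 1 : ℕ) * (J - l : ℕ) := by exact_mod_cast hJ2
      calc (A.card : ℝ) ≤ K * A'.card := hcard
        _ ≤ K * (8 * (m + 1 : ℕ) * (J - l : ℕ)) := by gcongr
        _ = _ := by ring
    have hK8 : (0 : ℝ) < 8 * (m + 1 : ℕ) * K := by positivity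
    calc c₂ * (A.card : ℝ) ^ (1 + φ)
        ≤ c₁ / (8 * (m + 1 : ℕ) * K) ^ (1 + φ) *
            (8 * (m + 1 : ℕ) * K * (J - l : ℕ)) ^ (1 + φ) := by
          gcongr
          exact min_le_right _ _
      _ = c₁ * ((J - l : ℕ) : ℝ) ^ (1 + φ) := by
          rw [Real.mul_rpow hK8.le (Nat.cast_nonneg _)]
          have : (0 : ℝ) < (8 * (m + 1 : ℕ) * K) ^ (1 + φ) := by positivity
          field_simp
      _ ≤ S.card := hS2
      _ ≤ _ := by exact_mod_cast hcardS
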